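/- **Setting.** Let $\mathcal X\subset\mathbb R^L$ be a Borel set and $p$ a probability measure on $\mathcal X$ with a density with respect to Lebesgue measure. $\Delta(\mathcal X)$ is the set of Borel probability measures on $\mathcal X$ and $\Delta(\Delta(\mathcal X))$ the set of Borel probability measures on $\Delta(\mathcal X)$. Given $W:\mathbb R^M\times\mathcal X\to\mathbb R$ and $G:\mathbb R^M\times\mathcal X\to\mathbb R^M$, let $a(\mu)$ be the solution of $\int G(a(\mu),X)\,d\mu(X)=0$ and $\bar W(\mu)=\int W(a(\mu),X)\,d\mu(X)$. An *optimal autoencoder* is a maximizer $\tau$ of $\int\bar W\,d\tau$ over all $\tau\in\Delta(\Delta(\mathcal X))$ with $\int\mu\,d\tau(\mu)=p$; it is part of the claim that for every such $\tau$ the action $a(\mu)$ exists and is unique and $W(a(\mu),\cdot)$ is $\mu$-integrable for $\tau$-almost every $\mu$, and that $\bar W$ is $\tau$-integrable. A *deterministic optimal autoencoder* is a Borel map $\mathcal A:\mathcal X\to\mathbb R^M$ such that $E[G(\mathcal A(X),X)\mid\mathcal A(X)]=0$ and the law of the conditional distribution of $X$ given $\mathcal A(X)$ is an optimal autoencoder.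 **Conditions on $G$ (with constant $\varepsilon>0$).** $G$ is Borel and continuously differentiable in $a$; either $z^\top D_aG(a,X)z\ge\varepsilon\|z\|^2$ for all $a,X,z$, or $-z^\top D_aG(a,X)z\ge\varepsilon\|z\|^2$ for all $a,X,z$; $\|D_aG(a,X)\|\le\varepsilon^{-1}$ in operator norm; and the solution $a_*(X)$ of $G(a_*(X),X)=0$ satisfies $E\|a_*(X)\|^2<\infty$. **Integrability (with constant $c$).** $W$ is jointly continuous and continuously differentiable in $a$; there are $\psi:\mathcal X\to\mathbb R_+$ with $\psi(X)\ge c\,\|a_*(X)\|^2$ and $\{\psi\le A\}$ compact for every $A>0$, and a convex increasing $f\ge1$ on $[0,\infty)$, such that $|W(a,X)|+\|D_aW(a,X)\|+\|D_aW(a,X)\|^2\le\psi(X)f(\|a\|^2)$ and $E[\psi^2(X)f(\psi(X))]<\infty$. **Theorem.** (i) If $G$ satisfies the above conditions with constant $\varepsilon$, and integrability holds with $c=\varepsilon^{-4}$, then an optimal autoencoder exists. (ii) Suppose that $M=L$, that $W=W(a)$ depends only on $a$, and that $G(a,X)=a-g(X)$, where $g:\mathcal X\to\mathbb R^L$ is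 bi-Lipschitz onto its image and $g(\mathcal X)$ is convex. Suppose that integrability holds with $c=1$ (here $a_*=g$), and that the inverse of $D_aW$ has finitely many continuous branches: there are finitely many continuous maps $B_i:D_i\to\mathbb R^L$, $D_i\subset\mathbb R^L$, such that $D_aW(a)=b$ if and only if $b\in D_i$ and $a=B_i(b)$ for some $i$. Then a deterministic optimal autoencoder $\mathcal A$ exists, and for it the map $F(x)=D_aW(\mathcal A(g^{-1}(x)))$ is, up to a null set of states, monotone with convex level sets: there is a set $S\subset\mathcal X$ of full $p$-measure such that $(F(x)-F(y))^\top(x-y)\ge0$ for all $x,y\in g(S)$, and for every $b\in\mathbb R^L$ the level set $\{x\in g(S):F(x)=b\}$ is the intersection of $g(S)$ with a convex set. -/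

import Mathlib

open MeasureTheory ProbabilityTheory
open scoped RealInnerProductSpace

noncomputable section

namespace Autoencoder

/-- The Euclidean space `ℝⁿ`. -/
abbrev E (n : ℕ) : Type := EuclideanSpace ℝ (Fin n)

section General

variable {L M : ℕ} {𝒳 : Set (E L)}

/-- `a` is an action for the posterior `μ` under the generalized unbiasedness constraint:
`∫ G(a, X) dμ(X) = 0`, the integral being absolutely convergent. -/
def IsAction (G : E M → 𝒳 → E M) (μ : Measure 𝒳) (a : E M) : Prop :=
  Integrable (G a) μ ∧ ∫ x, G a x ∂μ = 0

open Classical in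
/-- The action `a(μ)`. It is used only for posteriors that have exactly one action; the value `0`
for posteriors without an action is a placeholder. -/
def action (G : E M → 𝒳 → E M) (μ : Measure 𝒳) : E M :=
  if h : ∃ a, IsAction G μ a then h.choose else 0

/-- `W̄(μ) = ∫ W(a(μ), X) dμ(X)`. -/
def Wbar (W : E M → 𝒳 → ℝ) (G : E M → 𝒳 → E M) (μ : ProbabilityMeasure 𝒳) : ℝ :=
  ∫ x, W (action G (μ : Measure 𝒳)) x ∂(μ : Measure 𝒳)

/-- The constraint `∫ μ dτ(μ) = p` on `τ ∈ Δ(Δ(𝒳))`. -/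
def IsFeasible (p : ProbabilityMeasure 𝒳) (τ : ProbabilityMeasure (ProbabilityMeasure 𝒳)) : Prop :=
  ∀ s : Set 𝒳, MeasurableSet s →
    (∫⁻ μ : ProbabilityMeasure 𝒳, (μ : Measure 𝒳) s ∂(τ : Measure (ProbabilityMeasure 𝒳)))
      = (p : Measure 𝒳) s

/-- The objective `∫ W̄(μ) dτ(μ)`. -/
def objective (W : E M → 𝒳 → ℝ) (G : E M → 𝒳 → E M)
    (τ : ProbabilityMeasure (ProbabilityMeasure 𝒳)) : ℝ :=
  ∫ μ, Wbar W G μ ∂(τ : Measure (ProbabilityMeasure 𝒳))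

/-- Every quantity in the objective at `τ` is meaningful: `τ`-almost every posterior `μ` has exactly
one action `a(μ)`, `W(a(μ), ·)` is `μ`-integrable, and `W̄` is `τ`-integrable. -/
def ObjectiveDefined (W : E M → 𝒳 → ℝ) (G : E M → 𝒳 → E M)
    (τ : ProbabilityMeasure (ProbabilityMeasure 𝒳)) : Prop :=
  (∀ᵐ μ : ProbabilityMeasure 𝒳 ∂(τ : Measure (ProbabilityMeasure 𝒳)),
    (∃! a, IsAction G (μ : Measure 𝒳) a) ∧
      Integrable (W (action G (μ : Measure 𝒳))) (μ : Measure 𝒳)) ∧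
  Integrable (Wbar W G) (τ : Measure (ProbabilityMeasure 𝒳))

/-- `τ` is an optimal autoencoder: it is feasible, the objective is meaningful and finite at every
feasible competitor (so at `τ` too), and no competitor does better. -/
structure IsOptimal (W : E M → 𝒳 → ℝ) (G : E M → 𝒳 → E M) (p : ProbabilityMeasure 𝒳)
    (τ : ProbabilityMeasure (ProbabilityMeasure 𝒳)) : Prop where
  feasible : IsFeasible p τ
  defined : ∀ τ', IsFeasible p τ' → ObjectiveDefined W G τ'
  maximal : ∀ τ', IsFeasible p τ' → objective W G τ' ≤ objective W G τ

/-- The value of a Markov kernel as a point of `Δ(𝒳)`. -/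
def kernelPoint (κ : Kernel (E M) 𝒳) [IsMarkovKernel κ] (a : E M) : ProbabilityMeasure 𝒳 :=
  ⟨κ a, inferInstance⟩

/-- The Borel map `𝒜 : 𝒳 → ℝᴹ` is a deterministic optimal autoencoder. Here `κ` is a regular
conditional distribution of `X` given `𝒜(X)` under `p`; the code `𝒜(X)` is the action of the
posterior that it induces, `E[G(𝒜(X), X') | 𝒜(X)] = 0`; and the law of the posterior is an optimal
element of `Δ(Δ(𝒳))`. -/
def IsDeterministicOptimal (W : E M → 𝒳 → ℝ) (G : E M → 𝒳 → E M) (p : ProbabilityMeasure 𝒳)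
    (𝒜 : 𝒳 → E M) : Prop :=
  Measurable 𝒜 ∧
  ∃ (κ : Kernel (E M) 𝒳) (_ : IsMarkovKernel κ),
    (p : Measure 𝒳).map (fun x => (𝒜 x, x)) = ((p : Measure 𝒳).map 𝒜) ⊗ₘ κ ∧
    (∀ᵐ x ∂(p : Measure 𝒳), IsAction G (κ (𝒜 x)) (𝒜 x)) ∧
    ∃ τ : ProbabilityMeasure (ProbabilityMeasure 𝒳),
      (τ : Measure (ProbabilityMeasure 𝒳))
        = (p : Measure 𝒳).map (fun x => kernelPoint κ (𝒜 x)) ∧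
      IsOptimal W G p τ

/-- The conditions on the constraint map `G`, with monotonicity constant `ε`; `aStar X` is the
solution of `G(aStar X, X) = 0`. Replacing `G` by `-G` does not change the problem, so monotonicity
is asked of one of the two. -/
structure ConstraintAssumption (G : E M → 𝒳 → E M) (p : ProbabilityMeasure 𝒳)
    (aStar : 𝒳 → E M) (ε : ℝ) : Prop where
  measurable : Measurable (Function.uncurry G)
  contDiff : ∀ x, ContDiff ℝ 1 (fun a => G a x)
  eps_pos : 0 < ε
  monotone :
    (∀ x a z, ε * ‖z‖ ^ 2 ≤ ⟪z, fderiv ℝ (fun b => G b x) a z⟫) ∨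
    (∀ x a z, ε * ‖z‖ ^ 2 ≤ -⟪z, fderiv ℝ (fun b => G b x) a z⟫)
  bounded : ∀ x a, ‖fderiv ℝ (fun b => G b x) a‖ ≤ ε⁻¹
  solves : ∀ x, G (aStar x) x = 0
  square_integrable : MemLp aStar 2 (p : Measure 𝒳)

/-- The integrability conditions on `W`, where `ψ(X) ≥ c ‖aStar(X)‖²`. -/
structure IntegrabilityAssumption (W : E M → 𝒳 → ℝ) (p : ProbabilityMeasure 𝒳)
    (aStar : 𝒳 → E M) (c : ℝ) : Prop where
  continuous : Continuous (Function.uncurry W)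
  contDiff : ∀ x, ContDiff ℝ 1 (fun a => W a x)
  growth : ∃ (ψ : 𝒳 → ℝ) (f : ℝ → ℝ),
    (∀ x, c * ‖aStar x‖ ^ 2 ≤ ψ x) ∧ (∀ x, 0 ≤ ψ x) ∧
    (∀ A : ℝ, 0 < A → IsCompact {x : 𝒳 | ψ x ≤ A}) ∧
    ConvexOn ℝ (Set.Ici 0) f ∧ MonotoneOn f (Set.Ici 0) ∧ (∀ t, 0 ≤ t → 1 ≤ f t) ∧
    (∀ a x, |W a x| + ‖fderiv ℝ (fun b => W b x) a‖ + ‖fderiv ℝ (fun b => W b x) a‖ ^ 2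
      ≤ ψ x * f (‖a‖ ^ 2)) ∧
    Integrable (fun x => ψ x ^ 2 * f (ψ x)) (p : Measure 𝒳)

end General

/-- `F` has an inverse with finitely many continuous branches: there are continuous maps `Bᵢ` on
sets `Dᵢ`, finitely many, such that `F a = b` if and only if `a = Bᵢ b` for some `i` with `b ∈ Dᵢ`. -/
def FinitelyManyInverseBranches {n : ℕ} (F : E n → E n) : Prop :=
  ∃ (k : ℕ) (D : Fin k → Set (E n)) (B : Fin k → E n → E n),
    (∀ i, ContinuousOn (B i) (D i)) ∧ ∀ a b, F a = b ↔ ∃ i, b ∈ D i ∧ a = B i b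

/-- `F` is monotone on `S`: `(F x - F y)ᵀ (x - y) ≥ 0` for `x, y ∈ S`. -/
def MonotoneMapOn {n : ℕ} (F : E n → E n) (S : Set (E n)) : Prop :=
  ∀ x ∈ S, ∀ y ∈ S, 0 ≤ ⟪F x - F y, x - y⟫

/-- The level sets of `F` within `S` are convex relative to `S`: each is the intersection of `S`
with a convex set. -/
def ConvexLevelSetsOn {n : ℕ} (F : E n → E n) (S : Set (E n)) : Prop :=
  ∀ b, ∃ C : Set (E n), Convex ℝ C ∧ {x ∈ S | F x = b} = C ∩ S

end Autoencoder

end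

/-!
An autoencoder is studied through the joint law `γ` of the code (the action) and the state. The
admissible joint laws, `IsJoint`, are those with state marginal `p` under which the code is the
action of the posterior that it induces; both conditions are linear in `γ`, and so is the objective
`∫ W(a, X) dγ`.

*Existence.* A strongly monotone Lipschitz map has a unique zero
(`exists_zero_of_stronglyMonotone`), so every posterior that integrates `G(0, ·)` has exactly one
action, which depends measurably on the posterior (`RegularConstraint.measurable_action`). The
action satisfies `‖a(μ)‖² ≤ ∫ ψ dμ`, and Jensen's inequality for the convex function `t² f(t)`
turns the moment condition on the prior into a uniform bound for the integral of the superlinear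
weight `Growth.dom` over all admissible joint laws. Hence these laws are tight and `W` has
uniformly small tails. In a Polish topology that makes `G` jointly continuous and has the same
Borel sets the admissible joint laws form a compact set (`isCompact_isJoint`), on which the
objective is continuous. A maximizer exists, and by the Krein-Milman theorem one that is extreme
among the maximizers (`exists_extreme_joint`). Its posteriors form an optimal autoencoder
(`isOptimal_posteriorLaw`).

*Determinism.* Let `G(a, X) = a - g(X)` and let `Ξ` be the support of the code under an extreme best
joint law. Reassigning a few states to other codes does not help to first order, so almost every
state, given its code `a`, satisfies `T a' (g X) ≤ T a (g X)` for all `a' ∈ Ξ`, where `T a` is the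
tangent function of `W` at `a` (`IsBestSignal.ae_tangent_le`), and `T a' ≤ W` on `Ξ`
(`IsBestSignal.tangent_le`). The upper envelope of the functions `T a`, `a ∈ Ξ`, is convex, hence
differentiable almost everywhere. Therefore `∇W(a)` equals the gradient `β` of the envelope
at `g X` (`ae_isSharpAt`): although the code may be random, its slope is a function of the state.
Because `∇W` has finitely many inverse branches, the code then takes finitely many values given
the state, and these are Borel functions of `β`.

Suppose that two of these values have positive probability for a set of states of positive measure.
At most one of them can be `g X`; let `c` be one that is not. If `β` were injective on a set of
positive measure of such states, one could slide that set towards the points `c` by different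
amounts, and obtain infinitely many disjoint sets, of volume bounded from below, in a bounded region
(`volume_eq_zero_of_slide`). So no such set exists, and every such set of states can be split,
conditionally on `β`, into two parts of positive probability (`exists_injOn_of_not_split`). By a
conditional form of Lyapunov's theorem (`exists_condExp_mul_eq_zero`) there is then a nonzero
transfer of mass between the two atoms which preserves the constraint and the objective, as does its
opposite (`false_of_two_atoms`). This contradicts extremality, so the code is a function of the
state (`ae_deterministic`).

*Shape.* The tangent inequalities give the monotonicity of `∇W(𝒜)` by adding two of them, and
identify its level sets with the sets where a given tangent function is maximal, which are convex
(`monotoneMapOn_extend`, `convexLevelSetsOn_extend`).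
-/

namespace Autoencoder

open Filter Topology Set

set_option linter.unusedSectionVars false

/-! ### Strongly monotone maps and the action of a posterior -/

/-- A Lipschitz map of a Hilbert space which, up to a sign, is strongly monotone has a zero. -/
theorem exists_zero_of_stronglyMonotone {H : Type*} [NormedAddCommGroup H] [InnerProductSpace ℝ H]
    [CompleteSpace H] {h : H → H} {ε σ : ℝ} (hε : 0 < ε) (hσ : |σ| = 1)
    (lip : ∀ a b, ‖h a - h b‖ ≤ ε⁻¹ * ‖a - b‖)
    (mono : ∀ a b, ε * ‖a - b‖ ^ 2 ≤ σ * ⟪a - b, h a - h b⟫) : ∃ a, h a = 0 := by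
  -- For small `e`, the map `a ↦ a - e³ σ h(a)` is a contraction; its fixed points are zeros of `h`.
  set e := min ε 1 with he
  have he0 : 0 < e := lt_min hε one_pos
  have he1 : e ≤ 1 := min_le_right _ _
  have heε : e ≤ ε := min_le_left _ _
  have hσ2 : σ ^ 2 = 1 := by rw [← sq_abs, hσ]; norm_num
  let T : H → H := fun a => a - (e ^ 3 * σ) • h a
  have key : ∀ a b, ‖T a - T b‖ ^ 2 ≤ (1 - e ^ 4) * ‖a - b‖ ^ 2 := by
    intro a b
    have h1 : T a - T b = (a - b) - (e ^ 3 * σ) • (h a - h b) := by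
      simp only [T, smul_sub]; abel
    rw [h1, norm_sub_sq_real, inner_smul_right, norm_smul, mul_pow, Real.norm_eq_abs, sq_abs,
      mul_pow, hσ2, mul_one]
    have h2 := mono a b
    have h3 : ‖h a - h b‖ ≤ e⁻¹ * ‖a - b‖ :=
      (lip a b).trans (by gcongr)
    have h4 : ‖h a - h b‖ ^ 2 ≤ (e⁻¹ * ‖a - b‖) ^ 2 := by gcongr
    have h5 : e * ‖a - b‖ ^ 2 ≤ σ * ⟪a - b, h a - h b⟫ := le_trans (by gcongr) h2
    have h6 : (e ^ 3) ^ 2 * ‖h a - h b‖ ^ 2 ≤ e ^ 4 * ‖a - b‖ ^ 2 := by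
      calc (e ^ 3) ^ 2 * ‖h a - h b‖ ^ 2 ≤ (e ^ 3) ^ 2 * (e⁻¹ * ‖a - b‖) ^ 2 := by gcongr
        _ = e ^ 4 * ‖a - b‖ ^ 2 := by field_simp
    have h7 : e ^ 3 * (e * ‖a - b‖ ^ 2) ≤ e ^ 3 * (σ * ⟪a - b, h a - h b⟫) := by gcongr
    nlinarith
  have he4 : 0 ≤ 1 - e ^ 4 := by
    have := pow_le_one₀ (n := 4) he0.le he1
    linarith
  have hlip : LipschitzWith (Real.toNNReal (√(1 - e ^ 4))) T := by
    refine LipschitzWith.of_dist_le_mul fun a b => ?_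
    rw [dist_eq_norm, dist_eq_norm, Real.coe_toNNReal _ (Real.sqrt_nonneg _)]
    refine le_of_sq_le_sq ?_ (by positivity)
    rw [mul_pow, Real.sq_sqrt he4]
    exact key a b
  have hc : ContractingWith (Real.toNNReal (√(1 - e ^ 4))) T := by
    refine ⟨?_, hlip⟩
    rw [← NNReal.coe_lt_coe, Real.coe_toNNReal _ (Real.sqrt_nonneg _), NNReal.coe_one,
      Real.sqrt_lt' one_pos]
    have : 0 < e ^ 4 := by positivity
    linarith
  refine ⟨ContractingWith.fixedPoint T hc, ?_⟩
  have hf : T _ = _ := hc.fixedPoint_isFixedPt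
  have hσ0 : σ ≠ 0 := by rintro rfl; simp at hσ
  simp only [T, sub_eq_self, smul_eq_zero, mul_eq_zero, hσ0, or_false] at hf
  exact hf.resolve_left (pow_pos he0 3).ne'

section Posterior

variable {L M : ℕ} {𝒳 : Set (E L)}

/-- The integrated form of the conditions on the constraint map: `G` is Borel, uniformly Lipschitz
in the action and, up to a common sign `σ`, uniformly strongly monotone. -/
structure RegularConstraint (G : E M → 𝒳 → E M) (ε : ℝ) : Prop where
  measurable : Measurable (Function.uncurry G)
  pos : 0 < ε
  lipschitz : ∀ x a b, ‖G a x - G b x‖ ≤ ε⁻¹ * ‖a - b‖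
  monotone : ∃ σ : ℝ, |σ| = 1 ∧ ∀ x a b, ε * ‖a - b‖ ^ 2 ≤ σ * ⟪a - b, G a x - G b x⟫

/-- Strong monotonicity of the derivative gives strong monotonicity of the map, by the mean value
inequality along the segment from `b` to `a`. -/
theorem inner_sub_ge_of_fderiv {h : E M → E M} {ε σ : ℝ} (hd : Differentiable ℝ h)
    (hm : ∀ a z, ε * ‖z‖ ^ 2 ≤ σ * ⟪z, fderiv ℝ h a z⟫) (a b : E M) :
    ε * ‖a - b‖ ^ 2 ≤ σ * ⟪a - b, h a - h b⟫ := by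
  have hder : ∀ t : ℝ, HasDerivAt (fun t : ℝ => σ * ⟪a - b, h (b + t • (a - b))⟫)
      (σ * ⟪a - b, fderiv ℝ h (b + t • (a - b)) (a - b)⟫) t := by
    intro t
    have h1 : HasDerivAt (fun t : ℝ => b + t • (a - b)) (a - b) t := by
      simpa using ((hasDerivAt_id t).smul_const (a - b)).const_add b
    have h2 := (hd (b + t • (a - b))).hasFDerivAt.comp_hasDerivAt t h1
    have h3 := (innerSL ℝ (a - b)).hasFDerivAt.comp_hasDerivAt t h2
    exact (h3.const_mul σ)
  have := Convex.mul_sub_le_image_sub_of_le_deriv (convex_univ) (f := fun t : ℝ =>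
      σ * ⟪a - b, h (b + t • (a - b))⟫) (C := ε * ‖a - b‖ ^ 2)
      (fun t _ => (hder t).continuousAt.continuousWithinAt)
      (fun t _ => (hder t).differentiableAt.differentiableWithinAt)
      (fun t _ => by rw [(hder t).deriv]; exact hm _ _) 0 (mem_univ _) 1 (mem_univ _) zero_le_one
  simp only [sub_zero, mul_one, one_smul, add_sub_cancel, zero_smul, add_zero] at this
  rw [inner_sub_right, mul_sub]
  exact this

theorem ConstraintAssumption.regular {G : E M → 𝒳 → E M} {p : ProbabilityMeasure 𝒳}
    {aStar : 𝒳 → E M} {ε : ℝ} (h : ConstraintAssumption G p aStar ε) : RegularConstraint G ε where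
  measurable := h.measurable
  pos := h.eps_pos
  lipschitz x a b :=
    Convex.norm_image_sub_le_of_norm_fderiv_le (𝕜 := ℝ)
      (fun c _ => ((h.contDiff x).differentiable one_ne_zero) c) (fun c _ => h.bounded x c)
      convex_univ (mem_univ b) (mem_univ a)
  monotone := by
    rcases h.monotone with hm | hm
    · refine ⟨1, by simp, fun x a b => inner_sub_ge_of_fderiv
        ((h.contDiff x).differentiable one_ne_zero) (fun a z => ?_) a b⟩
      simpa using hm x a z
    · refine ⟨-1, by simp, fun x a b => inner_sub_ge_of_fderiv
        ((h.contDiff x).differentiable one_ne_zero) (fun a z => ?_) a b⟩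
      simpa using hm x a z

namespace RegularConstraint

variable {G : E M → 𝒳 → E M} {ε : ℝ}

theorem measurable_apply (hG : RegularConstraint G ε) (a : E M) : Measurable (G a) :=
  hG.measurable.comp (measurable_const.prodMk measurable_id)

theorem norm_le (hG : RegularConstraint G ε) (a b : E M) (x : 𝒳) :
    ‖G a x‖ ≤ ‖G b x‖ + ε⁻¹ * ‖a - b‖ := by
  have h1 := hG.lipschitz x a b
  have h2 := norm_sub_norm_le (G a x) (G b x)
  linarith

theorem integrable_of (hG : RegularConstraint G ε) {μ : Measure 𝒳} [IsFiniteMeasure μ] {b : E M}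
    (h : Integrable (G b) μ) (a : E M) : Integrable (G a) μ := by
  refine Integrable.mono' (h.norm.add (integrable_const (ε⁻¹ * ‖a - b‖)))
    (hG.measurable_apply a).aestronglyMeasurable (ae_of_all _ fun x => hG.norm_le a b x)

theorem norm_integral_sub_le (hG : RegularConstraint G ε) {μ : Measure 𝒳} [IsProbabilityMeasure μ]
    (h : Integrable (G 0) μ) (a b : E M) :
    ‖∫ x, G a x ∂μ - ∫ x, G b x ∂μ‖ ≤ ε⁻¹ * ‖a - b‖ := by
  rw [← integral_sub (hG.integrable_of h a) (hG.integrable_of h b)]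
  simpa using norm_integral_le_of_norm_le_const (μ := μ) (ae_of_all _ fun x => hG.lipschitz x a b)

theorem integral_monotone (hG : RegularConstraint G ε) : ∃ σ : ℝ, |σ| = 1 ∧
    ∀ (μ : Measure 𝒳) [IsProbabilityMeasure μ], Integrable (G 0) μ → ∀ a b,
      ε * ‖a - b‖ ^ 2 ≤ σ * ⟪a - b, ∫ x, G a x ∂μ - ∫ x, G b x ∂μ⟫ := by
  obtain ⟨σ, hσ, hm⟩ := hG.monotone
  refine ⟨σ, hσ, fun μ _ h a b => ?_⟩
  have hi : Integrable (fun x => G a x - G b x) μ :=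
    (hG.integrable_of h a).sub (hG.integrable_of h b)
  rw [← integral_sub (hG.integrable_of h a) (hG.integrable_of h b),
    ← integral_inner (𝕜 := ℝ) hi, ← integral_const_mul]
  have := integral_mono (μ := μ) (integrable_const (ε * ‖a - b‖ ^ 2))
    ((hi.const_inner (𝕜 := ℝ) (a - b)).const_mul σ) (fun x => hm x a b)
  simpa using this

/-- Monotonicity controls the distance of two points by the distance of their values; with `b` an
action this bounds the error of an approximate action. -/
theorem norm_sub_le_integral (hG : RegularConstraint G ε) {μ : Measure 𝒳} [IsProbabilityMeasure μ]
    (h : Integrable (G 0) μ) (a b : E M) :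
    ε * ‖a - b‖ ≤ ‖∫ x, G a x ∂μ - ∫ x, G b x ∂μ‖ := by
  obtain ⟨σ, hσ, hm⟩ := hG.integral_monotone
  have h1 := hm μ h a b
  have h2 : σ * ⟪a - b, ∫ x, G a x ∂μ - ∫ x, G b x ∂μ⟫
      ≤ ‖a - b‖ * ‖∫ x, G a x ∂μ - ∫ x, G b x ∂μ‖ := by
    refine (le_abs_self _).trans ?_
    rw [abs_mul, hσ, one_mul]
    exact abs_real_inner_le_norm _ _
  rcases (norm_nonneg (a - b)).eq_or_lt with h0 | h0
  · rw [← h0, mul_zero]; positivity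
  · refine le_of_mul_le_mul_left ?_ h0
    nlinarith

theorem existsUnique_action (hG : RegularConstraint G ε) {μ : Measure 𝒳} [IsProbabilityMeasure μ]
    (h : Integrable (G 0) μ) : ∃! a, IsAction G μ a := by
  obtain ⟨σ, hσ, hm⟩ := hG.integral_monotone
  obtain ⟨a, ha⟩ := exists_zero_of_stronglyMonotone (h := fun a => ∫ x, G a x ∂μ) hG.pos hσ
    (hG.norm_integral_sub_le h) (hm μ h)
  refine ⟨a, ⟨hG.integrable_of h a, ha⟩, fun b hb => ?_⟩
  have := hG.norm_sub_le_integral h b a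
  rw [hb.2, ha, sub_zero, norm_zero] at this
  have h3 : ‖b - a‖ ≤ 0 := nonpos_of_mul_nonpos_right this hG.pos
  exact sub_eq_zero.1 (norm_le_zero_iff.1 h3)

theorem isAction_action (hG : RegularConstraint G ε) {μ : Measure 𝒳} [IsProbabilityMeasure μ]
    (h : Integrable (G 0) μ) : IsAction G μ (action G μ) := by
  have := (hG.existsUnique_action h).exists
  rw [action, dif_pos this]
  exact this.choose_spec

theorem integrable_zero (hG : RegularConstraint G ε) {μ : Measure 𝒳} [IsProbabilityMeasure μ]
    {a : E M} (h : IsAction G μ a) : Integrable (G 0) μ := hG.integrable_of h.1 0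

theorem action_eq (hG : RegularConstraint G ε) {μ : Measure 𝒳} [IsProbabilityMeasure μ]
    {a : E M} (h : IsAction G μ a) : action G μ = a :=
  (hG.existsUnique_action (hG.integrable_zero h)).unique
    (hG.isAction_action (hG.integrable_zero h)) h

theorem norm_action_le (hG : RegularConstraint G ε) {μ : Measure 𝒳} [IsProbabilityMeasure μ]
    {a : E M} (h : IsAction G μ a) : ‖a‖ ≤ ε⁻¹ * ∫ x, ‖G 0 x‖ ∂μ := by
  have h1 := hG.norm_sub_le_integral (hG.integrable_zero h) a 0
  rw [h.2, zero_sub, norm_neg, sub_zero] at h1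
  have h2 := h1.trans (norm_integral_le_integral_norm _)
  rw [inv_mul_eq_div, le_div_iff₀ hG.pos, mul_comm]
  exact h2

end RegularConstraint

/-- The identity kernel from posteriors to states, `μ ↦ μ`. -/
def posteriorKernel (X : Type*) [MeasurableSpace X] : Kernel (ProbabilityMeasure X) X where
  toFun μ := (μ : Measure X)
  measurable' := measurable_subtype_coe

instance (X : Type*) [MeasurableSpace X] : IsMarkovKernel (posteriorKernel X) :=
  ⟨fun μ => inferInstanceAs (IsProbabilityMeasure (μ : Measure X))⟩

/-- The action is a Borel function of the posterior: for a countable dense subset `D` of a closed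
set `F`, the action of `μ` lies in `F` if and only if `∫ G(d, X) dμ` comes arbitrarily close to
zero for `d ∈ D`. -/
theorem RegularConstraint.measurable_action {G : E M → 𝒳 → E M} {ε : ℝ}
    (hG : RegularConstraint G ε) :
    Measurable (fun μ : ProbabilityMeasure 𝒳 => action G (μ : Measure 𝒳)) := by
  refine measurable_of_isClosed fun F hF => ?_
  obtain ⟨D, hDF, hDc, hD⟩ := TopologicalSpace.IsSeparable.exists_countable_dense_subset
    (TopologicalSpace.IsSeparable.of_separableSpace F)
  set good : Set (ProbabilityMeasure 𝒳) := {μ | Integrable (G 0) (μ : Measure 𝒳)} with hgood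
  have hgm : MeasurableSet good := by
    have : good = {μ : ProbabilityMeasure 𝒳 | ∫⁻ x, ‖G 0 x‖ₑ ∂(μ : Measure 𝒳) < ⊤} := by
      ext μ
      exact ⟨fun h => h.2, fun h => ⟨(hG.measurable_apply 0).aestronglyMeasurable, h⟩⟩
    rw [this]
    exact measurableSet_lt ((Measure.measurable_lintegral (hG.measurable_apply 0).enorm).comp
      measurable_subtype_coe) measurable_const
  have hnm : ∀ d : E M, Measurable fun μ : ProbabilityMeasure 𝒳 =>
      ‖∫ x, G d x ∂(μ : Measure 𝒳)‖ := fun d =>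
    ((hG.measurable_apply d).stronglyMeasurable.integral_kernel
      (κ := posteriorKernel 𝒳)).measurable.norm
  have : (fun μ : ProbabilityMeasure 𝒳 => action G (μ : Measure 𝒳)) ⁻¹' F
      = (good ∩ ⋂ n : ℕ, ⋃ d ∈ D, {μ | ‖∫ x, G d x ∂(μ : Measure 𝒳)‖ < 1 / ((n : ℝ) + 1)})
        ∪ (goodᶜ ∩ {_μ | (0 : E M) ∈ F}) := by
    ext μ
    by_cases hμ : μ ∈ good
    · have hact := hG.isAction_action (μ := (μ : Measure 𝒳)) hμ
      simp only [mem_preimage, mem_union, mem_inter_iff, hμ, true_and, mem_compl_iff,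
        not_true_eq_false, false_and, or_false, mem_iInter, mem_iUnion, mem_ofPred_eq, exists_prop]
      constructor
      · intro ha n
        have hpos : (0 : ℝ) < ε * (1 / ((n : ℝ) + 1)) := mul_pos hG.pos (by positivity)
        obtain ⟨d, hd, hdist⟩ := Metric.mem_closure_iff.1 (hD ha) _ hpos
        refine ⟨d, hd, ?_⟩
        have h1 := hG.norm_integral_sub_le (μ := (μ : Measure 𝒳)) hμ d (action G (μ : Measure 𝒳))
        rw [hact.2, sub_zero] at h1
        refine h1.trans_lt ?_
        rw [dist_comm, dist_eq_norm] at hdist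
        rw [inv_mul_eq_div, div_lt_iff₀ hG.pos, mul_comm (1 / _)]
        exact hdist
      · intro h
        refine hF.closure_subset_iff.2 hDF (Metric.mem_closure_iff.2 fun δ hδ => ?_)
        obtain ⟨n, hn⟩ := exists_nat_one_div_lt (mul_pos hG.pos hδ)
        obtain ⟨d, hd, hdn⟩ := h n
        refine ⟨d, hd, ?_⟩
        have h1 := hG.norm_sub_le_integral (μ := (μ : Measure 𝒳)) hμ d (action G (μ : Measure 𝒳))
        rw [hact.2, sub_zero] at h1
        rw [dist_comm, dist_eq_norm]
        exact lt_of_mul_lt_mul_left (h1.trans_lt (hdn.trans hn)) hG.pos.le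
    · have h0 : action G (μ : Measure 𝒳) = 0 := by
        rw [action, dif_neg]
        rintro ⟨a, ha⟩
        exact hμ (hG.integrable_zero ha)
      simp [hμ, h0]
  rw [this]
  refine MeasurableSet.union (hgm.inter (MeasurableSet.iInter fun n =>
    MeasurableSet.biUnion hDc fun d _ => measurableSet_lt (hnm d) measurable_const)) ?_
  exact hgm.compl.inter (MeasurableSet.const _)

/-! ### Moment bounds for a single posterior -/

/-- The growth conditions in the form in which they are used: `ψ` dominates `ε⁻² ‖G(0, X)‖²`, and
`f` is convex and increasing on the whole line. -/
structure Growth (W : E M → 𝒳 → ℝ) (G : E M → 𝒳 → E M) (p : ProbabilityMeasure 𝒳) (ε : ℝ)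
    (ψ : 𝒳 → ℝ) (f : ℝ → ℝ) : Prop where
  continuous : Continuous (Function.uncurry W)
  measurable : Measurable ψ
  nonneg : ∀ x, 0 ≤ ψ x
  le : ∀ x, (ε⁻¹ * ‖G 0 x‖) ^ 2 ≤ ψ x
  convex : ConvexOn ℝ univ f
  mono : Monotone f
  one_le : ∀ t, 1 ≤ f t
  bound : ∀ a x, |W a x| ≤ ψ x * f (‖a‖ ^ 2)
  integrable : Integrable (fun x => ψ x ^ 2 * f (ψ x)) (p : Measure 𝒳)

/-- The factor `ε⁻⁴` is what makes `ψ` dominate `ε⁻² ‖G(0, X)‖²`: the Lipschitz condition gives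
`‖G(0, X)‖ ≤ ε⁻¹ ‖a_*(X)‖`. Outside `[0, ∞)` the function `f` is continued by its value at `0`. -/
theorem IntegrabilityAssumption.exists_growth {W : E M → 𝒳 → ℝ} {G : E M → 𝒳 → E M}
    {p : ProbabilityMeasure 𝒳} {aStar : 𝒳 → E M} {ε : ℝ} (hG : RegularConstraint G ε)
    (hs : ∀ x, G (aStar x) x = 0) (h : IntegrabilityAssumption W p aStar (ε ^ 4)⁻¹) :
    ∃ ψ f, Growth W G p ε ψ f := by
  obtain ⟨ψ, f, hψ, hψ0, hc, hconv, hmono, h1, hb, hi⟩ := h.growth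
  have hmax : ∀ {t : ℝ}, 0 ≤ t → max t 0 = t := fun ht => max_eq_left ht
  have hε := hG.pos
  refine ⟨ψ, fun t => f (max t 0), ⟨h.continuous, ?_, hψ0, fun x => ?_, ?_, ?_, ?_, fun a x => ?_,
    ?_⟩⟩
  · refine measurable_of_Iic fun A => ?_
    -- The sublevel sets of `ψ` at positive levels are compact, hence closed; the level `0` is
    -- reached by an intersection.
    rcases lt_or_ge A 0 with hA | hA
    · convert MeasurableSet.empty
      ext x
      simpa using hA.trans_le (hψ0 x)
    · have : ψ ⁻¹' Iic A = ⋂ n : ℕ, {x | ψ x ≤ A + 1 / ((n : ℝ) + 1)} := by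
        ext x
        simp only [mem_preimage, mem_Iic, mem_iInter, mem_ofPred_eq]
        refine ⟨fun hx n => hx.trans (by simpa using (by positivity : (0 : ℝ) ≤ 1 / ((n : ℝ) + 1))),
          fun hx => le_of_forall_pos_le_add fun δ hδ => ?_⟩
        obtain ⟨n, hn⟩ := exists_nat_one_div_lt hδ
        linarith [hx n]
      rw [this]
      exact MeasurableSet.iInter fun n => (hc _ (by positivity)).isClosed.measurableSet
  · have h2 := hG.lipschitz x 0 (aStar x)
    rw [hs x, sub_zero, zero_sub, norm_neg] at h2
    refine le_trans ?_ (hψ x)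
    calc (ε⁻¹ * ‖G 0 x‖) ^ 2 ≤ (ε⁻¹ * (ε⁻¹ * ‖aStar x‖)) ^ 2 := by gcongr
      _ = (ε ^ 4)⁻¹ * ‖aStar x‖ ^ 2 := by field_simp
  · have himg : (fun t : ℝ => max t 0) '' univ = Ici 0 := by
      ext t
      simp only [image_univ, mem_range, mem_Ici]
      exact ⟨fun ⟨y, hy⟩ => hy ▸ le_max_right _ _, fun ht => ⟨t, max_eq_left ht⟩⟩
    exact ConvexOn.comp (g := f) (f := fun t : ℝ => max t 0) (by rwa [himg])
      ((convexOn_id convex_univ).sup (convexOn_const 0 convex_univ)) (by rwa [himg])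
  · intro s t hst
    exact hmono (mem_Ici.2 (le_max_right _ _)) (mem_Ici.2 (le_max_right _ _))
      (max_le_max_right 0 hst)
  · exact fun t => h1 _ (le_max_right _ _)
  · have := hb a x
    rw [hmax (sq_nonneg ‖a‖)]
    have h3 := norm_nonneg (fderiv ℝ (fun b => W b x) a)
    nlinarith
  · refine hi.congr (ae_of_all _ fun x => ?_)
    simp only [hmax (hψ0 x)]

namespace Growth

variable {W : E M → 𝒳 → ℝ} {G : E M → 𝒳 → E M} {p : ProbabilityMeasure 𝒳} {ε : ℝ}
  {ψ : 𝒳 → ℝ} {f : ℝ → ℝ}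

/-- The function `t ↦ t₊² f(t)` whose moments control everything. -/
noncomputable def gauge (f : ℝ → ℝ) (t : ℝ) : ℝ := max t 0 ^ 2 * f t

theorem f_pos (h : Growth W G p ε ψ f) (t : ℝ) : 0 < f t := one_pos.trans_le (h.one_le t)

theorem continuous_f (h : Growth W G p ε ψ f) : Continuous f :=
  continuousOn_univ.1 (h.convex.continuousOn isOpen_univ)

theorem gauge_nonneg (h : Growth W G p ε ψ f) (t : ℝ) : 0 ≤ gauge f t :=
  mul_nonneg (sq_nonneg _) (h.f_pos t).le

theorem gauge_eq {t : ℝ} (ht : 0 ≤ t) : gauge f t = t ^ 2 * f t := by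
  rw [gauge, max_eq_left ht]

theorem monotone_gauge (h : Growth W G p ε ψ f) : Monotone (gauge f) := by
  intro s t hst
  have h0 : 0 ≤ max s 0 := le_max_right _ _
  have := h.f_pos s
  exact mul_le_mul (pow_le_pow_left₀ h0 (max_le_max_right 0 hst) 2) (h.mono hst) this.le
    (sq_nonneg _)

theorem convex_gauge (h : Growth W G p ε ψ f) : ConvexOn ℝ univ (gauge f) := by
  have h1 : ConvexOn ℝ univ (fun t : ℝ => max t 0) :=
    (convexOn_id convex_univ).sup (convexOn_const 0 convex_univ)
  have h2 : ConvexOn ℝ univ ((fun t : ℝ => max t 0) ^ 2) :=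
    h1.pow (fun t _ => le_max_right _ _) 2
  refine h2.mul h.convex (fun t _ => sq_nonneg _) (fun t _ => (h.f_pos t).le) ?_
  refine (Monotone.monovary ?_ h.mono).monovaryOn _
  intro s t hst
  exact pow_le_pow_left₀ (le_max_right _ _) (max_le_max_right 0 hst) 2

theorem continuous_gauge (h : Growth W G p ε ψ f) : Continuous (gauge f) :=
  continuousOn_univ.1 (h.convex_gauge.continuousOn isOpen_univ)

theorem integrable_gauge (h : Growth W G p ε ψ f) :
    Integrable (fun x => gauge f (ψ x)) (p : Measure 𝒳) :=
  h.integrable.congr (ae_of_all _ fun x => (gauge_eq (h.nonneg x)).symm)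

theorem psi_le (h : Growth W G p ε ψ f) (x : 𝒳) : ψ x ≤ 1 + gauge f (ψ x) := by
  rw [gauge_eq (h.nonneg x)]
  nlinarith [h.one_le (ψ x), h.nonneg x, sq_nonneg (ψ x - 1), mul_nonneg (sq_nonneg (ψ x))
    (sub_nonneg.2 (h.one_le (ψ x)))]

section Moments

variable {μ : Measure 𝒳} [IsProbabilityMeasure μ]

theorem integrable_psi (h : Growth W G p ε ψ f) (hμ : Integrable (fun x => gauge f (ψ x)) μ) :
    Integrable ψ μ := by
  refine Integrable.mono' ((integrable_const (1 : ℝ)).add hμ) h.measurable.aestronglyMeasurable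
    (ae_of_all _ fun x => ?_)
  rw [Real.norm_of_nonneg (h.nonneg x)]
  exact h.psi_le x

theorem integrable_sq (h : Growth W G p ε ψ f) (hG : RegularConstraint G ε)
    (hμ : Integrable (fun x => gauge f (ψ x)) μ) :
    Integrable (fun x => (ε⁻¹ * ‖G 0 x‖) ^ 2) μ := by
  refine Integrable.mono' (h.integrable_psi hμ)
    (((hG.measurable_apply 0).norm.const_mul _).pow_const 2).aestronglyMeasurable
    (ae_of_all _ fun x => ?_)
  rw [Real.norm_of_nonneg (sq_nonneg _)]
  exact h.le x

theorem integrable_zero (h : Growth W G p ε ψ f) (hG : RegularConstraint G ε)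
    (hμ : Integrable (fun x => gauge f (ψ x)) μ) : Integrable (G 0) μ := by
  have hε := hG.pos
  refine Integrable.mono' (((integrable_const (1 : ℝ)).add (h.integrable_sq hG hμ)).const_mul ε)
    (hG.measurable_apply 0).aestronglyMeasurable (ae_of_all _ fun x => ?_)
  have : ‖G 0 x‖ = ε * (ε⁻¹ * ‖G 0 x‖) := by field_simp
  rw [this]
  simp only [Pi.add_apply]
  refine mul_le_mul_of_nonneg_left ?_ hε.le
  nlinarith [sq_nonneg (ε⁻¹ * ‖G 0 x‖ - 1)]

/-- The bound `‖a‖ ≤ ε⁻¹ ∫ ‖G(0, X)‖ dμ` and Jensen's inequality for the square bound `‖a‖²` by the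
posterior mean of `ψ`. -/
theorem sq_norm_action_le (h : Growth W G p ε ψ f) (hG : RegularConstraint G ε)
    (hμ : Integrable (fun x => gauge f (ψ x)) μ) {a : E M} (ha : IsAction G μ a) :
    ‖a‖ ^ 2 ≤ ∫ x, ψ x ∂μ := by
  have hi : Integrable (fun x => ε⁻¹ * ‖G 0 x‖) μ := (h.integrable_zero hG hμ).norm.const_mul _
  have h1 := hG.norm_action_le ha
  rw [← integral_const_mul] at h1
  have h2 := (even_two.convexOn_pow (𝕜 := ℝ)).map_integral_le (μ := μ)
    (f := fun x => ε⁻¹ * ‖G 0 x‖) (continuous_pow 2).continuousOn isClosed_univ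
    (ae_of_all _ fun _ => mem_univ _) hi (h.integrable_sq hG hμ)
  calc ‖a‖ ^ 2 ≤ (∫ x, ε⁻¹ * ‖G 0 x‖ ∂μ) ^ 2 := by gcongr
    _ ≤ _ := h2
    _ ≤ ∫ x, ψ x ∂μ := integral_mono (h.integrable_sq hG hμ) (h.integrable_psi hμ) h.le

/-- Jensen's inequality turns the bound on `‖a‖²` into one on its gauge. -/
theorem gauge_action_le (h : Growth W G p ε ψ f) (hG : RegularConstraint G ε)
    (hμ : Integrable (fun x => gauge f (ψ x)) μ) {a : E M} (ha : IsAction G μ a) :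
    gauge f (‖a‖ ^ 2) ≤ ∫ x, gauge f (ψ x) ∂μ :=
  (h.monotone_gauge (h.sq_norm_action_le hG hμ ha)).trans
    (h.convex_gauge.map_integral_le h.continuous_gauge.continuousOn isClosed_univ
      (ae_of_all _ fun _ => mem_univ _) (h.integrable_psi hμ) hμ)

end Moments

/-- Superlinear dominating function: it controls the size of `W` and, by the weight
`ψ(X) + ‖a‖²`, its tails. -/
noncomputable def dom (ψ : 𝒳 → ℝ) (f : ℝ → ℝ) (z : E M × 𝒳) : ℝ :=
  (ψ z.2 + ‖z.1‖ ^ 2) * (ψ z.2 * f (‖z.1‖ ^ 2))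

theorem dom_nonneg (h : Growth W G p ε ψ f) (z : E M × 𝒳) : 0 ≤ dom ψ f z :=
  mul_nonneg (add_nonneg (h.nonneg _) (sq_nonneg _)) (mul_nonneg (h.nonneg _) (h.f_pos _).le)

/-- The weight is bounded by a function of the state plus a function of the action: replace the
smaller of `ψ(X)` and `‖a‖²` by the larger. -/
theorem dom_le (h : Growth W G p ε ψ f) (z : E M × 𝒳) :
    dom ψ f z ≤ 2 * gauge f (ψ z.2) + 2 * gauge f (‖z.1‖ ^ 2) := by
  rw [gauge_eq (h.nonneg _), gauge_eq (sq_nonneg _), dom]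
  set s := ψ z.2 with hs
  set t := ‖z.1‖ ^ 2 with ht
  have hs0 : 0 ≤ s := h.nonneg _
  have ht0 : 0 ≤ t := sq_nonneg _
  have hfs := h.f_pos s
  have hft := h.f_pos t
  rcases le_total s t with hst | hst
  · have h1 : (s + t) * (s * f t) ≤ (t + t) * (t * f t) := by gcongr
    nlinarith [mul_nonneg (sq_nonneg s) hfs.le]
  · have h1 : (s + t) * (s * f t) ≤ (s + s) * (s * f s) := by
      have := h.mono hst
      gcongr
    nlinarith [mul_nonneg (sq_nonneg t) hft.le]

theorem measurable_dom (h : Growth W G p ε ψ f) : Measurable (dom (M := M) ψ f) := by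
  have h1 := (h.measurable.comp measurable_snd : Measurable fun z : E M × 𝒳 => ψ z.2)
  have h2 : Measurable fun z : E M × 𝒳 => ‖z.1‖ ^ 2 := (measurable_fst.norm).pow_const 2
  exact (h1.add h2).mul (h1.mul (h.continuous_f.measurable.comp h2))

theorem abs_le_dom (h : Growth W G p ε ψ f) (z : E M × 𝒳) :
    |W z.1 z.2| ≤ f 1 + dom ψ f z := by
  refine (h.bound z.1 z.2).trans ?_
  have hs0 : 0 ≤ ψ z.2 := h.nonneg _
  have ht0 : 0 ≤ ‖z.1‖ ^ 2 := sq_nonneg _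
  have hft := h.f_pos (‖z.1‖ ^ 2)
  have h1 := h.f_pos 1
  rcases le_total (ψ z.2 + ‖z.1‖ ^ 2) 1 with hle | hle
  · have : ψ z.2 * f (‖z.1‖ ^ 2) ≤ 1 * f 1 := by
      have := h.mono (show ‖z.1‖ ^ 2 ≤ 1 by linarith)
      gcongr
      linarith
    linarith [h.dom_nonneg z]
  · have : 1 * (ψ z.2 * f (‖z.1‖ ^ 2)) ≤ dom ψ f z := by
      unfold dom; gcongr
    linarith

/-- Where `|W|` exceeds `R f(R)`, it is at most `R⁻¹` times the dominating function. -/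
theorem mul_abs_le_dom (h : Growth W G p ε ψ f) (z : E M × 𝒳) {R : ℝ}
    (hR : 0 ≤ R) (hz : R * f R < |W z.1 z.2|) : R * |W z.1 z.2| ≤ dom ψ f z := by
  have hb := h.bound z.1 z.2
  have hs0 : 0 ≤ ψ z.2 := h.nonneg _
  have ht0 : 0 ≤ ‖z.1‖ ^ 2 := sq_nonneg _
  have hft := h.f_pos (‖z.1‖ ^ 2)
  have hRle : R ≤ ψ z.2 + ‖z.1‖ ^ 2 := by
    by_contra! hlt
    have : ψ z.2 * f (‖z.1‖ ^ 2) ≤ R * f R := by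
      have := h.mono (show ‖z.1‖ ^ 2 ≤ R by linarith)
      gcongr
      linarith
    linarith
  unfold dom
  gcongr

theorem measurable_W (h : Growth W G p ε ψ f) : Measurable (Function.uncurry W) :=
  h.continuous.measurable

end Growth

/-! ### Signals and joint laws of actions and states -/

/-- The joint law `γ` of an action and a state is consistent with the prior and with the constraint:
its second marginal is `p`, and `E[φ(a) G(a, X)] = 0` for every continuous compactly supported
`φ`. -/
def IsJoint {X : Type*} [MeasurableSpace X] (G : E M → X → E M) (p : ProbabilityMeasure X)
    (γ : Measure (E M × X)) : Prop :=
  γ.snd = (p : Measure X) ∧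
    ∀ φ : E M → ℝ, Continuous φ → HasCompactSupport φ → ∫ z, φ z.1 • G z.1 z.2 ∂γ = 0

section Signal

variable {W : E M → 𝒳 → ℝ} {G : E M → 𝒳 → E M} {p : ProbabilityMeasure 𝒳} {ε : ℝ}
  {ψ : 𝒳 → ℝ} {f : ℝ → ℝ} {Ω : Type*} [MeasurableSpace Ω] {P : Measure Ω} [IsProbabilityMeasure P]
  {κ : Kernel Ω 𝒳} [IsMarkovKernel κ]

/-- The version of `MeasureTheory.Integrable.integral_compProd` for a measure and a kernel. -/
theorem integrable_integral_compProd {F : Type*} [NormedAddCommGroup F] [NormedSpace ℝ F]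
    {g : Ω × 𝒳 → F} (hg : Integrable g (P ⊗ₘ κ)) : Integrable (fun ω => ∫ x, g (ω, x) ∂κ ω) P := by
  simpa using MeasureTheory.Integrable.integral_compProd (κ := Kernel.const Unit P)
    (η := Kernel.prodMkLeft Unit κ) (a := ()) hg

theorem Growth.ae_integrable_gauge (h : Growth W G p ε ψ f) (hκ : κ ∘ₘ P = (p : Measure 𝒳)) :
    ∀ᵐ ω ∂P, Integrable (fun x => Growth.gauge f (ψ x)) (κ ω) :=
  Measure.ae_integrable_of_integrable_comp (by rw [hκ]; exact h.integrable_gauge)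

theorem Growth.ae_existsUnique (h : Growth W G p ε ψ f) (hG : RegularConstraint G ε)
    (hκ : κ ∘ₘ P = (p : Measure 𝒳)) : ∀ᵐ ω ∂P, ∃! a, IsAction G (κ ω) a := by
  filter_upwards [h.ae_integrable_gauge hκ] with ω hω
  exact hG.existsUnique_action (h.integrable_zero hG hω)

/-- The law of the pair (action, state) under a signal `ω` with posteriors `κ ω`. -/
noncomputable def jointLaw (P : Measure Ω) (κ : Kernel Ω 𝒳) (α : Ω → E M) : Measure (E M × 𝒳) :=
  (P ⊗ₘ κ).map fun z => (α z.1, z.2)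

theorem measurable_code {α : Ω → E M} (hα : Measurable α) :
    Measurable fun z : Ω × 𝒳 => (α z.1, z.2) :=
  (hα.comp measurable_fst).prodMk measurable_snd

theorem isProbabilityMeasure_jointLaw {α : Ω → E M} (hα : Measurable α) :
    IsProbabilityMeasure (jointLaw P κ α) :=
  Measure.isProbabilityMeasure_map (measurable_code hα).aemeasurable

/-- The integral of the weight over the joint law of any signal is bounded in terms of the prior
alone. -/
theorem Growth.integrable_dom (h : Growth W G p ε ψ f) (hG : RegularConstraint G ε)
    (hκ : κ ∘ₘ P = (p : Measure 𝒳)) {α : Ω → E M} (hα : Measurable α)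
    (hact : ∀ᵐ ω ∂P, IsAction G (κ ω) (α ω)) :
    Integrable (Growth.dom ψ f) (jointLaw P κ α) ∧
      ∫ z, Growth.dom ψ f z ∂(jointLaw P κ α)
        ≤ 4 * ∫ x, Growth.gauge f (ψ x) ∂(p : Measure 𝒳) := by
  have hg := h.integrable_gauge
  rw [← hκ] at hg
  have hsnd : Integrable (fun z : Ω × 𝒳 => Growth.gauge f (ψ z.2)) (P ⊗ₘ κ) :=
    Measure.integrable_compProd_snd_iff (h.continuous_gauge.measurable.comp
      h.measurable).aestronglyMeasurable |>.2 hg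
  have hG1 : Integrable (fun ω => ∫ x, Growth.gauge f (ψ x) ∂κ ω) P := by
    have := Measure.integrable_integral_norm_of_integrable_comp hg
    refine this.congr (ae_of_all _ fun ω => integral_congr_ae (ae_of_all _ fun x => ?_))
    exact Real.norm_of_nonneg (h.gauge_nonneg _)
  have hmα : Measurable fun ω => Growth.gauge f (‖α ω‖ ^ 2) :=
    h.continuous_gauge.measurable.comp (hα.norm.pow_const 2)
  have hle : ∀ᵐ ω ∂P, Growth.gauge f (‖α ω‖ ^ 2) ≤ ∫ x, Growth.gauge f (ψ x) ∂κ ω := by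
    filter_upwards [h.ae_integrable_gauge hκ, hact] with ω h1 h2
    exact h.gauge_action_le hG h1 h2
  have hG2 : Integrable (fun ω => Growth.gauge f (‖α ω‖ ^ 2)) P := by
    refine Integrable.mono' hG1 hmα.aestronglyMeasurable ?_
    filter_upwards [hle] with ω hω
    rwa [Real.norm_of_nonneg (h.gauge_nonneg _)]
  have hfst : Integrable (fun z : Ω × 𝒳 => Growth.gauge f (‖α z.1‖ ^ 2)) (P ⊗ₘ κ) := by
    have : P = (P ⊗ₘ κ).map Prod.fst := (Measure.fst_compProd P κ).symm
    rw [this] at hG2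
    exact hG2.comp_measurable measurable_fst
  have htot := (hsnd.const_mul 2).add (hfst.const_mul 2)
  have hD : Integrable (fun z : Ω × 𝒳 => Growth.dom ψ f (α z.1, z.2)) (P ⊗ₘ κ) := by
    refine Integrable.mono' htot
      (h.measurable_dom.comp (measurable_code hα)).aestronglyMeasurable (ae_of_all _ fun z => ?_)
    rw [Real.norm_of_nonneg (h.dom_nonneg _)]
    exact h.dom_le _
  constructor
  · exact (integrable_map_measure h.measurable_dom.aestronglyMeasurable
      (measurable_code hα).aemeasurable).2 hD
  · rw [jointLaw, integral_map (measurable_code hα).aemeasurable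
      h.measurable_dom.aestronglyMeasurable]
    have e1 : ∫ z, Growth.gauge f (ψ z.2) ∂(P ⊗ₘ κ)
        = ∫ x, Growth.gauge f (ψ x) ∂(p : Measure 𝒳) := by
      rw [← hκ, ← Measure.snd_compProd, Measure.snd, integral_map measurable_snd.aemeasurable]
      exact (h.continuous_gauge.measurable.comp h.measurable).aestronglyMeasurable
    have e2 : ∫ z, Growth.gauge f (‖α z.1‖ ^ 2) ∂(P ⊗ₘ κ)
        ≤ ∫ x, Growth.gauge f (ψ x) ∂(p : Measure 𝒳) := by
      calc ∫ z, Growth.gauge f (‖α z.1‖ ^ 2) ∂(P ⊗ₘ κ)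
          = ∫ ω, Growth.gauge f (‖α ω‖ ^ 2) ∂P := by
            rw [Measure.integral_compProd hfst]; simp
        _ ≤ ∫ ω, ∫ x, Growth.gauge f (ψ x) ∂κ ω ∂P := integral_mono_ae hG2 hG1 hle
        _ = _ := by rw [← Measure.integral_compProd hsnd, e1]
    calc ∫ z, Growth.dom ψ f (α z.1, z.2) ∂(P ⊗ₘ κ)
        ≤ ∫ z, (2 * Growth.gauge f (ψ z.2) + 2 * Growth.gauge f (‖α z.1‖ ^ 2)) ∂(P ⊗ₘ κ) :=
          integral_mono hD htot (fun z => h.dom_le _)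
      _ = 2 * ∫ z, Growth.gauge f (ψ z.2) ∂(P ⊗ₘ κ)
          + 2 * ∫ z, Growth.gauge f (‖α z.1‖ ^ 2) ∂(P ⊗ₘ κ) := by
          rw [integral_add (hsnd.const_mul 2) (hfst.const_mul 2), integral_const_mul,
            integral_const_mul]
      _ ≤ _ := by linarith

theorem Growth.integrable_W_of_dom (h : Growth W G p ε ψ f) {γ : Measure (E M × 𝒳)}
    [IsFiniteMeasure γ] (hd : Integrable (Growth.dom ψ f) γ) :
    Integrable (fun z => W z.1 z.2) γ :=
  Integrable.mono' ((integrable_const (f 1)).add hd) h.measurable_W.aestronglyMeasurable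
    (ae_of_all _ fun z => h.abs_le_dom z)

theorem integrable_smul_constraint (hG : RegularConstraint G ε) {γ : Measure (E M × 𝒳)}
    [IsFiniteMeasure γ] (hi : Integrable (fun z : E M × 𝒳 => G 0 z.2) γ) {φ : E M → ℝ}
    (hφ : Continuous φ) (hc : HasCompactSupport φ) :
    Integrable (fun z : E M × 𝒳 => φ z.1 • G z.1 z.2) γ := by
  obtain ⟨C, hC⟩ := hφ.bounded_above_of_compact_support hc
  obtain ⟨C', hC'⟩ := (hφ.mul continuous_norm).bounded_above_of_compact_support (hc.mul_right)
  have hC0 : 0 ≤ C := (norm_nonneg _).trans (hC 0)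
  have hε := hG.pos
  refine Integrable.mono' ((hi.norm.const_mul C).add (integrable_const (ε⁻¹ * C'))) ?_
    (ae_of_all _ fun z => ?_)
  · exact ((hφ.measurable.comp measurable_fst).smul hG.measurable).aestronglyMeasurable
  · rw [norm_smul]
    have h1 := hG.norm_le z.1 0 z.2
    rw [sub_zero] at h1
    have h2 := hC z.1
    have h3 := hC' z.1
    rw [Pi.mul_apply, norm_mul, norm_norm] at h3
    calc ‖φ z.1‖ * ‖G z.1 z.2‖ ≤ ‖φ z.1‖ * (‖G 0 z.2‖ + ε⁻¹ * ‖z.1‖) := by gcongr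
      _ = ‖φ z.1‖ * ‖G 0 z.2‖ + ε⁻¹ * (‖φ z.1‖ * ‖z.1‖) := by ring
      _ ≤ _ := by simp only [Pi.add_apply]; gcongr

theorem snd_jointLaw (hκ : κ ∘ₘ P = (p : Measure 𝒳)) {α : Ω → E M} (hα : Measurable α) :
    (jointLaw P κ α).snd = (p : Measure 𝒳) := by
  rw [jointLaw, Measure.snd, Measure.map_map measurable_snd (measurable_code hα)]
  exact (Measure.snd_compProd P κ).trans hκ

theorem Growth.integrable_zero_snd (h : Growth W G p ε ψ f) (hG : RegularConstraint G ε)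
    {γ : Measure (E M × 𝒳)} (hγ : γ.snd = (p : Measure 𝒳)) :
    Integrable (fun z : E M × 𝒳 => G 0 z.2) γ := by
  have := h.integrable_zero hG (μ := (p : Measure 𝒳)) h.integrable_gauge
  rw [← hγ] at this
  exact this.comp_measurable measurable_snd

theorem Growth.isJoint_jointLaw (h : Growth W G p ε ψ f) (hG : RegularConstraint G ε)
    (hκ : κ ∘ₘ P = (p : Measure 𝒳)) {α : Ω → E M} (hα : Measurable α)
    (hact : ∀ᵐ ω ∂P, IsAction G (κ ω) (α ω)) : IsJoint G p (jointLaw P κ α) := by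
  have hs := snd_jointLaw hκ hα
  refine ⟨hs, fun φ hφ hc => ?_⟩
  have := isProbabilityMeasure_jointLaw (P := P) (κ := κ) hα
  have hi := integrable_smul_constraint hG (h.integrable_zero_snd hG hs) hφ hc
  have hm : Measurable fun z : E M × 𝒳 => φ z.1 • G z.1 z.2 :=
    (hφ.measurable.comp measurable_fst).smul hG.measurable
  rw [jointLaw] at hi ⊢
  have hi' : Integrable (fun z : Ω × 𝒳 => φ (α z.1) • G (α z.1) z.2) (P ⊗ₘ κ) :=
    hi.comp_measurable (measurable_code hα)
  rw [integral_map (measurable_code hα).aemeasurable hm.aestronglyMeasurable,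
    Measure.integral_compProd hi']
  refine integral_eq_zero_of_ae ?_
  filter_upwards [hact] with ω hω
  simp only [integral_smul, hω.2, smul_zero, Pi.zero_apply]

theorem Growth.integral_W_jointLaw (h : Growth W G p ε ψ f) (hG : RegularConstraint G ε)
    (hκ : κ ∘ₘ P = (p : Measure 𝒳)) {α : Ω → E M} (hα : Measurable α)
    (hact : ∀ᵐ ω ∂P, IsAction G (κ ω) (α ω)) :
    (∀ᵐ ω ∂P, Integrable (W (α ω)) (κ ω)) ∧ Integrable (fun ω => ∫ x, W (α ω) x ∂κ ω) P ∧
      ∫ z, W z.1 z.2 ∂(jointLaw P κ α) = ∫ ω, ∫ x, W (α ω) x ∂κ ω ∂P := by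
  have := isProbabilityMeasure_jointLaw (P := P) (κ := κ) hα
  have hi := h.integrable_W_of_dom (h.integrable_dom hG hκ hα hact).1
  rw [jointLaw] at hi ⊢
  have hi' : Integrable (fun z : Ω × 𝒳 => W (α z.1) z.2) (P ⊗ₘ κ) :=
    hi.comp_measurable (measurable_code hα)
  refine ⟨((Measure.integrable_compProd_iff hi'.1).1 hi').1, integrable_integral_compProd hi', ?_⟩
  rw [integral_map (measurable_code hα).aemeasurable hi.1, Measure.integral_compProd hi']

/-- Under an admissible joint law, almost every code is the action of the posterior that it
induces. -/
theorem IsJoint.ae_isAction (h : Growth W G p ε ψ f) (hG : RegularConstraint G ε)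
    {ν : Measure (E M)} [IsProbabilityMeasure ν] {κ : Kernel (E M) 𝒳} [IsMarkovKernel κ]
    (hγ : IsJoint G p (ν ⊗ₘ κ)) : ∀ᵐ a ∂ν, IsAction G (κ a) a := by
  have hκ : κ ∘ₘ ν = (p : Measure 𝒳) := by rw [← Measure.snd_compProd]; exact hγ.1
  have hint : ∀ᵐ a ∂ν, Integrable (G 0) (κ a) := by
    filter_upwards [h.ae_integrable_gauge hκ] with a ha using h.integrable_zero hG ha
  have h0 := h.integrable_zero_snd hG hγ.1
  have hsm : StronglyMeasurable fun a => ∫ x, G a x ∂κ a :=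
    hG.measurable.stronglyMeasurable.integral_kernel_prod_right
  have hloc : LocallyIntegrable (fun a => ∫ x, G a x ∂κ a) ν := by
    have h1 : LocallyIntegrable (fun a : E M => (∫ x, ‖G 0 x‖ ∂κ a) + ε⁻¹ * ‖a‖) ν := by
      refine LocallyIntegrable.add ?_ ?_
      · exact ((Measure.integrable_compProd_iff h0.1).1 h0).2.locallyIntegrable
      · exact (continuous_const.mul continuous_norm).locallyIntegrable
    refine h1.mono hsm.aestronglyMeasurable ?_
    filter_upwards [hint] with a ha
    have hε := hG.pos
    calc ‖∫ x, G a x ∂κ a‖ ≤ ∫ x, ‖G a x‖ ∂κ a := norm_integral_le_integral_norm _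
      _ ≤ ∫ x, (‖G 0 x‖ + ε⁻¹ * ‖a‖) ∂κ a :=
        integral_mono (hG.integrable_of ha a).norm (ha.norm.add (integrable_const _))
          (fun x => by simpa using hG.norm_le a 0 x)
      _ = (∫ x, ‖G 0 x‖ ∂κ a) + ε⁻¹ * ‖a‖ := by
        rw [integral_add ha.norm (integrable_const _)]; simp
      _ ≤ _ := le_abs_self _
  -- The locally integrable function `a ↦ ∫ G(a, X) dκ(a)` is orthogonal to all test functions.
  have hz : ∀ᵐ a ∂ν, ∫ x, G a x ∂κ a = 0 := by
    refine ae_eq_zero_of_integral_contDiff_smul_eq_zero hloc fun φ hφ hc => ?_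
    have h2 := hγ.2 φ hφ.continuous hc
    rw [Measure.integral_compProd (integrable_smul_constraint hG h0 hφ.continuous hc)] at h2
    simpa only [integral_smul] using h2
  filter_upwards [hint, hz] with a h1 h2
  exact ⟨hG.integrable_of h1 a, h2⟩

end Signal

end Posterior

/-! ### Compactness of the set of joint laws -/

section Compactness

/-- A continuous function with uniformly small tails has an integral that is continuous for weak
convergence: it is uniformly approximated by the integrals of the truncations of the function. -/
theorem continuousOn_integral_of_tails {Z : Type*} [TopologicalSpace Z] [MeasurableSpace Z]
    [OpensMeasurableSpace Z] {F : Z → ℝ} (hF : Continuous F) {Γ : Set (ProbabilityMeasure Z)}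
    (ht : ∀ δ : ℝ, 0 < δ → ∃ K : ℝ, 0 ≤ K ∧ ∀ γ ∈ Γ, Integrable F (γ : Measure Z) ∧
      ∫ z, max (|F z| - K) 0 ∂(γ : Measure Z) ≤ δ) :
    ContinuousOn (fun γ : ProbabilityMeasure Z => ∫ z, F z ∂(γ : Measure Z)) Γ := by
  refine continuousOn_of_uniform_approx_of_continuousOn fun u hu => ?_
  obtain ⟨δ, hδ, hu⟩ := Metric.mem_uniformity_dist.1 hu
  obtain ⟨K, hK, hKΓ⟩ := ht (δ / 2) (half_pos hδ)
  have htr : ∀ t : ℝ, |max (-K) (min K t)| ≤ K := fun t =>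
    abs_le.2 ⟨le_max_left _ _, max_le (by linarith) (min_le_left _ _)⟩
  let FK : BoundedContinuousFunction Z ℝ := BoundedContinuousFunction.ofNormedAddCommGroup
    (fun z => max (-K) (min K (F z))) (by fun_prop) K (fun z => htr _)
  refine ⟨fun γ => ∫ z, FK z ∂(γ : Measure Z),
    (ProbabilityMeasure.continuous_integral_boundedContinuousFunction FK).continuousOn,
    fun γ hγ => hu ?_⟩
  obtain ⟨hi, hle⟩ := hKΓ γ hγ
  have hdiff : ∀ z, ‖F z - FK z‖ ≤ max (|F z| - K) 0 := by
    intro z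
    change |F z - max (-K) (min K (F z))| ≤ _
    rcases abs_cases (F z) with h | h <;> rcases le_total K (F z) with h2 | h2 <;>
      rcases le_total (F z) (-K) with h3 | h3 <;>
      simp only [min_eq_left, min_eq_right, max_eq_left, max_eq_right, h2, h3, neg_le_self hK] <;>
      grind
  have hiK : Integrable FK (γ : Measure Z) := FK.integrable _
  rw [Real.dist_eq, ← integral_sub hi hiK]
  have hmax : Integrable (fun z => max (|F z| - K) 0) (γ : Measure Z) :=
    (hi.abs.sub (integrable_const K)).pos_part
  rw [← Real.norm_eq_abs]
  calc ‖∫ z, (F z - FK z) ∂(γ : Measure Z)‖ ≤ ∫ z, ‖F z - FK z‖ ∂(γ : Measure Z) :=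
        norm_integral_le_integral_norm _
    _ ≤ ∫ z, max (|F z| - K) 0 ∂(γ : Measure Z) := integral_mono (hi.sub hiK).norm hmax hdiff
    _ < δ := by linarith

/-- A continuous function dominated by a function of the state has uniformly small tails on the
laws with a given second marginal. -/
theorem tails_of_le_snd {A X : Type*} [TopologicalSpace A] [MeasurableSpace A] [TopologicalSpace X]
    [MeasurableSpace X] [OpensMeasurableSpace (A × X)]
    {p : ProbabilityMeasure X} {F : A × X → ℝ} (hF : Continuous F) {u : X → ℝ}
    (hu : Integrable u (p : Measure X)) (hle : ∀ z, |F z| ≤ u z.2) (δ : ℝ) (hδ : 0 < δ) :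
    ∃ K : ℝ, 0 ≤ K ∧ ∀ γ : ProbabilityMeasure (A × X), (γ : Measure (A × X)).snd = p →
      Integrable F (γ : Measure (A × X)) ∧ ∫ z, max (|F z| - K) 0 ∂(γ : Measure (A × X)) ≤ δ := by
  have hlim : Tendsto (fun n : ℕ => ∫ x, max (u x - n) 0 ∂(p : Measure X)) atTop (𝓝 0) := by
    have : Tendsto (fun n : ℕ => ∫ x, max (u x - n) 0 ∂(p : Measure X)) atTop
        (𝓝 (∫ _x, (0 : ℝ) ∂(p : Measure X))) := by
      refine tendsto_integral_of_dominated_convergence (fun x => |u x|)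
        (fun n => ((hu.sub (integrable_const (n : ℝ))).pos_part).aestronglyMeasurable) hu.abs
        (fun n => ae_of_all _ fun x => ?_) (ae_of_all _ fun x => ?_)
      · rw [Real.norm_of_nonneg (le_max_right _ _)]
        exact max_le ((sub_le_self _ (Nat.cast_nonneg n)).trans (le_abs_self _)) (abs_nonneg _)
      · obtain ⟨N, hN⟩ := exists_nat_ge (u x)
        refine tendsto_const_nhds.congr' ?_
        filter_upwards [eventually_ge_atTop N] with n hn
        have : (N : ℝ) ≤ n := by exact_mod_cast hn
        exact (max_eq_right (by linarith)).symm
    simpa using this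
  obtain ⟨n, hn⟩ := (hlim.eventually (gt_mem_nhds hδ)).exists
  refine ⟨n, Nat.cast_nonneg n, fun γ hγ => ?_⟩
  rw [← hγ] at hu hn
  have hu2 : Integrable (fun z : A × X => u z.2) (γ : Measure (A × X)) :=
    hu.comp_measurable measurable_snd
  have hi : Integrable F (γ : Measure (A × X)) :=
    hu2.mono' hF.measurable.aestronglyMeasurable (ae_of_all _ hle)
  refine ⟨hi, le_trans ?_ hn.le⟩
  have hm : AEStronglyMeasurable (fun x => max (u x - n) 0) ((γ : Measure (A × X)).snd) :=
    ((hu.sub (integrable_const (n : ℝ))).pos_part).aestronglyMeasurable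
  rw [Measure.snd, integral_map measurable_snd.aemeasurable hm]
  exact integral_mono (hi.abs.sub (integrable_const _)).pos_part
    (hu2.sub (integrable_const _)).pos_part
    (fun z => max_le_max_right 0 (by linarith [hle z]))

/-- On a nonempty compact set of probability measures, a continuous functional has a maximizer that
is extreme among the maximizers. -/
theorem exists_extreme_isMaxOn {Z : Type*} [TopologicalSpace Z] [MeasurableSpace Z] [BorelSpace Z]
    [HasOuterApproxClosed Z] {Γ : Set (ProbabilityMeasure Z)} (hΓ : IsCompact Γ)
    (hne : Γ.Nonempty) {J : ProbabilityMeasure Z → ℝ} (hJ : ContinuousOn J Γ) :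
    ∃ γ₀ ∈ Γ, IsMaxOn J Γ γ₀ ∧ ∀ γ₁ ∈ Γ, ∀ γ₂ ∈ Γ, J γ₁ = J γ₀ → J γ₂ = J γ₀ →
      (γ₁ : Measure Z) + (γ₂ : Measure Z) = (2 : ENNReal) • (γ₀ : Measure Z) → γ₁ = γ₀ := by
  obtain ⟨γm, hγm, hmax⟩ := hΓ.exists_isMaxOn hne hJ
  set Γm := Γ ∩ J ⁻¹' {J γm} with hΓm
  have hclosed : IsClosed Γm := hJ.preimage_isClosed_of_isClosed hΓ.isClosed isClosed_singleton
  have hcomp : IsCompact Γm := hΓ.of_isClosed_subset hclosed inter_subset_left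
  let ι : ProbabilityMeasure Z → (BoundedContinuousFunction Z ℝ → ℝ) :=
    fun γ f => ∫ z, f z ∂(γ : Measure Z)
  have hι : Continuous ι := continuous_pi fun f =>
    ProbabilityMeasure.continuous_integral_boundedContinuousFunction f
  have hinj : Function.Injective ι := by
    intro γ γ' h
    exact Subtype.ext (ext_of_forall_integral_eq_of_IsFiniteMeasure (μ := (γ : Measure Z))
      (ν := (γ' : Measure Z)) fun f => congrFun h f)
  -- The maximizers form a compact set; embedded by `ι` in the locally convex space of functionals
  -- on bounded continuous functions, it has an extreme point by the Krein-Milman theorem.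
  obtain ⟨_, ⟨⟨γ₀, hγ₀, rfl⟩, hext⟩⟩ :=
    (hcomp.image hι).extremePoints_nonempty (Set.Nonempty.image ι (⟨γm, hγm, rfl⟩ : Γm.Nonempty))
  have hJ0 : J γ₀ = J γm := hγ₀.2
  refine ⟨γ₀, hγ₀.1, fun γ hγ => ?_, fun γ₁ h₁ γ₂ h₂ hJ₁ hJ₂ hsum => ?_⟩
  · rw [mem_ofPred_eq, hJ0]
    exact hmax hγ
  · refine hinj (hext ⟨γ₁, ⟨h₁, hJ₁.trans hJ0⟩, rfl⟩ ⟨γ₂, ⟨h₂, hJ₂.trans hJ0⟩, rfl⟩ ?_)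
    refine ⟨1 / 2, 1 / 2, by norm_num, by norm_num, by norm_num, ?_⟩
    ext f
    have h3 : ∫ z, f z ∂((γ₁ : Measure Z) + (γ₂ : Measure Z))
        = ∫ z, f z ∂((2 : ENNReal) • (γ₀ : Measure Z)) := by
      rw [hsum]
    rw [integral_add_measure (f.integrable _) (f.integrable _), integral_smul_measure] at h3
    simp only [ι, Pi.add_apply, Pi.smul_apply, smul_eq_mul]
    simp only [ENNReal.toReal_ofNat, smul_eq_mul] at h3
    linarith

variable {M : ℕ}

/-- For a constraint that is jointly continuous in a Polish topology of the state space, the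
admissible joint laws form a compact set as soon as their actions have bounded first moments. -/
theorem isCompact_isJoint {X : Type*} [TopologicalSpace X] [PolishSpace X] [MeasurableSpace X]
    [BorelSpace X] {p : ProbabilityMeasure X} {G : E M → X → E M} {u : X → ℝ} {c C : ℝ}
    (hG : Continuous (Function.uncurry G)) (hc : 0 ≤ c) (hu : Integrable u (p : Measure X))
    (hGu : ∀ a x, ‖G a x‖ ≤ u x + c * ‖a‖)
    (hC : ∀ γ : ProbabilityMeasure (E M × X), IsJoint G p (γ : Measure (E M × X)) →
      ∫⁻ z, ‖z.1‖ₑ ∂(γ : Measure (E M × X)) ≤ ENNReal.ofReal C) :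
    IsCompact {γ : ProbabilityMeasure (E M × X) | IsJoint G p (γ : Measure (E M × X))} := by
  set Γ := {γ : ProbabilityMeasure (E M × X) | IsJoint G p (γ : Measure (E M × X))} with hΓ
  have hu0 : ∀ x, 0 ≤ u x := fun x => by simpa using (norm_nonneg _).trans (hGu 0 x)
  -- The constraint is tested against scalar products with fixed vectors; these integrals are
  -- continuous on the set `S` of laws with state marginal `p`.
  have hclosed : IsClosed Γ := by
    set S : Set (ProbabilityMeasure (E M × X)) := {γ | (γ : Measure (E M × X)).snd = p} with hS
    have hSc : IsClosed S := by
      have : S = (fun γ : ProbabilityMeasure (E M × X) =>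
          γ.map (f := Prod.snd) measurable_snd.aemeasurable) ⁻¹' {p} := by
        ext γ
        simp only [hS, mem_ofPred_eq, mem_preimage, mem_singleton_iff]
        exact (Subtype.ext_iff (a1 := γ.map _) (a2 := p)).symm
      rw [this]
      exact isClosed_singleton.preimage (ProbabilityMeasure.continuous_map continuous_snd)
    have hone : ∀ (φ : E M → ℝ) (v : E M), Continuous φ → HasCompactSupport φ →
        ContinuousOn (fun γ : ProbabilityMeasure (E M × X) =>
          ∫ z, φ z.1 * ⟪v, G z.1 z.2⟫ ∂(γ : Measure (E M × X))) S := by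
      intro φ v hφ hcs
      obtain ⟨B, hB⟩ := hφ.bounded_above_of_compact_support hcs
      obtain ⟨B', hB'⟩ := (hφ.mul continuous_norm).bounded_above_of_compact_support (hcs.mul_right)
      have hcont : Continuous fun z : E M × X => φ z.1 * ⟪v, G z.1 z.2⟫ :=
        (hφ.comp continuous_fst).mul (continuous_const.inner hG)
      refine continuousOn_integral_of_tails hcont fun δ hδ => ?_
      refine tails_of_le_snd hcont (u := fun x => ‖v‖ * (B * u x + c * B'))
        (((hu.const_mul B).add (integrable_const _)).const_mul _) (fun z => ?_) δ hδ
      have h1 := hB z.1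
      have h2 := hB' z.1
      rw [Pi.mul_apply, norm_mul, norm_norm] at h2
      rw [abs_mul]
      calc |φ z.1| * |⟪v, G z.1 z.2⟫| ≤ ‖φ z.1‖ * (‖v‖ * (u z.2 + c * ‖z.1‖)) := by
            rw [Real.norm_eq_abs]
            gcongr
            exact (abs_real_inner_le_norm _ _).trans (by gcongr; exact hGu _ _)
        _ = ‖v‖ * (‖φ z.1‖ * u z.2 + c * (‖φ z.1‖ * ‖z.1‖)) := by ring
        _ ≤ _ := by
          have := hu0 z.2
          gcongr
    have hint : ∀ γ ∈ S, ∀ φ : E M → ℝ, Continuous φ → HasCompactSupport φ →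
        Integrable (fun z : E M × X => φ z.1 • G z.1 z.2) (γ : Measure (E M × X)) := by
      intro γ hγ φ hφ hcs
      obtain ⟨B, hB⟩ := hφ.bounded_above_of_compact_support hcs
      obtain ⟨B', hB'⟩ := (hφ.mul continuous_norm).bounded_above_of_compact_support (hcs.mul_right)
      have hu' := hu
      rw [← (show (γ : Measure (E M × X)).snd = p from hγ)] at hu'
      have hu2 : Integrable (fun z : E M × X => u z.2) (γ : Measure (E M × X)) :=
        hu'.comp_measurable measurable_snd
      refine ((hu2.const_mul B).add (integrable_const (c * B'))).mono'
        ((hφ.comp continuous_fst).smul hG).measurable.aestronglyMeasurable (ae_of_all _ fun z => ?_)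
      have h1 := hB z.1
      have h2 := hB' z.1
      rw [Pi.mul_apply, norm_mul, norm_norm] at h2
      rw [norm_smul]
      calc ‖φ z.1‖ * ‖G z.1 z.2‖ ≤ ‖φ z.1‖ * (u z.2 + c * ‖z.1‖) := by gcongr; exact hGu _ _
        _ = ‖φ z.1‖ * u z.2 + c * (‖φ z.1‖ * ‖z.1‖) := by ring
        _ ≤ _ := by
          have := hu0 z.2
          simp only [Pi.add_apply]
          gcongr
    have hΓeq : Γ = S ∩ ⋂ (φ : E M → ℝ) (v : E M) (_ : Continuous φ) (_ : HasCompactSupport φ),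
        (S ∩ (fun γ : ProbabilityMeasure (E M × X) =>
          ∫ z, φ z.1 * ⟪v, G z.1 z.2⟫ ∂(γ : Measure (E M × X))) ⁻¹' {0}) := by
      ext γ
      simp only [hΓ, mem_ofPred_eq, mem_inter_iff, mem_iInter, mem_preimage, mem_singleton_iff]
      have hin : ∀ (φ : E M → ℝ) (v : E M), γ ∈ S → Continuous φ → HasCompactSupport φ →
          ∫ z, φ z.1 * ⟪v, G z.1 z.2⟫ ∂(γ : Measure (E M × X))
            = ⟪v, ∫ z, φ z.1 • G z.1 z.2 ∂(γ : Measure (E M × X))⟫ := by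
        intro φ v hγ hφ hcs
        rw [← integral_inner (hint γ hγ φ hφ hcs)]
        simp only [inner_smul_right]
      constructor
      · intro h
        refine ⟨h.1, fun φ v hφ hcs => ⟨h.1, ?_⟩⟩
        rw [hin φ v h.1 hφ hcs, h.2 φ hφ hcs, inner_zero_right]
      · rintro ⟨h1, h2⟩
        refine ⟨h1, fun φ hφ hcs => ext_inner_left ℝ fun v => ?_⟩
        rw [← hin φ v h1 hφ hcs, (h2 φ v hφ hcs).2, inner_zero_right]
    rw [hΓeq]
    refine hSc.inter (isClosed_iInter fun φ => isClosed_iInter fun v => isClosed_iInter fun hφ =>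
      isClosed_iInter fun hcs => ?_)
    exact (hone φ v hφ hcs).preimage_isClosed_of_isClosed hSc isClosed_singleton
  -- Tightness: the states are controlled by the fixed marginal, the actions by Markov's
  -- inequality.
  have htight : IsTightMeasureSet
      {x : Measure (E M × X) | ∃ μ ∈ Γ, (μ : Measure (E M × X)) = x} := by
    rw [isTightMeasureSet_iff_exists_isCompact_measure_compl_le]
    intro δ hδ
    obtain ⟨K, hK, hKp⟩ := isTightMeasureSet_iff_exists_isCompact_measure_compl_le.1
      (isTightMeasureSet_singleton (μ := (p : Measure X))) (δ / 2) (ENNReal.half_pos hδ.ne')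
    have hKp := hKp _ rfl
    have : ∃ R : ℕ, 0 < R ∧ ENNReal.ofReal C / R ≤ δ / 2 := by
      have hlim : Tendsto (fun R : ℕ => ENNReal.ofReal C / R) atTop (𝓝 0) := by
        have := ENNReal.Tendsto.const_div ENNReal.tendsto_nat_nhds_top
          (Or.inr (ENNReal.ofReal_ne_top (r := C)))
        simpa using this
      have := (hlim.eventually (gt_mem_nhds (ENNReal.half_pos hδ.ne'))).and
        (eventually_gt_atTop 0)
      obtain ⟨R, h1, h2⟩ := this.exists
      exact ⟨R, h2, h1.le⟩
    obtain ⟨R, hR0, hR⟩ := this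
    refine ⟨Metric.closedBall 0 R ×ˢ K, (isCompact_closedBall 0 _).prod hK, ?_⟩
    rintro _ ⟨γ, hγ, rfl⟩
    have hsub : (Metric.closedBall (0 : E M) (R : ℝ) ×ˢ K)ᶜ
        ⊆ {z : E M × X | (R : ENNReal) ≤ ‖z.1‖ₑ} ∪ Prod.snd ⁻¹' Kᶜ := by
      rintro z hz
      by_cases h : z.2 ∈ K
      · left
        have h2 : (R : ℝ) < ‖z.1‖ := by
          by_contra! hle
          exact hz ⟨by simpa using hle, h⟩
        rw [mem_ofPred_eq, ← ofReal_norm, ← ENNReal.ofReal_natCast]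
        exact ENNReal.ofReal_le_ofReal h2.le
      · exact Or.inr h
    calc (γ : Measure (E M × X)) (Metric.closedBall 0 R ×ˢ K)ᶜ
        ≤ (γ : Measure (E M × X)) {z : E M × X | (R : ENNReal) ≤ ‖z.1‖ₑ}
          + (γ : Measure (E M × X)) (Prod.snd ⁻¹' Kᶜ) :=
          (measure_mono hsub).trans (measure_union_le _ _)
      _ ≤ δ / 2 + δ / 2 := by
          gcongr
          · refine (meas_ge_le_lintegral_div (by fun_prop) (by exact_mod_cast hR0.ne')
              (ENNReal.natCast_ne_top R)).trans (le_trans ?_ hR)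
            gcongr
            exact hC γ hγ
          · rw [← Measure.snd_apply hK.isClosed.measurableSet.compl, hγ.1]
            exact hKp
      _ = δ := ENNReal.add_halves δ
  rw [← hclosed.closure_eq]
  exact isCompact_closure_of_isTightMeasureSet htight

/-- Stated for separate spaces `X` and `Y`, so that it applies to a set with two topologies. -/
theorem continuous_comp_prodMap_id {X Y : Type*} [TopologicalSpace X] [TopologicalSpace Y]
    {W : E M → Y → ℝ} (hW : Continuous (Function.uncurry W)) {i : X → Y} (hi : Continuous i) :
    Continuous fun z : E M × X => W z.1 (i z.2) :=
  hW.comp (continuous_fst.prodMk (hi.comp continuous_snd))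

/-- A map that is uniformly Lipschitz in the first variable and continuous in the second for a
dense set of values of the first is jointly continuous. -/
theorem continuous_uncurry_of_lipschitz {X : Type*} [TopologicalSpace X] {G : E M → X → E M}
    {c : ℝ} (hlip : ∀ x a b, ‖G a x - G b x‖ ≤ c * ‖a - b‖)
    (hc : ∀ n : ℕ, Continuous (G (TopologicalSpace.denseSeq (E M) n))) :
    Continuous (Function.uncurry G) := by
  have hl : ∀ x, LipschitzWith (Real.toNNReal c) fun a => G a x := fun x =>
    LipschitzWith.of_dist_le_mul fun a b => by
      rw [dist_eq_norm, dist_eq_norm]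
      exact (hlip x a b).trans (by gcongr; exact Real.le_coe_toNNReal c)
  exact continuous_prod_of_dense_continuous_lipschitzWith _ (Real.toNNReal c)
    (TopologicalSpace.denseRange_denseSeq (E M)) (by rintro _ ⟨n, rfl⟩; exact hc n) hl

end Compactness

section JointLaws

variable {L M : ℕ} {𝒳 : Set (E L)} {W : E M → 𝒳 → ℝ} {G : E M → 𝒳 → E M}
  {p : ProbabilityMeasure 𝒳} {ε : ℝ} {ψ : 𝒳 → ℝ} {f : ℝ → ℝ}

/-- The first moment of the action is bounded in terms of the prior alone. -/
theorem lintegral_enorm_jointLaw_le (h : Growth W G p ε ψ f) (hG : RegularConstraint G ε)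
    {Ω : Type*} [MeasurableSpace Ω] {P : Measure Ω} [IsProbabilityMeasure P]
    {κ : Kernel Ω 𝒳} [IsMarkovKernel κ] (hκ : κ ∘ₘ P = (p : Measure 𝒳)) {α : Ω → E M}
    (hα : Measurable α) (hact : ∀ᵐ ω ∂P, IsAction G (κ ω) (α ω)) :
    ∫⁻ z, ‖z.1‖ₑ ∂(jointLaw P κ α) ≤ ENNReal.ofReal (ε⁻¹ * ∫ x, ‖G 0 x‖ ∂(p : Measure 𝒳)) := by
  have hε := hG.pos
  have h0 : Integrable (G 0) (κ ∘ₘ P) := by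
    rw [hκ]; exact h.integrable_zero hG h.integrable_gauge
  rw [jointLaw, lintegral_map (by fun_prop) (measurable_code hα),
    Measure.lintegral_compProd (by fun_prop)]
  have h1 : ∀ᵐ ω ∂P, ‖α ω‖ₑ ≤ ENNReal.ofReal (ε⁻¹ * ∫ x, ‖G 0 x‖ ∂(κ ω)) := by
    filter_upwards [hact] with ω hω
    rw [← ofReal_norm]
    exact ENNReal.ofReal_le_ofReal (hG.norm_action_le hω)
  have h2 := Measure.integrable_integral_norm_of_integrable_comp h0
  calc ∫⁻ ω, ∫⁻ _x, ‖α ω‖ₑ ∂(κ ω) ∂P = ∫⁻ ω, ‖α ω‖ₑ ∂P := by simp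
    _ ≤ ∫⁻ ω, ENNReal.ofReal (ε⁻¹ * ∫ x, ‖G 0 x‖ ∂(κ ω)) ∂P := lintegral_mono_ae h1
    _ = ENNReal.ofReal (∫ ω, ε⁻¹ * ∫ x, ‖G 0 x‖ ∂(κ ω) ∂P) :=
      (ofReal_integral_eq_lintegral_ofReal (h2.const_mul _)
        (ae_of_all _ fun ω => by positivity)).symm
    _ = _ := by
      rw [integral_const_mul]
      congr 2
      have h3 : Integrable (fun z : Ω × 𝒳 => ‖G 0 z.2‖) (P ⊗ₘ κ) :=
        (Measure.integrable_compProd_snd_iff h0.norm.1).2 h0.norm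
      rw [← Measure.integral_compProd h3, ← hκ, ← Measure.snd_compProd, Measure.snd,
        integral_map measurable_snd.aemeasurable
          (hG.measurable_apply 0).norm.aestronglyMeasurable]

/-- An admissible joint law is the joint law of the signal that announces the action. -/
theorem IsJoint.exists_signal [StandardBorelSpace 𝒳] [Nonempty 𝒳] (h : Growth W G p ε ψ f)
    (hG : RegularConstraint G ε)
    {γ : Measure (E M × 𝒳)} [IsProbabilityMeasure γ] (hγ : IsJoint G p γ) :
    γ.condKernel ∘ₘ γ.fst = (p : Measure 𝒳) ∧
      (∀ᵐ a ∂γ.fst, IsAction G (γ.condKernel a) (id a)) ∧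
      jointLaw γ.fst γ.condKernel id = γ := by
  have hd : γ.fst ⊗ₘ γ.condKernel = γ := γ.disintegrate γ.condKernel
  refine ⟨?_, ?_, ?_⟩
  · rw [← Measure.snd_compProd, hd]
    exact hγ.1
  · exact IsJoint.ae_isAction h hG (by rwa [hd])
  · rw [jointLaw, hd]
    exact Measure.map_id

/-- A topology on `𝒳` in which the inclusion is continuous is finer than the subspace topology. -/
theorem continuous_id_of_val (t : TopologicalSpace 𝒳)
    (ht : @Continuous 𝒳 (E L) t _ Subtype.val) :
    @Continuous 𝒳 𝒳 t instTopologicalSpaceSubtype id :=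
  (@continuous_induced_rng 𝒳 (E L) 𝒳 Subtype.val id _ t).2 ht

/-- Stated with the topology as an explicit argument, for use with a topology that is not the
canonical instance. -/
theorem hasOuterApproxClosed_prod {X : Type*} (t : TopologicalSpace X) (_ : PolishSpace X) :
    HasOuterApproxClosed (E M × X) := inferInstance

/-- The best admissible joint laws of actions and states exist, and one of them is extreme among
the best ones. -/
theorem exists_extreme_joint [StandardBorelSpace 𝒳] [Nonempty 𝒳] (h : Growth W G p ε ψ f)
    (hG : RegularConstraint G ε) :
    ∃ γ₀ : ProbabilityMeasure (E M × 𝒳), IsJoint G p (γ₀ : Measure (E M × 𝒳)) ∧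
      (∀ γ : ProbabilityMeasure (E M × 𝒳), IsJoint G p (γ : Measure (E M × 𝒳)) →
        ∫ z, W z.1 z.2 ∂(γ : Measure (E M × 𝒳)) ≤ ∫ z, W z.1 z.2 ∂(γ₀ : Measure (E M × 𝒳))) ∧
      ∀ γ₁ γ₂ : ProbabilityMeasure (E M × 𝒳), IsJoint G p (γ₁ : Measure (E M × 𝒳)) →
        IsJoint G p (γ₂ : Measure (E M × 𝒳)) →
        ∫ z, W z.1 z.2 ∂(γ₁ : Measure (E M × 𝒳)) = ∫ z, W z.1 z.2 ∂(γ₀ : Measure (E M × 𝒳)) →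
        ∫ z, W z.1 z.2 ∂(γ₂ : Measure (E M × 𝒳)) = ∫ z, W z.1 z.2 ∂(γ₀ : Measure (E M × 𝒳)) →
        (γ₁ : Measure (E M × 𝒳)) + (γ₂ : Measure (E M × 𝒳))
          = (2 : ENNReal) • (γ₀ : Measure (E M × 𝒳)) → γ₁ = γ₀ := by
  have hε := hG.pos
  have h0 := h.integrable_zero hG h.integrable_gauge
  -- The uninformative signal, whose posterior is the prior, is admissible.
  have hne : ∃ γ : ProbabilityMeasure (E M × 𝒳), IsJoint G p (γ : Measure (E M × 𝒳)) := by
    have hbind : (posteriorKernel 𝒳) ∘ₘ (Measure.dirac p) = (p : Measure 𝒳) := by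
      rw [Measure.dirac_bind (posteriorKernel 𝒳).measurable]
      rfl
    have hact : ∀ᵐ μ ∂(Measure.dirac p), IsAction G (posteriorKernel 𝒳 μ)
        (action G (posteriorKernel 𝒳 μ)) := by
      filter_upwards [h.ae_integrable_gauge hbind] with μ hμ
      exact hG.isAction_action (h.integrable_zero hG hμ)
    have := isProbabilityMeasure_jointLaw (P := Measure.dirac p) (κ := posteriorKernel 𝒳)
      hG.measurable_action
    exact ⟨⟨_, this⟩, h.isJoint_jointLaw hG hbind hG.measurable_action hact⟩
  have hdom : ∀ γ : ProbabilityMeasure (E M × 𝒳), IsJoint G p (γ : Measure (E M × 𝒳)) →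
      Integrable (Growth.dom ψ f) (γ : Measure (E M × 𝒳)) ∧
      ∫ z, Growth.dom ψ f z ∂(γ : Measure (E M × 𝒳))
        ≤ 4 * ∫ x, Growth.gauge f (ψ x) ∂(p : Measure 𝒳) := by
    intro γ hγ
    obtain ⟨h1, h2, h3⟩ := hγ.exists_signal h hG
    have := h.integrable_dom hG h1 measurable_id h2
    rwa [h3] at this
  have hC : ∀ γ : ProbabilityMeasure (E M × 𝒳), IsJoint G p (γ : Measure (E M × 𝒳)) →
      ∫⁻ z, ‖z.1‖ₑ ∂(γ : Measure (E M × 𝒳))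
        ≤ ENNReal.ofReal (ε⁻¹ * ∫ x, ‖G 0 x‖ ∂(p : Measure 𝒳)) := by
    intro γ hγ
    obtain ⟨h1, h2, h3⟩ := hγ.exists_signal h hG
    have := lintegral_enorm_jointLaw_le h hG h1 measurable_id h2
    rwa [h3] at this
  have htails : ∀ δ : ℝ, 0 < δ → ∃ K : ℝ, 0 ≤ K ∧
      ∀ γ ∈ {γ : ProbabilityMeasure (E M × 𝒳) | IsJoint G p (γ : Measure (E M × 𝒳))},
        Integrable (fun z : E M × 𝒳 => W z.1 z.2) (γ : Measure (E M × 𝒳)) ∧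
        ∫ z, max (|W z.1 z.2| - K) 0 ∂(γ : Measure (E M × 𝒳)) ≤ δ := by
    intro δ hδ
    set C := 4 * ∫ x, Growth.gauge f (ψ x) ∂(p : Measure 𝒳) with hCdef
    have hC0 : 0 ≤ C := mul_nonneg (by norm_num) (integral_nonneg fun x => h.gauge_nonneg _)
    -- With this `R` the tail of `W` beyond `R f(R)` is at most `R⁻¹ C ≤ δ`.
    set R := C / δ + 1 with hR
    have hR0 : 0 < R := by positivity
    have hfR := h.f_pos R
    refine ⟨R * f R, by positivity, fun γ hγ => ?_⟩
    obtain ⟨hd, hdC⟩ := hdom γ hγ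
    have hW := h.integrable_W_of_dom hd
    refine ⟨hW, ?_⟩
    have hpt : ∀ z : E M × 𝒳, max (|W z.1 z.2| - R * f R) 0 ≤ R⁻¹ * Growth.dom ψ f z := by
      intro z
      have hd0 := h.dom_nonneg z
      rcases le_or_gt (|W z.1 z.2|) (R * f R) with hle | hlt
      · rw [max_eq_right (by linarith)]
        positivity
      · have h1 := h.mul_abs_le_dom z hR0.le hlt
        rw [max_eq_left (by linarith), inv_mul_eq_div, le_div_iff₀ hR0]
        nlinarith [mul_pos hR0 hfR]
    calc ∫ z, max (|W z.1 z.2| - R * f R) 0 ∂(γ : Measure (E M × 𝒳))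
        ≤ ∫ z, R⁻¹ * Growth.dom ψ f z ∂(γ : Measure (E M × 𝒳)) :=
          integral_mono (hW.abs.sub (integrable_const _)).pos_part (hd.const_mul _) hpt
      _ ≤ R⁻¹ * C := by rw [integral_const_mul]; gcongr
      _ ≤ δ := by
        rw [inv_mul_eq_div, div_le_iff₀ hR0, hR]
        field_simp
        linarith
  -- Refine the topology of the state space to a Polish one in which `G` is jointly continuous.
  -- The Borel sets, hence the admissible laws, do not change, and `W` remains continuous.
  have hFm : Measurable fun x : 𝒳 =>
      ((x : E L), fun n : ℕ => G (TopologicalSpace.denseSeq (E M) n) x) :=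
    measurable_subtype_coe.prodMk (measurable_pi_lambda _ fun n => hG.measurable_apply _)
  obtain ⟨t₀, hb₀, hp₀⟩ := StandardBorelSpace.polish (α := 𝒳)
  obtain ⟨t, htle, hFc, htp⟩ :=
    @Measurable.exists_continuous 𝒳 (E L × (ℕ → E M)) t₀ hp₀ _ hb₀ _ _ _ _ _ hFm
  have hbt : @BorelSpace 𝒳 t _ := by
    refine @BorelSpace.mk 𝒳 t _ ?_
    rw [hb₀.measurable_eq]
    exact (borel_eq_borel_of_le htp hp₀ htle).symm
  have hWc := @continuous_comp_prodMap_id M 𝒳 𝒳 t instTopologicalSpaceSubtype W h.continuous id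
    (continuous_id_of_val t (continuous_fst.comp hFc))
  have hGc := @continuous_uncurry_of_lipschitz M 𝒳 t G ε⁻¹ hG.lipschitz (fun n =>
    (continuous_apply n).comp (continuous_snd.comp hFc))
  have hcomp := @isCompact_isJoint M 𝒳 t htp _ hbt p G (fun x => ‖G 0 x‖) ε⁻¹ _ hGc
    (inv_nonneg.2 hε.le) h0.norm (fun a x => by simpa using hG.norm_le a 0 x) hC
  have hcont := @continuousOn_integral_of_tails (E M × 𝒳) (@instTopologicalSpaceProd _ _ _ t) _
    (@BorelSpace.opensMeasurable _ _ _ (@Prod.borelSpace _ _ _ _ _ t _ hbt _)) _ hWc _ htails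
  obtain ⟨γ₀, h1, h2, h3⟩ := @exists_extreme_isMaxOn (E M × 𝒳) (@instTopologicalSpaceProd _ _ _ t) _
    (@Prod.borelSpace _ _ _ _ _ t _ hbt _) (hasOuterApproxClosed_prod t htp) _ hcomp hne _ hcont
  exact ⟨γ₀, h1, fun γ hγ => h2 hγ, fun γ₁ γ₂ hγ₁ hγ₂ e1 e2 e3 => h3 γ₁ hγ₁ γ₂ hγ₂ e1 e2 e3⟩

end JointLaws

/-! ### From joint laws to laws of posteriors -/

section Posteriors

variable {L M : ℕ} {𝒳 : Set (E L)} {W : E M → 𝒳 → ℝ} {G : E M → 𝒳 → E M}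
  {p : ProbabilityMeasure 𝒳} {ε : ℝ} {ψ : 𝒳 → ℝ} {f : ℝ → ℝ}
  {Ω : Type*} [MeasurableSpace Ω] {P : Measure Ω} [IsProbabilityMeasure P]
  {κ : Kernel Ω 𝒳} [IsMarkovKernel κ]

theorem IsFeasible.bind_eq {τ : ProbabilityMeasure (ProbabilityMeasure 𝒳)}
    (hτ : IsFeasible p τ) :
    posteriorKernel 𝒳 ∘ₘ (τ : Measure (ProbabilityMeasure 𝒳)) = (p : Measure 𝒳) := by
  ext s hs
  rw [Measure.bind_apply hs (posteriorKernel 𝒳).measurable.aemeasurable]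
  exact hτ s hs

theorem Growth.ae_isAction_action (h : Growth W G p ε ψ f) (hG : RegularConstraint G ε)
    (hκ : κ ∘ₘ P = (p : Measure 𝒳)) : ∀ᵐ ω ∂P, IsAction G (κ ω) (action G (κ ω)) := by
  filter_upwards [h.ae_integrable_gauge hκ] with ω hω
  exact hG.isAction_action (h.integrable_zero hG hω)

theorem IsFeasible.objectiveDefined (h : Growth W G p ε ψ f) (hG : RegularConstraint G ε)
    {τ : ProbabilityMeasure (ProbabilityMeasure 𝒳)} (hτ : IsFeasible p τ) :
    ObjectiveDefined W G τ := by
  obtain ⟨h1, h2, -⟩ := h.integral_W_jointLaw hG hτ.bind_eq hG.measurable_action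
    (h.ae_isAction_action hG hτ.bind_eq)
  exact ⟨(h.ae_existsUnique hG hτ.bind_eq).and h1, h2⟩

theorem IsFeasible.objective_eq (h : Growth W G p ε ψ f) (hG : RegularConstraint G ε)
    {τ : ProbabilityMeasure (ProbabilityMeasure 𝒳)} (hτ : IsFeasible p τ) :
    objective W G τ = ∫ z, W z.1 z.2 ∂(jointLaw (τ : Measure (ProbabilityMeasure 𝒳))
      (posteriorKernel 𝒳) fun μ => action G (μ : Measure 𝒳)) :=
  (h.integral_W_jointLaw hG hτ.bind_eq hG.measurable_action
    (h.ae_isAction_action hG hτ.bind_eq)).2.2.symm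

/-- The value of a Markov kernel as a point of the space of probability measures. -/
def posterior (κ : Kernel Ω 𝒳) [IsMarkovKernel κ] (ω : Ω) : ProbabilityMeasure 𝒳 :=
  ⟨κ ω, inferInstance⟩

theorem measurable_posterior : Measurable (posterior κ) :=
  κ.measurable.subtype_mk

/-- The law of the posterior of a signal. -/
noncomputable def posteriorLaw (P : Measure Ω) [IsProbabilityMeasure P] (κ : Kernel Ω 𝒳)
    [IsMarkovKernel κ] :
    ProbabilityMeasure (ProbabilityMeasure 𝒳) :=
  ⟨P.map (posterior κ), Measure.isProbabilityMeasure_map measurable_posterior.aemeasurable⟩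

theorem isFeasible_posteriorLaw (hκ : κ ∘ₘ P = (p : Measure 𝒳)) :
    IsFeasible p (posteriorLaw P κ) := by
  intro s hs
  change ∫⁻ μ : ProbabilityMeasure 𝒳, (μ : Measure 𝒳) s ∂(P.map (posterior κ)) = _
  have hm : Measurable fun μ : ProbabilityMeasure 𝒳 => (μ : Measure 𝒳) s :=
    (Measure.measurable_coe hs).comp measurable_subtype_coe
  rw [lintegral_map hm measurable_posterior, ← hκ, Measure.bind_apply hs κ.measurable.aemeasurable]
  rfl

theorem objective_posteriorLaw (h : Growth W G p ε ψ f) (hG : RegularConstraint G ε)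
    (hκ : κ ∘ₘ P = (p : Measure 𝒳)) {α : Ω → E M} (hα : Measurable α)
    (hact : ∀ᵐ ω ∂P, IsAction G (κ ω) (α ω)) :
    objective W G (posteriorLaw P κ) = ∫ z, W z.1 z.2 ∂(jointLaw P κ α) := by
  rw [(h.integral_W_jointLaw hG hκ hα hact).2.2]
  have h1 := ((isFeasible_posteriorLaw hκ).objectiveDefined h hG).2
  change ∫ μ, Wbar W G μ ∂(P.map (posterior κ)) = _
  rw [integral_map measurable_posterior.aemeasurable h1.1]
  refine integral_congr_ae ?_
  filter_upwards [hact] with ω hω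
  have : action G ((posterior κ ω : ProbabilityMeasure 𝒳) : Measure 𝒳) = α ω := hG.action_eq hω
  simp only [Wbar, this]
  rfl

/-- A signal whose joint law is best among the admissible joint laws induces an optimal law of
posteriors. -/
theorem isOptimal_posteriorLaw (h : Growth W G p ε ψ f) (hG : RegularConstraint G ε)
    (hκ : κ ∘ₘ P = (p : Measure 𝒳)) {α : Ω → E M} (hα : Measurable α)
    (hact : ∀ᵐ ω ∂P, IsAction G (κ ω) (α ω))
    (hmax : ∀ γ : ProbabilityMeasure (E M × 𝒳), IsJoint G p (γ : Measure (E M × 𝒳)) →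
        ∫ z, W z.1 z.2 ∂(γ : Measure (E M × 𝒳)) ≤ ∫ z, W z.1 z.2 ∂(jointLaw P κ α)) :
    IsOptimal W G p (posteriorLaw P κ) where
  feasible := isFeasible_posteriorLaw hκ
  defined τ' hτ' := hτ'.objectiveDefined h hG
  maximal τ' hτ' := by
    rw [objective_posteriorLaw h hG hκ hα hact, hτ'.objective_eq h hG]
    have hact' := h.ae_isAction_action hG hτ'.bind_eq
    have := isProbabilityMeasure_jointLaw (P := (τ' : Measure (ProbabilityMeasure 𝒳)))
      (κ := posteriorKernel 𝒳) hG.measurable_action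
    exact hmax ⟨_, this⟩ (h.isJoint_jointLaw hG hτ'.bind_eq hG.measurable_action hact')

/-- Splitting a best joint law into the law of the code and the posteriors given the code yields an
optimal law of posteriors. -/
theorem exists_isOptimal [StandardBorelSpace 𝒳] [Nonempty 𝒳] (h : Growth W G p ε ψ f)
    (hG : RegularConstraint G ε) :
    ∃ τ : ProbabilityMeasure (ProbabilityMeasure 𝒳), IsOptimal W G p τ := by
  obtain ⟨γ₀, h1, h2, -⟩ := exists_extreme_joint h hG
  obtain ⟨e1, e2, e3⟩ := h1.exists_signal h hG
  refine ⟨_, isOptimal_posteriorLaw h hG e1 measurable_id e2 ?_⟩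
  rwa [e3]

end Posteriors

/-! ### Tangent functions and the sliding argument -/

/-- **Lusin's theorem**, in the form: a Borel map is continuous on a compact subset, of positive
measure, of any set of positive measure. The compact set is compact in a finer Polish topology in
which the map is continuous. -/
theorem exists_isCompact_continuousOn {X Y : Type*} [TopologicalSpace X] [PolishSpace X]
    [MeasurableSpace X] [BorelSpace X] [TopologicalSpace Y] [SecondCountableTopology Y]
    [MeasurableSpace Y] [OpensMeasurableSpace Y] {μ : Measure X} [IsFiniteMeasure μ] {c : X → Y}
    (hc : Measurable c) {Z : Set X} (hZ : MeasurableSet Z) (hμZ : μ Z ≠ 0) :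
    ∃ K ⊆ Z, IsCompact K ∧ μ K ≠ 0 ∧ ContinuousOn c K := by
  have key : ∀ (X' : Type _) [TopologicalSpace X'] [PolishSpace X'] [mX' : MeasurableSpace X']
      [BorelSpace X'] (i : X' → X) (μ' : Measure X') [IsFiniteMeasure μ'] (Z' : Set X'),
      Continuous i → Continuous (c ∘ i) → MeasurableSet Z' → μ' Z' ≠ 0 →
      ∃ K' ⊆ Z', IsCompact (i '' K') ∧ μ' K' ≠ 0 ∧ ContinuousOn c (i '' K') := by
    intro X' _ _ _ _ i μ' _ Z' hi hci hZ' hμ'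
    obtain ⟨K', hK'Z, hK', hpos⟩ :=
      innerRegular_isCompact_isClosed_measurableSet_of_finite μ' hZ' 0 (pos_iff_ne_zero.2 hμ')
    refine ⟨K', hK'Z, hK'.1.image hi, hpos.ne', continuousOn_iff_isClosed.2 fun F hF => ?_⟩
    refine ⟨i '' (K' ∩ (c ∘ i) ⁻¹' F),
      ((hK'.1.inter_right (hF.preimage hci)).image hi).isClosed, ?_⟩
    ext x
    constructor
    · rintro ⟨hx, y, hy, rfl⟩
      exact ⟨⟨y, ⟨hy, hx⟩, rfl⟩, ⟨y, hy, rfl⟩⟩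
    · rintro ⟨⟨y, ⟨hy, hx⟩, rfl⟩, hx2⟩
      exact ⟨hx, hx2⟩
  rename_i tX pX mX bX tY sY mY oY fμ
  obtain ⟨t, htle, htc, htp⟩ := hc.exists_continuous
  have hbt : @BorelSpace X t _ := by
    refine @BorelSpace.mk X t _ ?_
    rw [bX.measurable_eq]
    exact (borel_eq_borel_of_le htp pX htle).symm
  obtain ⟨K, hKZ, h1, h2, h3⟩ := @key X t htp mX hbt id μ fμ Z (continuous_id_of_le htle) htc hZ hμZ
  rw [image_id] at h1 h3
  exact ⟨K, hKZ, h1, h2, h3⟩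

section Tangent

variable {n : ℕ} {W : E n → ℝ}

/-- The tangent (affine) function of `W` at `a`, evaluated at `z`. -/
noncomputable def tangent (W : E n → ℝ) (a z : E n) : ℝ := W a + ⟪gradient W a, z - a⟫

theorem tangent_self (a : E n) : tangent W a a = W a := by simp [tangent]

theorem tangent_sub (a y z : E n) : tangent W a y - tangent W a z = ⟪gradient W a, y - z⟫ := by
  simp only [tangent, inner_sub_right]; ring

/-- The tangent function is affine along the rays from `b`. -/
theorem tangent_homothety (a b y : E n) (r : ℝ) :
    tangent W a (AffineMap.homothety b r y) = r * tangent W a y + (1 - r) * tangent W a b := by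
  simp only [tangent, AffineMap.homothety_apply, vsub_eq_sub, vadd_eq_add, inner_sub_right,
    inner_add_right, inner_smul_right]
  ring

theorem continuous_tangent_left (hW : Continuous W) (hb : Continuous (gradient W)) (z : E n) :
    Continuous fun a => tangent W a z :=
  hW.add (hb.inner (continuous_const.sub continuous_id))

theorem continuous_tangent_right (a : E n) : Continuous fun z => tangent W a z :=
  continuous_const.add (continuous_const.inner (continuous_id.sub continuous_const))

/-- At the point `y`, the tangent functions with base point in `Ξ` that come close to the value of
the tangent function at `a` have slopes close to the slope at `a`. -/
def IsSharpAt (W : E n → ℝ) (Ξ : Set (E n)) (a y : E n) : Prop :=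
  ∀ η : ℝ, 0 < η → ∃ δ : ℝ, 0 < δ ∧ ∀ a' ∈ Ξ, tangent W a y - δ < tangent W a' y →
    ‖gradient W a' - gradient W a‖ < η

theorem IsSharpAt.gradient_eq {Ξ : Set (E n)} {a a' y : E n} (h : IsSharpAt W Ξ a y) (ha' : a' ∈ Ξ)
    (hle : tangent W a y ≤ tangent W a' y) : gradient W a' = gradient W a := by
  by_contra hne
  obtain ⟨δ, hδ, H⟩ := h _ (norm_pos_iff.2 (sub_ne_zero.2 hne))
  exact (H a' ha' (by linarith)).false

section Sliding

variable {Ξ : Set (E n)} {Z : Set (E n)} {c : E n → E n}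

/-- Moving the points of a compact set by a fixed ratio `1 - r` towards their contact points
contracts volume by at most `rⁿ`. The finitely many tangent functions at a finite set of contact
points divide the space into cells which are star-shaped about their contact points, so moving
within the cells is injective; these maps converge to the given one. -/
theorem volume_le_volume_slide (hW : Continuous W) (hb : Continuous (gradient W))
    (hΞ : ∀ a ∈ Ξ, ∀ a' ∈ Ξ, tangent W a' a ≤ W a) (hZ : IsCompact Z) (hc : ContinuousOn c Z)
    (hcΞ : ∀ y ∈ Z, c y ∈ Ξ) (hsharp : ∀ y ∈ Z, IsSharpAt W Ξ (c y) y)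
    (hinj : InjOn (fun y => gradient W (c y)) Z) {r : ℝ} (hr0 : 0 < r) (hr1 : r < 1) :
    ENNReal.ofReal (r ^ n) * volume Z
      ≤ volume ((fun y => AffineMap.homothety (c y) r y) '' Z) := by
  rcases Z.eq_empty_or_nonempty with rfl | hZne
  · simp
  rw [((fun y => AffineMap.homothety (c y) r y) '' Z).measure_eq_iInf_isOpen]
  -- By outer regularity it suffices to bound the volume of every open set `O` that contains the
  -- image of `Z`.
  refine le_iInf fun O => le_iInf fun hTO => le_iInf fun hO => ?_
  have : Nonempty Z := hZne.to_subtype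
  let y : ℕ → Z := TopologicalSpace.denseSeq Z
  have hy : DenseRange y := TopologicalSpace.denseRange_denseSeq Z
  let a : ℕ → E n := fun j => c (y j)
  have haΞ : ∀ j, a j ∈ Ξ := fun j => hcΞ _ (y j).2
  -- `R N j` is the part of `Z` where `j` is the first index that maximizes the tangent functions.
  let R : ℕ → ℕ → Set (E n) := fun N j =>
    {z ∈ Z | (∀ i ≤ N, tangent W (a i) z ≤ tangent W (a j) z) ∧
    ∀ i < j, tangent W (a i) z < tangent W (a j) z}
  have hRm : ∀ N j, MeasurableSet (R N j) := by
    intro N j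
    have h1 : MeasurableSet (⋂ i ∈ Iic N, {z | tangent W (a i) z ≤ tangent W (a j) z}) :=
      MeasurableSet.biInter (to_countable _) fun i _ => measurableSet_le
        (continuous_tangent_right _).measurable (continuous_tangent_right _).measurable
    have h2 : MeasurableSet (⋂ i ∈ Iio j, {z | tangent W (a i) z < tangent W (a j) z}) :=
      MeasurableSet.biInter (to_countable _) fun i _ => measurableSet_lt
        (continuous_tangent_right _).measurable (continuous_tangent_right _).measurable
    convert hZ.measurableSet.inter (h1.inter h2) using 1
    ext z
    simp only [R, mem_ofPred_eq, mem_inter_iff, mem_iInter, mem_Iic, mem_Iio]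
  let B : ℕ → ℕ → Set (E n) := fun N j => R N j ∩ AffineMap.homothety (a j) r ⁻¹' O
  have hhm : ∀ j, Measurable (AffineMap.homothety (a j) r : E n → E n) := fun j =>
    (AffineMap.homothety_continuous (a j) r).measurable
  have hBm : ∀ N j, MeasurableSet (B N j) := fun N j =>
    (hRm N j).inter (hhm j hO.measurableSet)
  have hhinj : ∀ j, Function.Injective (AffineMap.homothety (a j) r : E n → E n) := by
    intro j z z' h
    simpa [AffineMap.homothety_apply, hr0.ne'] using h
  have himg : ∀ N j, MeasurableSet ((AffineMap.homothety (a j) r : E n → E n) '' B N j) :=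
    fun N j => (hBm N j).image_of_measurable_injOn (hhm j) (hhinj j).injOn
  -- The images of distinct cells are disjoint.
  have hlt : ∀ N i j, i < j → j ≤ N → ∀ z ∈ R N i, ∀ z' ∈ R N j,
      AffineMap.homothety (a i) r z ≠ AffineMap.homothety (a j) r z' := by
    intro N i j hij hjN z hz z' hz' he
    have h1 : tangent W (a j) (AffineMap.homothety (a i) r z)
        ≤ tangent W (a i) (AffineMap.homothety (a i) r z) := by
      rw [tangent_homothety, tangent_homothety, tangent_self]
      have := hΞ _ (haΞ i) _ (haΞ j)
      have := hz.2.1 j hjN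
      have : 0 ≤ 1 - r := by linarith
      gcongr
    have h2 : tangent W (a i) (AffineMap.homothety (a j) r z')
        < tangent W (a j) (AffineMap.homothety (a j) r z') := by
      rw [tangent_homothety, tangent_homothety, tangent_self]
      have h3 := hΞ _ (haΞ j) _ (haΞ i)
      have h4 := hz'.2.2 i hij
      have h5 : (1 - r) * tangent W (a i) (a j) ≤ (1 - r) * W (a j) :=
        mul_le_mul_of_nonneg_left h3 (by linarith)
      have h6 := mul_lt_mul_of_pos_left h4 hr0
      linarith
    rw [he] at h1
    linarith
  have hdisj : ∀ N, (↑(Finset.range (N + 1)) : Set ℕ).PairwiseDisjoint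
      fun j => (AffineMap.homothety (a j) r : E n → E n) '' B N j := by
    intro N i hi j hj hij
    rw [Function.onFun, Set.disjoint_left]
    rintro _ ⟨z, hz, rfl⟩ ⟨z', hz', he⟩
    simp only [Finset.coe_range, mem_Iio, Nat.lt_succ_iff] at hi hj
    rcases lt_or_gt_of_ne hij with h | h
    · exact hlt N i j h hj z hz.1 z' hz'.1 he.symm
    · exact hlt N j i h hi z' hz'.1 z hz.1 he
  have hA : ∀ N, ENNReal.ofReal (r ^ n) * volume (⋃ j ∈ Finset.range (N + 1), B N j)
      ≤ volume O := by
    intro N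
    calc ENNReal.ofReal (r ^ n) * volume (⋃ j ∈ Finset.range (N + 1), B N j)
        ≤ ENNReal.ofReal (r ^ n) * ∑ j ∈ Finset.range (N + 1), volume (B N j) := by
          gcongr; exact measure_biUnion_finset_le _ _
      _ = ∑ j ∈ Finset.range (N + 1),
            volume ((AffineMap.homothety (a j) r : E n → E n) '' B N j) := by
          rw [Finset.mul_sum]
          refine Finset.sum_congr rfl fun j _ => ?_
          rw [Measure.addHaar_image_homothety, finrank_euclideanSpace_fin,
            abs_of_pos (pow_pos hr0 n)]
      _ = volume (⋃ j ∈ Finset.range (N + 1),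
            (AffineMap.homothety (a j) r : E n → E n) '' B N j) :=
          (measure_biUnion_finset (hdisj N) fun j _ => himg N j).symm
      _ ≤ volume O := by
          refine measure_mono (iUnion₂_subset fun j _ => ?_)
          rintro _ ⟨z, hz, rfl⟩
          exact hz.2
  -- Every point of `Z` is eventually moved into `O` by the cellwise maps.
  have hev : ∀ z ∈ Z, ∃ N₀, ∀ N ≥ N₀, z ∈ ⋃ j ∈ Finset.range (N + 1), B N j := by
    intro z hz
    have hzO : AffineMap.homothety (c z) r z ∈ O := hTO ⟨z, hz, rfl⟩
    obtain ⟨η, hη, hηO⟩ : ∃ η : ℝ, 0 < η ∧ ∀ a', ‖a' - c z‖ < η →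
        AffineMap.homothety a' r z ∈ O := by
      have hcont : Continuous fun a' : E n => AffineMap.homothety a' r z := by
        simp only [AffineMap.homothety_apply, vsub_eq_sub, vadd_eq_add]
        fun_prop
      obtain ⟨η, hη, h⟩ := Metric.isOpen_iff.1 (hO.preimage hcont) (c z) hzO
      exact ⟨η, hη, fun a' ha' => h (by rwa [Metric.mem_ball, dist_eq_norm])⟩
    -- On the compact set `Z` the slope determines the contact point continuously, since it is
    -- injective.
    obtain ⟨η', hη', hbc⟩ : ∃ η' : ℝ, 0 < η' ∧ ∀ z' ∈ Z,
        ‖gradient W (c z') - gradient W (c z)‖ < η' → ‖c z' - c z‖ < η := by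
      have hS : IsCompact (Z ∩ (fun z' => ‖c z' - c z‖) ⁻¹' Ici η) := by
        refine hZ.of_isClosed_subset ?_ inter_subset_left
        exact (hc.sub continuousOn_const).norm.preimage_isClosed_of_isClosed hZ.isClosed
          isClosed_Ici
      rcases (Z ∩ (fun z' => ‖c z' - c z‖) ⁻¹' Ici η).eq_empty_or_nonempty with he | hne
      · refine ⟨1, one_pos, fun z' hz' _ => ?_⟩
        by_contra! hcon
        exact (he.subset ⟨hz', hcon⟩ : z' ∈ (∅ : Set (E n)))
      · obtain ⟨m, hm, hmin⟩ := hS.exists_isMinOn hne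
          (f := fun z' => ‖gradient W (c z') - gradient W (c z)‖)
          (((hb.comp_continuousOn (hc.mono inter_subset_left)).sub continuousOn_const).norm)
        refine ⟨‖gradient W (c m) - gradient W (c z)‖, ?_, fun z' hz' hlt' => ?_⟩
        · refine norm_pos_iff.2 (sub_ne_zero.2 fun he => ?_)
          have := hinj hm.1 hz he
          have h2 : η ≤ ‖c m - c z‖ := hm.2
          rw [this, sub_self, norm_zero] at h2
          linarith
        · by_contra! hcon
          exact absurd (hmin ⟨hz', hcon⟩) (not_le.2 hlt')
    -- Once the finite set contains a contact point whose tangent function is nearly optimal at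
    -- `z`, the maximizing index has a slope, hence a contact point, close to that of `z`.
    obtain ⟨δ, hδ, hsh⟩ := hsharp z hz η' hη'
    obtain ⟨j₀, hj₀⟩ : ∃ j₀, tangent W (c z) z - δ < tangent W (a j₀) z := by
      have hcont : Continuous fun z' : Z => tangent W (c z') z :=
        (continuous_tangent_left hW hb z).comp (continuousOn_iff_continuous_domRestrict.1 hc)
      have hopen : IsOpen {z' : Z | tangent W (c z) z - δ < tangent W (c z') z} :=
        isOpen_lt continuous_const hcont
      obtain ⟨j, hj⟩ := hy.exists_mem_open hopen ⟨⟨z, hz⟩, by simpa using hδ⟩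
      exact ⟨j, hj⟩
    refine ⟨j₀, fun N hN => ?_⟩
    have hex : ∃ j, j ≤ N ∧ ∀ i ≤ N, tangent W (a i) z ≤ tangent W (a j) z := by
      obtain ⟨j, hj, hmax⟩ := Finset.exists_max_image (Finset.range (N + 1))
        (fun j => tangent W (a j) z) ⟨0, by simp⟩
      exact ⟨j, by simpa [Nat.lt_succ_iff] using hj,
        fun i hi => hmax i (by simpa [Nat.lt_succ_iff] using hi)⟩
    classical
    obtain ⟨hjN, hjmax⟩ := Nat.find_spec hex
    set j := Nat.find hex with hjdef
    have hzR : z ∈ R N j := by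
      refine ⟨hz, hjmax, fun i hi => ?_⟩
      have hmin := Nat.find_min hex hi
      push Not at hmin
      obtain ⟨i', hi', hlt'⟩ := hmin (hi.le.trans hjN)
      exact hlt'.trans_le (hjmax i' hi')
    have hclose : ‖a j - c z‖ < η :=
      hbc _ (y j).2 (hsh _ (haΞ j) (hj₀.trans_le (hjmax j₀ hN)))
    simp only [mem_iUnion, Finset.mem_range, Nat.lt_succ_iff]
    exact ⟨j, hjN, hzR, hηO _ hclose⟩
  let D : ℕ → Set (E n) := fun N₀ => ⋂ N ≥ N₀, ⋃ j ∈ Finset.range (N + 1), B N j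
  have hDmono : Monotone D := by
    intro N₀ N₁ h z hz
    simp only [D, mem_iInter] at hz ⊢
    exact fun N hN => hz N (h.trans hN)
  have hZD : Z ⊆ ⋃ N₀, D N₀ := by
    intro z hz
    obtain ⟨N₀, hN₀⟩ := hev z hz
    exact mem_iUnion.2 ⟨N₀, mem_iInter₂.2 hN₀⟩
  calc ENNReal.ofReal (r ^ n) * volume Z ≤ ENNReal.ofReal (r ^ n) * volume (⋃ N₀, D N₀) := by
        gcongr
    _ = ⨆ N₀, ENNReal.ofReal (r ^ n) * volume (D N₀) := by
        rw [hDmono.measure_iUnion, ENNReal.mul_iSup]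
    _ ≤ volume O := iSup_le fun N₀ => by
        refine le_trans ?_ (hA N₀)
        gcongr
        exact iInter₂_subset (s := fun N (_ : N ≥ N₀) => ⋃ j ∈ Finset.range (N + 1), B N j) N₀
          le_rfl

/-- A set that meets each level set of the slope in at most one point, away from the contact point
of the level set, is null: sliding it towards the contact points gives infinitely many disjoint
sets of comparable volume in a bounded region. -/
theorem volume_eq_zero_of_slide (hW : Continuous W) (hb : Continuous (gradient W))
    (hΞ : ∀ a ∈ Ξ, ∀ a' ∈ Ξ, tangent W a' a ≤ W a) (hZ : MeasurableSet Z) (hc : Measurable c)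
    (hcΞ : ∀ y ∈ Z, c y ∈ Ξ) (hopt : ∀ y ∈ Z, ∀ a' ∈ Ξ, tangent W a' y ≤ tangent W (c y) y)
    (hsharp : ∀ y ∈ Z, IsSharpAt W Ξ (c y) y) (hne : ∀ y ∈ Z, c y ≠ y)
    (hinj : InjOn (fun y => gradient W (c y)) Z) : volume Z = 0 := by
  by_contra hpos
  obtain ⟨R, hR⟩ : ∃ R : ℕ, (volume.restrict (Metric.ball (0 : E n) R)) Z ≠ 0 := by
    by_contra! hall
    refine hpos (measure_mono_null (t := ⋃ R : ℕ, Z ∩ Metric.ball (0 : E n) R) ?_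
      (measure_iUnion_null fun R => by rw [← Measure.restrict_apply hZ]; exact hall R))
    intro z hz
    obtain ⟨R, hR⟩ := exists_nat_gt ‖z‖
    exact mem_iUnion.2 ⟨R, hz, by simpa using hR⟩
  have : IsFiniteMeasure (volume.restrict (Metric.ball (0 : E n) R)) :=
    ⟨by simpa using measure_ball_lt_top⟩
  obtain ⟨K, hKZ, hK, hKpos, hcK⟩ := exists_isCompact_continuousOn hc hZ hR
  have hKvol : volume K ≠ 0 := fun h0 => hKpos (le_antisymm
    ((Measure.restrict_apply_le _ _).trans h0.le) zero_le)
  let T : ℝ → E n → E n := fun r y => AffineMap.homothety (c y) r y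
  let r : ℕ → ℝ := fun m => 1 - 1 / ((m : ℝ) + 2)
  have hr0 : ∀ m, 1 / 2 ≤ r m := by
    intro m
    have : (1 : ℝ) / ((m : ℝ) + 2) ≤ 1 / 2 := by
      apply one_div_le_one_div_of_le <;> [norm_num; linarith [(Nat.cast_nonneg m : (0 : ℝ) ≤ m)]]
    simp only [r]; linarith
  have hr1 : ∀ m, r m < 1 := by
    intro m
    have : (0 : ℝ) < 1 / ((m : ℝ) + 2) := by positivity
    simp only [r]; linarith
  have hrinj : Function.Injective r := by
    intro m m' h
    have h1 : (1 : ℝ) / ((m : ℝ) + 2) = 1 / ((m' : ℝ) + 2) := by simp only [r] at h; linarith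
    have h2 : (m : ℝ) + 2 = m' + 2 := by
      have := congrArg (fun t : ℝ => t⁻¹) h1
      simpa using this
    exact_mod_cast (by linarith : (m : ℝ) = m')
  have hTc : ContinuousOn (fun q : ℝ × E n => T q.1 q.2) (Icc 0 1 ×ˢ K) := by
    have h2 : ContinuousOn (fun q : ℝ × E n => c q.2) (Icc 0 1 ×ˢ K) :=
      hcK.comp continuousOn_snd (fun q hq => hq.2)
    simp only [T, AffineMap.homothety_apply, vsub_eq_sub, vadd_eq_add]
    exact (continuousOn_fst.smul (continuousOn_snd.sub h2)).add h2
  have hbig : IsCompact ((fun q : ℝ × E n => T q.1 q.2) '' (Icc 0 1 ×ˢ K)) :=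
    (isCompact_Icc.prod hK).image_of_continuousOn hTc
  have hsub : ∀ m, T (r m) '' K ⊆ (fun q : ℝ × E n => T q.1 q.2) '' (Icc 0 1 ×ˢ K) := by
    rintro m _ ⟨y, hy, rfl⟩
    exact ⟨(r m, y), ⟨⟨by linarith [hr0 m], (hr1 m).le⟩, hy⟩, rfl⟩
  have hTm : ∀ m, MeasurableSet (T (r m) '' K) := by
    intro m
    have : ContinuousOn (T (r m)) K :=
      hTc.comp (f := fun y => (r m, y)) (by fun_prop)
        (fun y hy => ⟨⟨by linarith [hr0 m], (hr1 m).le⟩, hy⟩)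
    exact (hK.image_of_continuousOn this).measurableSet
  -- The ratios `r m ≥ 1/2` are distinct, and each image retains at least the fraction `2⁻ⁿ` of the
  -- volume.
  have hlow : ∀ m, ENNReal.ofReal ((1 / 2) ^ n) * volume K ≤ volume (T (r m) '' K) := by
    intro m
    refine le_trans ?_ (volume_le_volume_slide hW hb hΞ hK hcK (fun y hy => hcΞ y (hKZ hy))
      (fun y hy => hsharp y (hKZ hy)) (hinj.mono hKZ) (by linarith [hr0 m]) (hr1 m))
    gcongr
    exact hr0 m
  -- At a common point `z` of two images, comparing the tangent functions at `c y` and `c y'` shows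
  -- that `c y'` is optimal at `y`, too; by sharpness the slopes, hence the points, coincide.
  have hdisj : Pairwise (Function.onFun Disjoint fun m => T (r m) '' K) := by
    intro m m' hmm
    rw [Function.onFun, Set.disjoint_left]
    rintro _ ⟨y, hy, rfl⟩ ⟨y', hy', he⟩
    have hy := hKZ hy
    have hy' := hKZ hy'
    set z := T (r m) y with hz
    have e1 : tangent W (c y) z = r m * tangent W (c y) y + (1 - r m) * W (c y) := by
      rw [hz, tangent_homothety, tangent_self]
    have e2 : tangent W (c y') z
        = r m * tangent W (c y') y + (1 - r m) * tangent W (c y') (c y) := by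
      rw [hz, tangent_homothety]
    have e3 : tangent W (c y') z = r m' * tangent W (c y') y' + (1 - r m') * W (c y') := by
      rw [← he, tangent_homothety, tangent_self]
    have e4 : tangent W (c y) z
        = r m' * tangent W (c y) y' + (1 - r m') * tangent W (c y) (c y') := by
      rw [← he, tangent_homothety]
    have i1 := hopt y hy _ (hcΞ y' hy')
    have i2 := hΞ _ (hcΞ y hy) _ (hcΞ y' hy')
    have i3 := hopt y' hy' _ (hcΞ y hy)
    have i4 := hΞ _ (hcΞ y' hy') _ (hcΞ y hy)
    have hle : tangent W (c y) y ≤ tangent W (c y') y := by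
      have j1 : tangent W (c y) z ≤ tangent W (c y') z := by
        rw [e4, e3]
        have k1 : 0 ≤ r m' := by linarith [hr0 m']
        have k2 : 0 ≤ 1 - r m' := by linarith [hr1 m']
        gcongr
      rw [e1, e2] at j1
      have k2 : (1 - r m) * tangent W (c y') (c y) ≤ (1 - r m) * W (c y) :=
        mul_le_mul_of_nonneg_left i2 (by linarith [hr1 m])
      have k3 : r m * tangent W (c y) y ≤ r m * tangent W (c y') y := by linarith
      exact le_of_mul_le_mul_left k3 (by linarith [hr0 m])
    have hgrad := (hsharp y hy).gradient_eq (hcΞ y' hy') hle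
    have hyy : y' = y := hinj hy' hy hgrad
    rw [hyy] at he
    have h4 : (r m' - r m) • (y - c y) = 0 := by
      have : r m' • (y - c y) + c y = r m • (y - c y) + c y := by
        simpa [hz, T, AffineMap.homothety_apply] using he
      rw [sub_smul, sub_eq_zero]
      exact add_right_cancel this
    rcases smul_eq_zero.1 h4 with h5 | h5
    · exact hmm (hrinj (sub_eq_zero.1 h5)).symm
    · exact hne y hy (sub_eq_zero.1 h5).symm
  have htop : ∑' _ : ℕ, ENNReal.ofReal ((1 / 2) ^ n) * volume K = ⊤ :=
    ENNReal.tsum_const_eq_top_of_ne_zero (mul_ne_zero (by simp) hKvol)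
  have hfin : ∑' _ : ℕ, ENNReal.ofReal ((1 / 2) ^ n) * volume K < ⊤ :=
    calc ∑' _ : ℕ, ENNReal.ofReal ((1 / 2) ^ n) * volume K
        ≤ ∑' m, volume (T (r m) '' K) := ENNReal.tsum_le_tsum hlow
      _ = volume (⋃ m, T (r m) '' K) := (measure_iUnion hdisj hTm).symm
      _ ≤ volume ((fun q : ℝ × E n => T q.1 q.2) '' (Icc 0 1 ×ˢ K)) :=
        measure_mono (iUnion_subset hsub)
      _ < ⊤ := hbig.measure_lt_top
  exact hfin.ne htop

end Sliding

end Tangent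

/-! ### The upper envelope of the tangent functions -/

section Envelope

variable {n : ℕ} {W : E n → ℝ}

/-- The upper envelope of the tangent functions of `W` with base point in `Ξ`; it is meaningful
where these functions are bounded above. -/
noncomputable def envelope (W : E n → ℝ) (Ξ : Set (E n)) (z : E n) : ℝ := ⨆ a : Ξ, tangent W a z

/-- The effective domain of the envelope. -/
def envelopeDomain (W : E n → ℝ) (Ξ : Set (E n)) : Set (E n) :=
  {z | BddAbove (range fun a : Ξ => tangent W a z)}

theorem tangent_combo (a y z : E n) {s t : ℝ} (hst : s + t = 1) :
    tangent W a (s • y + t • z) = s * tangent W a y + t * tangent W a z := by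
  have : s • y + t • z - a = s • (y - a) + t • (z - a) := by
    have h : a = s • a + t • a := by rw [← add_smul, hst, one_smul]
    nth_rewrite 1 [h]
    module
  simp only [tangent, this, inner_add_right, inner_smul_right]
  linear_combination (-W a) * hst

theorem tangent_le_envelope {Ξ : Set (E n)} {a z : E n} (ha : a ∈ Ξ)
    (hz : z ∈ envelopeDomain W Ξ) : tangent W a z ≤ envelope W Ξ z :=
  le_ciSup (f := fun a : Ξ => tangent W a z) hz ⟨a, ha⟩

theorem convexOn_envelope {Ξ : Set (E n)} (hne : Ξ.Nonempty) :
    ConvexOn ℝ (envelopeDomain W Ξ) (envelope W Ξ) := by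
  have := hne.to_subtype
  have key : ∀ y ∈ envelopeDomain W Ξ, ∀ z ∈ envelopeDomain W Ξ, ∀ s t : ℝ, 0 ≤ s → 0 ≤ t →
      s + t = 1 → ∀ a : Ξ, tangent W a (s • y + t • z)
        ≤ s * envelope W Ξ y + t * envelope W Ξ z := by
    intro y hy z hz s t hs ht hst a
    rw [tangent_combo _ _ _ hst]
    have h1 := tangent_le_envelope a.2 hy
    have h2 := tangent_le_envelope a.2 hz
    gcongr
  refine ⟨fun y hy z hz s t hs ht hst =>
    ⟨s * envelope W Ξ y + t * envelope W Ξ z, ?_⟩, fun y hy z hz s t hs ht hst => ?_⟩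
  · rintro _ ⟨a, rfl⟩
    exact key y hy z hz s t hs ht hst a
  · exact ciSup_le fun a => key y hy z hz s t hs ht hst a

/-- The effective domain is convex, so its boundary is null; in its interior the envelope is locally
Lipschitz, and Rademacher's theorem applies. -/
theorem ae_differentiableAt_envelope {Ξ : Set (E n)} (hne : Ξ.Nonempty) :
    ∀ᵐ y, y ∈ envelopeDomain W Ξ →
      y ∈ interior (envelopeDomain W Ξ) ∧ DifferentiableAt ℝ (envelope W Ξ) y := by
  have hconv := convexOn_envelope (W := W) hne
  set D := envelopeDomain W Ξ
  have h1 : ∀ᵐ y, y ∉ frontier D := measure_eq_zero_iff_ae_notMem.1 (hconv.1.addHaar_frontier _)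
  have h2 : ∀ᵐ y, y ∉ {y ∈ interior D | ¬ DifferentiableAt ℝ (envelope W Ξ) y} := by
    refine measure_eq_zero_iff_ae_notMem.1 (measure_null_of_locally_null _ fun y hy => ?_)
    obtain ⟨C, t, ht, hlip⟩ := hconv.locallyLipschitzOn_interior hy.1
    rw [isOpen_interior.nhdsWithin_eq hy.1] at ht
    obtain ⟨U, hUt, hU, hyU⟩ := mem_nhds_iff.1 ht
    refine ⟨{y ∈ interior D | ¬ DifferentiableAt ℝ (envelope W Ξ) y} ∩ U,
      inter_mem self_mem_nhdsWithin (mem_nhdsWithin_of_mem_nhds (hU.mem_nhds hyU)), ?_⟩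
    have h3 := (hlip.mono hUt).ae_differentiableWithinAt_of_mem (μ := (volume : Measure (E n)))
    refine measure_mono_null ?_ (ae_iff.1 h3)
    rintro z ⟨⟨_, hz⟩, hzU⟩ hcon
    exact hz ((hcon hzU).differentiableAt (hU.mem_nhds hzU))
  filter_upwards [h1, h2] with y hy1 hy2 hyD
  have hint : y ∈ interior D := by
    by_contra hcon
    exact hy1 ⟨subset_closure hyD, hcon⟩
  refine ⟨hint, ?_⟩
  by_contra hcon
  exact hy2 ⟨hint, hcon⟩

/-- At almost every point, a tangent function that attains the envelope has the slope of the
envelope, and it does so sharply. -/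
theorem ae_isSharpAt (W : E n → ℝ) (Ξ : Set (E n)) :
    ∀ᵐ y, ∀ a ∈ Ξ, (∀ a' ∈ Ξ, tangent W a' y ≤ tangent W a y) →
      gradient W a = gradient (envelope W Ξ) y ∧ IsSharpAt W Ξ a y := by
  rcases Ξ.eq_empty_or_nonempty with rfl | hne
  · simp
  filter_upwards [ae_differentiableAt_envelope (W := W) hne] with y hy a ha hopt
  have hyD : y ∈ envelopeDomain W Ξ := by
    refine ⟨tangent W a y, ?_⟩
    rintro _ ⟨a', rfl⟩
    exact hopt a' a'.2
  obtain ⟨hint, hdiff⟩ := hy hyD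
  have := hne.to_subtype
  have hval : envelope W Ξ y = tangent W a y :=
    le_antisymm (ciSup_le fun a' => hopt a' a'.2) (tangent_le_envelope ha hyD)
  have hnear : ∀ᶠ z in 𝓝 y, z ∈ envelopeDomain W Ξ := mem_interior_iff_mem_nhds.1 hint
  have hgrad := hdiff.hasGradientAt
  have htan : HasGradientAt (fun z => tangent W a z) (gradient W a) y := by
    rw [hasGradientAt_iff_hasFDerivAt]
    have h1 : HasFDerivAt (fun z : E n => z - a) (ContinuousLinearMap.id ℝ (E n)) y :=
      (hasFDerivAt_id y).sub_const a
    have h2 := ((innerSL ℝ (gradient W a)).hasFDerivAt.comp y h1).const_add (W a)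
    exact h2
  have heq : gradient (envelope W Ξ) y = gradient W a := by
    have hmin : IsLocalMin (fun z => envelope W Ξ z - tangent W a z) y := by
      filter_upwards [hnear] with z hz
      rw [hval, sub_self]
      exact sub_nonneg.2 (tangent_le_envelope ha hz)
    have h0 := hmin.hasFDerivAt_eq_zero (hgrad.hasFDerivAt.sub htan.hasFDerivAt)
    rw [← map_sub] at h0
    exact sub_eq_zero.1 ((map_eq_zero_iff _ (InnerProductSpace.toDual ℝ (E n)).injective).1 h0)
  refine ⟨heq.symm, fun η hη => ?_⟩
  rw [heq] at hgrad
  have hlit := (hasGradientAt_iff_isLittleO.1 hgrad).def (show (0 : ℝ) < η / 4 by linarith)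
  obtain ⟨ρ', hρ', hball⟩ := Metric.eventually_nhds_iff.1 (hlit.and hnear)
  set ρ := ρ' / 2 with hρdef
  have hρ : 0 < ρ := half_pos hρ'
  refine ⟨η * ρ / 4, by positivity, fun a' ha' hlt => ?_⟩
  -- If the slope at `a'` were far from that at `a`, a step of length `ρ` in the direction of the
  -- difference of the slopes would lift the tangent function at `a'` above the envelope.
  by_contra! hcon
  set d := gradient W a' - gradient W a with hd
  have hd0 : 0 < ‖d‖ := hη.trans_le hcon
  set h := (ρ / ‖d‖) • d with hh
  have hhn : ‖h‖ = ρ := by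
    rw [hh, norm_smul, Real.norm_of_nonneg (by positivity)]
    field_simp
  obtain ⟨e1, e2⟩ := @hball (y + h) (by
    rw [dist_eq_norm, add_sub_cancel_left, hhn, hρdef]; linarith)
  rw [add_sub_cancel_left, hhn, hval, Real.norm_eq_abs] at e1
  have e3 := tangent_le_envelope ha' e2
  have e4 := tangent_sub (W := W) a' (y + h) y
  rw [add_sub_cancel_left] at e4
  have e5 : ⟪d, h⟫ = ρ * ‖d‖ := by
    rw [hh, inner_smul_right, real_inner_self_eq_norm_sq]
    field_simp
  have e6 : ⟪d, h⟫ = ⟪gradient W a', h⟫ - ⟪gradient W a, h⟫ := by rw [hd, inner_sub_left]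
  have e7 := (abs_le.1 e1).2
  have e8 : ρ * η ≤ ρ * ‖d‖ := by gcongr
  nlinarith [mul_pos hρ hη]

theorem measurable_gradient (F : E n → ℝ) : Measurable (gradient F) := by
  have : gradient F = fun x => (InnerProductSpace.toDual ℝ (E n)).symm (fderiv ℝ F x) := rfl
  rw [this]
  exact (InnerProductSpace.toDual ℝ (E n)).symm.continuous.measurable.comp (measurable_fderiv ℝ F)

/-- The law of an expanding function of the state has a density when the state has one. -/
theorem absolutelyContinuous_map {L : ℕ} {𝒳 : Set (E L)} (h𝒳 : MeasurableSet 𝒳) {μ : Measure 𝒳}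
    (hμ : μ ≪ (volume : Measure (E L)).comap Subtype.val) {g : 𝒳 → E L} (hgm : Measurable g)
    {K : NNReal} (hg : AntilipschitzWith K g) : μ.map g ≪ (volume : Measure (E L)) := by
  refine Measure.AbsolutelyContinuous.mk fun s hs h0 => ?_
  rw [Measure.map_apply hgm hs]
  refine hμ ?_
  rw [(MeasurableEmbedding.subtype_coe h𝒳).comap_apply]
  have hac : ∀ t : Set (E L),
      volume t = 0 ↔ (Measure.hausdorffMeasure (L : ℝ) : Measure (E L)) t = 0 := by
    intro t
    exact ⟨fun h => Measure.absolutelyContinuous_isAddHaarMeasure _ _ h,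
      fun h => Measure.absolutelyContinuous_isAddHaarMeasure _ _ h⟩
  rw [hac] at h0 ⊢
  have h1 : (Measure.hausdorffMeasure (L : ℝ) : Measure 𝒳) (g ⁻¹' s) = 0 :=
    le_antisymm ((hg.hausdorffMeasure_preimage_le (Nat.cast_nonneg L) s).trans
      (by rw [h0, mul_zero])) zero_le
  rw [(isometry_subtype_coe).hausdorffMeasure_image (Or.inl (Nat.cast_nonneg L)), h1]

end Envelope

/-! ### A conditional form of Lyapunov's theorem -/

section Lyapunov

/-- Stated for an arbitrary σ-algebra, which need not be the canonical instance. -/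
theorem measurable_inv_one_add_abs {X : Type*} {_ : MeasurableSpace X} {u v : X → ℝ}
    (hu : Measurable u) (hv : Measurable v) : Measurable fun x => (1 + |u x| + |v x|)⁻¹ := by
  fun_prop

variable {X : Type*} {m m0 : MeasurableSpace X} {μ : Measure X} [IsFiniteMeasure μ]

theorem condExp_ae_zero_of_indicator {h : X → ℝ} (hi : Integrable h μ) {S : Set X}
    (hS : MeasurableSet[m] S) (h0 : ∀ x ∉ S, h x = 0) : ∀ᵐ x ∂μ, x ∉ S → (μ[h|m]) x = 0 := by
  have h1 := condExp_indicator (m := m) hi hS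
  have h2 : S.indicator h = h := by
    ext x
    by_cases hx : x ∈ S
    · simp [hx]
    · simp [hx, h0 x hx]
  rw [h2] at h1
  filter_upwards [h1] with x hx hxS
  rw [hx, indicator_of_notMem hxS]

theorem measurableSet_condExp_pos (h : X → ℝ) : MeasurableSet[m] {x | 0 < (μ[h|m]) x} := by
  have h1 : Measurable[m] (μ[h|m]) := stronglyMeasurable_condExp.measurable
  exact h1 measurableSet_Ioi

/-- A nonnegative function vanishes almost everywhere where its conditional expectation is not
positive. -/
theorem ae_eq_zero_of_condExp_le (hm : m ≤ m0) {h : X → ℝ} (hi : Integrable h μ)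
    (hnn : ∀ x, 0 ≤ h x) : ∀ᵐ x ∂μ, ¬ 0 < (μ[h|m]) x → h x = 0 := by
  set S : Set X := {x | ¬ 0 < (μ[h|m]) x} with hS
  have hSm : MeasurableSet[m] S :=
    (measurableSet_condExp_pos h).compl
  have h1 : ∫ x in S, h x ∂μ ≤ 0 := by
    rw [← setIntegral_condExp hm hi hSm]
    exact setIntegral_nonpos (hm _ hSm) fun x hx => not_lt.1 hx
  have h2 := (setIntegral_eq_zero_iff_of_nonneg_ae (ae_of_all _ hnn) hi.integrableOn).1
    (le_antisymm h1 (integral_nonneg hnn))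
  exact (ae_restrict_iff' (hm _ hSm)).1 h2

theorem measure_inter_ne_zero_of_condExp (hm : m ≤ m0) {Z S : Set X} (hZ : MeasurableSet Z)
    (hS : MeasurableSet[m] S) (hS0 : μ S ≠ 0)
    (hpos : ∀ᵐ x ∂μ, x ∈ S → 0 < (μ[Z.indicator (fun _ => (1 : ℝ))|m]) x) : μ (Z ∩ S) ≠ 0 := by
  intro h0
  have hi : Integrable (Z.indicator fun _ => (1 : ℝ)) μ := (integrable_const 1).indicator hZ
  have h1 : ∫ x in S, (μ[Z.indicator (fun _ => (1 : ℝ))|m]) x ∂μ = 0 := by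
    rw [setIntegral_condExp hm hi hS, integral_indicator hZ, Measure.restrict_restrict hZ]
    simp [Measure.restrict_eq_zero.2 h0]
  have h2 := (setIntegral_eq_zero_iff_of_nonneg_ae
    ((ae_restrict_iff' (hm _ hS)).2 (hpos.mono fun x hx hxS => (hx hxS).le))
    integrable_condExp.integrableOn).1 h1
  have h3 := (ae_restrict_iff' (hm _ hS)).1 h2
  refine hS0 (measure_eq_zero_iff_ae_notMem.2 ?_)
  filter_upwards [h3, hpos] with x hx1 hx2 hxS
  exact (hx2 hxS).ne' (hx1 hxS)

/-- If every set of positive measure inside `Z₀` can be split in two parts which both have positive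
conditional probability given `m` on a common event, then every such set carries a bounded function
that is not zero and is conditionally orthogonal to finitely many given integrable functions. The
proof adds the functions one at a time: if `h₁` and `h₂` live on two such parts and are orthogonal
to the earlier functions, then so is `E[h₂ u|m] h₁ - E[h₁ u|m] h₂`, which is also orthogonal
to `u`. -/
theorem exists_condExp_mul_eq_zero (hm : m ≤ m0) {Z₀ : Set X}
    (hsplit : ∀ Z ⊆ Z₀, MeasurableSet Z → μ Z ≠ 0 → ∃ Z₁ ⊆ Z, MeasurableSet Z₁ ∧
      μ {x | 0 < (μ[Z₁.indicator (fun _ => (1 : ℝ))|m]) x ∧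
        0 < (μ[(Z \ Z₁).indicator (fun _ => (1 : ℝ))|m]) x} ≠ 0)
    {ι : Type*} (s : Finset ι) (u : ι → X → ℝ) (hu : ∀ i ∈ s, Integrable (u i) μ) :
    ∀ Z ⊆ Z₀, MeasurableSet Z → μ Z ≠ 0 → ∃ h : X → ℝ, Measurable h ∧ (∀ x, |h x| ≤ 1) ∧
      (∀ x ∉ Z, h x = 0) ∧ μ {x | h x ≠ 0} ≠ 0 ∧ ∀ i ∈ s, μ[h * u i|m] =ᵐ[μ] 0 := by
  classical
  induction s using Finset.induction_on with
  | empty =>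
    intro Z hZ hZm hZ0
    refine ⟨Z.indicator fun _ => 1, measurable_const.indicator hZm, fun x => ?_, fun x hx => ?_,
      ?_, by simp⟩
    · by_cases hx : x ∈ Z <;> simp [hx]
    · simp [hx]
    · convert hZ0 using 2
      ext x
      by_cases hx : x ∈ Z <;> simp [hx]
  | insert i s his ih =>
    intro Z hZ hZm hZ0
    have ih := ih fun j hj => hu j (Finset.mem_insert_of_mem hj)
    have hui := hu i (Finset.mem_insert_self i s)
    obtain ⟨Z₁, hZ₁, hZ₁m, hE⟩ := hsplit Z hZ hZm hZ0
    set e₁ := μ[Z₁.indicator (fun _ => (1 : ℝ))|m] with he₁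
    set e₂ := μ[(Z \ Z₁).indicator (fun _ => (1 : ℝ))|m] with he₂
    set S : Set X := {x | 0 < e₁ x ∧ 0 < e₂ x} with hSdef
    have hSm : MeasurableSet[m] S :=
      (measurableSet_condExp_pos _).inter (measurableSet_condExp_pos _)
    have hb : ∀ {h : X → ℝ}, Measurable h → (∀ x, |h x| ≤ 1) → ∀ j ∈ insert i s,
        Integrable (h * u j) μ := by
      intro h hh hh1 j hj
      exact (hu j hj).bdd_mul hh.aestronglyMeasurable (ae_of_all _ hh1)
    obtain ⟨h₁, h₁m, h₁b, h₁Z, h₁0, h₁s⟩ := ih (Z₁ ∩ S)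
      ((inter_subset_left.trans hZ₁).trans hZ) (hZ₁m.inter (hm _ hSm))
      (measure_inter_ne_zero_of_condExp hm hZ₁m hSm hE (ae_of_all _ fun x hx => hx.1))
    set k : X → ℝ := fun x => |h₁ x| with hk
    have h₁i : Integrable k μ :=
      Integrable.mono' (integrable_const 1) (h₁m.abs).aestronglyMeasurable
        (ae_of_all _ fun x => by simpa [hk] using h₁b x)
    set S₁ : Set X := {x | 0 < (μ[k|m]) x} with hS₁
    have hS₁m : MeasurableSet[m] S₁ := measurableSet_condExp_pos _
    have hSS₁ : μ (S ∩ S₁) ≠ 0 := by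
      intro h0
      have e1 := condExp_ae_zero_of_indicator h₁i hSm (fun x hx => by
        simp only [hk]; rw [h₁Z x fun h => hx h.2, abs_zero])
      have e2 := ae_eq_zero_of_condExp_le hm h₁i fun x => abs_nonneg _
      refine h₁0 (measure_eq_zero_iff_ae_notMem.2 ?_)
      filter_upwards [e1, e2, measure_eq_zero_iff_ae_notMem.1 h0] with x hx1 hx2 hx3 hx4
      by_cases hxS : x ∈ S
      · exact hx4 (abs_eq_zero.1 (hx2 fun h => hx3 ⟨hxS, h⟩))
      · exact hx4 (abs_eq_zero.1 (hx2 (by rw [hx1 hxS]; exact lt_irrefl 0)))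
    obtain ⟨h₂, h₂m, h₂b, h₂Z, h₂0, h₂s⟩ := ih ((Z \ Z₁) ∩ (S ∩ S₁))
      ((inter_subset_left.trans sdiff_subset).trans hZ)
      ((hZm.diff hZ₁m).inter ((hm _ hSm).inter (hm _ hS₁m)))
      (measure_inter_ne_zero_of_condExp hm (hZm.diff hZ₁m) (hSm.inter hS₁m) hSS₁
        (ae_of_all _ fun x hx => hx.1.2))
    set c₁ := μ[h₁ * u i|m] with hc₁
    set c₂ := μ[h₂ * u i|m] with hc₂
    have hc₁m : StronglyMeasurable[m] c₁ := stronglyMeasurable_condExp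
    have hc₂m : StronglyMeasurable[m] c₂ := stronglyMeasurable_condExp
    -- The factor `d`, a function measurable for `m`, makes the combination bounded by `1`.
    set d : X → ℝ := fun x => (1 + |c₁ x| + |c₂ x|)⁻¹ with hd
    have hdpos : ∀ x, 0 < d x := fun x => by simp only [hd]; positivity
    have hdm : Measurable[m] d :=
      @measurable_inv_one_add_abs X m _ _ hc₁m.measurable hc₂m.measurable
    have hd1m : StronglyMeasurable[m] (fun x => d x * c₁ x) :=
      (hdm.mul hc₁m.measurable).stronglyMeasurable
    have hd2m : StronglyMeasurable[m] (fun x => d x * c₂ x) :=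
      (hdm.mul hc₂m.measurable).stronglyMeasurable
    have hd1 : ∀ x, |d x * c₁ x| ≤ 1 := fun x => by
      rw [abs_mul, abs_of_pos (hdpos x)]
      simp only [hd]
      rw [inv_mul_le_iff₀ (by positivity)]
      linarith [abs_nonneg (c₁ x), abs_nonneg (c₂ x)]
    have hd2 : ∀ x, |d x * c₂ x| ≤ 1 := fun x => by
      rw [abs_mul, abs_of_pos (hdpos x)]
      simp only [hd]
      rw [inv_mul_le_iff₀ (by positivity)]
      linarith [abs_nonneg (c₁ x), abs_nonneg (c₂ x)]
    -- `h₁` and `h₂` have disjoint supports.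
    have hdisj : ∀ x, h₁ x = 0 ∨ h₂ x = 0 := fun x => by
      by_cases hx : x ∈ Z₁
      · exact Or.inr (h₂Z x fun h => h.1.2 hx)
      · exact Or.inl (h₁Z x fun h => hx h.1)
    set h : X → ℝ := fun x => d x * c₂ x * h₁ x - d x * c₁ x * h₂ x with hh
    have hhm : Measurable h :=
      ((hd2m.measurable.mono hm le_rfl).mul h₁m).sub ((hd1m.measurable.mono hm le_rfl).mul h₂m)
    by_cases hzero : μ {x | h x ≠ 0} = 0
    · -- In the degenerate case `E[h₂ u|m] = 0`, and `h₂` itself is orthogonal to `u`.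
      refine ⟨h₂, h₂m, h₂b, fun x hx => h₂Z x fun hcon => hx hcon.1.1, h₂0, fun j hj => ?_⟩
      rcases Finset.mem_insert.1 hj with rfl | hj
      · have hae : ∀ᵐ x ∂μ, d x * c₂ x * |h₁ x| = 0 := by
          filter_upwards [measure_eq_zero_iff_ae_notMem.1 hzero] with x hx
          replace hx : h x = 0 := not_not.1 hx
          rcases hdisj x with h0 | h0
          · simp [h0]
          · simp only [hh, h0, mul_zero, sub_zero] at hx
            rcases mul_eq_zero.1 hx with h3 | h3 <;> simp [h3]
        have hpull := condExp_mul_of_stronglyMeasurable_left (μ := μ) (m := m) hd2m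
          (g := k) (h₁i.bdd_mul (hd2m.mono hm).aestronglyMeasurable
            (ae_of_all _ hd2)) h₁i
        have hz : μ[(fun x => d x * c₂ x) * k|m] =ᵐ[μ] 0 := by
          have : ((fun x => d x * c₂ x) * k) =ᵐ[μ] 0 := hae
          simpa using condExp_congr_ae (m := m) this
        have hoff := condExp_ae_zero_of_indicator
          (hb h₂m h₂b j (Finset.mem_insert_self _ _)) hS₁m (fun x hx => by
            rw [Pi.mul_apply, h₂Z x fun h => hx h.2.2, zero_mul])
        filter_upwards [hpull, hz, hoff] with x hx1 hx2 hx3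
        by_cases hxS : x ∈ S₁
        · rw [hx2] at hx1
          have hx1 := hx1.symm
          simp only [Pi.mul_apply, Pi.zero_apply, mul_eq_zero] at hx1
          rcases hx1 with (h4 | h4) | h4
          · exact absurd h4 (hdpos x).ne'
          · exact h4
          · exact absurd h4 (ne_of_gt hxS)
        · exact hx3 hxS
      · exact h₂s j hj
    · refine ⟨h, hhm, fun x => ?_, fun x hx => ?_, hzero, fun j hj => ?_⟩
      · rcases hdisj x with h0 | h0
        · simp only [hh, h0, mul_zero, zero_sub, abs_neg]
          rw [abs_mul]
          exact mul_le_one₀ (hd1 x) (abs_nonneg _) (h₂b x)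
        · simp only [hh, h0, mul_zero, sub_zero]
          rw [abs_mul]
          exact mul_le_one₀ (hd2 x) (abs_nonneg _) (h₁b x)
      · have e1 : h₁ x = 0 := h₁Z x fun hcon => hx (hZ₁ hcon.1)
        have e2 : h₂ x = 0 := h₂Z x fun hcon => hx hcon.1.1
        simp [hh, e1, e2]
      · have i1 := hb h₁m h₁b j hj
        have i2 := hb h₂m h₂b j hj
        have j1 : Integrable ((fun x => d x * c₂ x) * (h₁ * u j)) μ :=
          i1.bdd_mul (hd2m.mono hm).aestronglyMeasurable (ae_of_all _ hd2)
        have j2 : Integrable ((fun x => d x * c₁ x) * (h₂ * u j)) μ :=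
          i2.bdd_mul (hd1m.mono hm).aestronglyMeasurable (ae_of_all _ hd1)
        have hdec : h * u j = (fun x => d x * c₂ x) * (h₁ * u j)
            - (fun x => d x * c₁ x) * (h₂ * u j) := by
          ext x
          simp only [hh, Pi.mul_apply, Pi.sub_apply]
          ring
        rw [hdec]
        have k0 := condExp_sub (μ := μ) j1 j2 m
        have k1 := condExp_mul_of_stronglyMeasurable_left (μ := μ) (m := m) hd2m j1 i1
        have k2 := condExp_mul_of_stronglyMeasurable_left (μ := μ) (m := m) hd1m j2 i2
        have k3 : ∀ᵐ x ∂μ, d x * c₂ x * (μ[h₁ * u j|m]) x - d x * c₁ x * (μ[h₂ * u j|m]) x = 0 := by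
          rcases Finset.mem_insert.1 hj with rfl | hj
          · exact ae_of_all _ fun x => by simp only [← hc₁, ← hc₂]; ring
          · filter_upwards [h₁s j hj, h₂s j hj] with x hx1 hx2
            rw [hx1, hx2]
            simp
        filter_upwards [k0, k1, k2, k3] with x hx0 hx1 hx2 hx3
        rw [hx0, Pi.sub_apply, hx1, hx2]
        exact hx3

/-- If a set cannot be split relative to the σ-algebra of `β`, then `β` is injective on it up to a
null set. -/
theorem exists_injOn_of_not_split {Y : Type*} [MeasurableSpace Y]
    [MeasurableSpace.CountablySeparated X]
    {β : X → Y} (hβ : Measurable β) {Z : Set X} (hZ : MeasurableSet Z)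
    (hns : ∀ Z₁ ⊆ Z, MeasurableSet Z₁ →
      μ {x | 0 < (μ[Z₁.indicator (fun _ => (1 : ℝ))|MeasurableSpace.comap β inferInstance]) x ∧
        0 < (μ[(Z \ Z₁).indicator (fun _ => (1 : ℝ))|MeasurableSpace.comap β inferInstance]) x}
        = 0) :
    ∃ N, MeasurableSet N ∧ μ N = 0 ∧ InjOn β (Z \ N) := by
  have hm : MeasurableSpace.comap β inferInstance ≤ m0 := hβ.comap_le
  -- A countable family `S` of measurable sets separates points. On `Z`, membership in `S n` agrees
  -- almost everywhere with membership in a set that is measurable for `β`.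
  obtain ⟨S, hSm, hS⟩ := exists_seq_separating X (p := MeasurableSet) MeasurableSet.empty univ
  let A : ℕ → Set X := fun n => {x | 0 <
    (μ[(Z ∩ S n).indicator (fun _ => (1 : ℝ))|MeasurableSpace.comap β inferInstance]) x}
  have hA : ∀ n, ∃ F : Set Y, β ⁻¹' F = A n := fun n => by
    have : MeasurableSet[MeasurableSpace.comap β inferInstance] (A n) :=
      measurableSet_condExp_pos _
    obtain ⟨F, -, hF⟩ := MeasurableSpace.measurableSet_comap.1 this
    exact ⟨F, hF⟩
  have hae : ∀ᵐ x ∂μ, ∀ n, x ∈ Z → (x ∈ S n ↔ x ∈ A n) := by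
    refine ae_all_iff.2 fun n => ?_
    have h1 := ae_eq_zero_of_condExp_le (μ := μ) hm
      ((integrable_const (1 : ℝ)).indicator (hZ.inter (hSm n)))
      (fun x => indicator_nonneg (fun _ _ => zero_le_one) x)
    have h2 := ae_eq_zero_of_condExp_le (μ := μ) hm
      ((integrable_const (1 : ℝ)).indicator (hZ.diff (hZ.inter (hSm n))))
      (fun x => indicator_nonneg (fun _ _ => zero_le_one) x)
    have h3 := measure_eq_zero_iff_ae_notMem.1 (hns (Z ∩ S n) inter_subset_left (hZ.inter (hSm n)))
    filter_upwards [h1, h2, h3] with x hx1 hx2 hx3 hxZ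
    constructor
    · intro hxS
      by_contra hcon
      have := hx1 hcon
      rw [indicator_of_mem (show x ∈ Z ∩ S n from ⟨hxZ, hxS⟩)] at this
      exact one_ne_zero this
    · intro hxA
      by_contra hcon
      have := hx2 fun h => hx3 ⟨hxA, h⟩
      rw [indicator_of_mem
        (show x ∈ Z \ (Z ∩ S n) from ⟨hxZ, fun h => hcon h.2⟩)] at this
      exact one_ne_zero this
  refine ⟨toMeasurable μ {x | ¬ ∀ n, x ∈ Z → (x ∈ S n ↔ x ∈ A n)}, measurableSet_toMeasurable _ _,
    by rw [measure_toMeasurable]; exact hae, ?_⟩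
  intro x hx y hy hxy
  have hx' : ∀ n, x ∈ Z → (x ∈ S n ↔ x ∈ A n) := by
    by_contra hcon; exact hx.2 (subset_toMeasurable _ _ hcon)
  have hy' : ∀ n, y ∈ Z → (y ∈ S n ↔ y ∈ A n) := by
    by_contra hcon; exact hy.2 (subset_toMeasurable _ _ hcon)
  refine hS x (mem_univ _) y (mem_univ _) fun n => ?_
  rw [hx' n hx.1, hy' n hy.1]
  obtain ⟨F, hF⟩ := hA n
  rw [← hF, mem_preimage, mem_preimage, hxy]

/-- A function with vanishing conditional expectation given `β` is orthogonal to the bounded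
functions of `β`. -/
theorem integral_mul_comp_eq_zero {Y : Type*} [MeasurableSpace Y] {β : X → Y} (hβ : Measurable β)
    {h : X → ℝ} (hi : Integrable h μ)
    (h0 : μ[h|MeasurableSpace.comap β inferInstance] =ᵐ[μ] 0) {φ : Y → ℝ} (hφ : Measurable φ)
    {C : ℝ} (hC : ∀ y, |φ y| ≤ C) : ∫ x, φ (β x) * h x ∂μ = 0 := by
  have hm : MeasurableSpace.comap β inferInstance ≤ m0 := hβ.comap_le
  have hsm : StronglyMeasurable[MeasurableSpace.comap β inferInstance] (fun x => φ (β x)) :=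
    (hφ.comp (comap_measurable β)).stronglyMeasurable
  have hint : Integrable ((fun x => φ (β x)) * h) μ :=
    hi.bdd_mul (hsm.mono hm).aestronglyMeasurable (ae_of_all _ fun x => hC (β x))
  have h1 := condExp_mul_of_stronglyMeasurable_left (μ := μ) hsm hint hi
  have h2 : ∫ x, ((fun x => φ (β x)) * h) x ∂μ = 0 := by
    rw [← integral_condExp hm (f := (fun x => φ (β x)) * h)]
    refine integral_eq_zero_of_ae ?_
    filter_upwards [h1, h0] with x hx1 hx2
    rw [hx1, Pi.mul_apply, hx2]
    simp
  exact h2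

end Lyapunov

/-! ### Reassigning states to codes -/

section Perspective

variable {n : ℕ} {W : E n → ℝ}

/-- The derivative of the perspective function `η ↦ (1 + η s) W((a + η y) / (1 + η s))`, the
contribution to the value of a posterior of mass `1 + η s` with integral `a + η y`. -/
theorem hasDerivAt_perspective (hW : Differentiable ℝ W) (s : ℝ) (a y : E n) {η : ℝ}
    (h : 1 + η * s ≠ 0) :
    HasDerivAt (fun η : ℝ => (1 + η * s) * W ((1 + η * s)⁻¹ • (a + η • y)))
      (s * W ((1 + η * s)⁻¹ • (a + η • y))
        + ⟪gradient W ((1 + η * s)⁻¹ • (a + η • y)), y - s • ((1 + η * s)⁻¹ • (a + η • y))⟫) η := by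
  have h1 : HasDerivAt (fun η : ℝ => 1 + η * s) s η := by
    simpa using ((hasDerivAt_id η).mul_const s).const_add 1
  have h2 : HasDerivAt (fun η : ℝ => a + η • y) y η := by
    simpa using ((hasDerivAt_id η).smul_const y).const_add a
  have h3 := (h1.inv h).smul h2
  have h4 := (hW ((1 + η * s)⁻¹ • (a + η • y))).hasGradientAt.hasFDerivAt.comp_hasDerivAt η h3
  have h5 := h1.mul h4
  refine h5.congr_deriv ?_
  simp only [Function.comp_apply, InnerProductSpace.toDual_apply_apply, Pi.smul_apply',
    Pi.inv_apply]
  generalize gradient W ((1 + η * s)⁻¹ • (a + η • y)) = v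
  generalize W ((1 + η * s)⁻¹ • (a + η • y)) = w
  simp only [inner_add_right, inner_sub_right, inner_smul_right, div_eq_mul_inv, ← inv_pow]
  have hD : (1 + η * s) * (1 + η * s)⁻¹ = 1 := mul_inv_cancel₀ h
  linear_combination (⟪v, y⟫ - s * (1 + η * s)⁻¹ * (⟪v, a⟫ + η * ⟪v, y⟫)) * hD

/-- The code of a label after its posterior has been changed: the mass changes by `η s`, and the
integral of `g` by `η y`. -/
noncomputable def perturbedCode (s : E n → ℝ) (y : E n → E n) (η : ℝ) (a : E n) : E n :=
  (1 + η * s a)⁻¹ • (a + η • y a)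

theorem measurable_perturbedCode {s : E n → ℝ} {y : E n → E n} (hs : Measurable s)
    (hy : Measurable y) (η : ℝ) : Measurable (perturbedCode s y η) := by
  unfold perturbedCode
  fun_prop

theorem half_le_one_add_mul {η s : ℝ} (hη : |η| ≤ 1 / 2) (hs : |s| ≤ 1) : 1 / 2 ≤ 1 + η * s := by
  have : |η * s| ≤ 1 / 2 * 1 := by rw [abs_mul]; gcongr
  linarith [neg_le_of_abs_le this]

variable {s : E n → ℝ} {y : E n → E n} {R C : ℝ}

theorem norm_perturbedCode_le (hs : ∀ a, |s a| ≤ 1) (hy : ∀ a, ‖y a‖ ≤ C) {η : ℝ}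
    (hη : |η| ≤ 1 / 2) {a : E n} (ha : ‖a‖ ≤ R) : ‖perturbedCode s y η a‖ ≤ 2 * (R + C) := by
  have h1 := half_le_one_add_mul hη (hs a)
  have h2 : ‖a + η • y a‖ ≤ R + C := by
    refine (norm_add_le _ _).trans (add_le_add ha ?_)
    rw [norm_smul, Real.norm_eq_abs]
    have := norm_nonneg (y a)
    nlinarith [hy a]
  rw [perturbedCode, norm_smul, norm_inv, Real.norm_of_nonneg (by linarith),
    inv_mul_le_iff₀ (by linarith)]
  have := (norm_nonneg _).trans h2
  nlinarith

theorem perturbedCode_eq_self {η : ℝ} {a : E n} (h0 : s a = 0 ∧ y a = 0) :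
    perturbedCode s y η a = a := by
  simp [perturbedCode, h0.1, h0.2]

/-- The derivative of the value when the posteriors of a bounded set of labels are perturbed. -/
theorem hasDerivAt_integral_perspective {ν : Measure (E n)} [IsFiniteMeasure ν]
    (hW : Differentiable ℝ W) (hb : Continuous (gradient W)) (hi : Integrable W ν)
    (hsm : Measurable s) (hym : Measurable y) (hs : ∀ a, |s a| ≤ 1) (hy : ∀ a, ‖y a‖ ≤ C)
    (h0 : ∀ a, R < ‖a‖ → s a = 0 ∧ y a = 0) :
    Integrable (fun a => s a * W a + ⟪gradient W a, y a - s a • a⟫) ν ∧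
      HasDerivAt (fun η => ∫ a, (1 + η * s a) * W (perturbedCode s y η a) ∂ν)
        (∫ a, (s a * W a + ⟪gradient W a, y a - s a • a⟫) ∂ν) 0 := by
  have hC : 0 ≤ C := (norm_nonneg _).trans (hy 0)
  obtain ⟨K, hK⟩ := (isCompact_closedBall (0 : E n) (2 * (R + C))).exists_bound_of_continuousOn
    hW.continuous.continuousOn
  obtain ⟨K', hK'⟩ := (isCompact_closedBall (0 : E n) (2 * (R + C))).exists_bound_of_continuousOn
    hb.continuousOn
  let F' : ℝ → E n → ℝ := fun η a => s a * W (perturbedCode s y η a)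
    + ⟪gradient W (perturbedCode s y η a), y a - s a • perturbedCode s y η a⟫
  have hz : ∀ a, perturbedCode s y 0 a = a := fun a => by simp [perturbedCode]
  have key := hasDerivAt_integral_of_dominated_loc_of_deriv_le (μ := ν) (x₀ := (0 : ℝ))
    (F := fun η a => (1 + η * s a) * W (perturbedCode s y η a)) (F' := F')
    (bound := fun _ => |K| + |K'| * (C + 2 * (|R| + C)))
    (s := Metric.ball 0 (1 / 2)) (Metric.ball_mem_nhds _ (by norm_num)) ?_ ?_ ?_ ?_
    (integrable_const _) ?_
  · have e : F' 0 = fun a => s a * W a + ⟪gradient W a, y a - s a • a⟫ := by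
      funext a
      simp only [F', hz]
    rw [e] at key
    exact key
  · refine Eventually.of_forall fun η => Measurable.aestronglyMeasurable ?_
    exact (by fun_prop : Measurable fun a => 1 + η * s a).mul
      (hW.continuous.measurable.comp (measurable_perturbedCode hsm hym η))
  · simpa [hz] using hi
  · refine Measurable.aestronglyMeasurable ?_
    have hp := measurable_perturbedCode hsm hym 0
    exact (hsm.mul (hW.continuous.measurable.comp hp)).add
      ((hb.measurable.comp hp).inner (hym.sub (hsm.smul hp)))
  · refine ae_of_all _ fun a η hη => ?_
    have hη' : |η| ≤ 1 / 2 := by simpa using (mem_ball_zero_iff.1 hη).le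
    by_cases ha : R < ‖a‖
    · simp only [F', h0 a ha]
      simp only [zero_mul, zero_smul, sub_zero, inner_zero_right, add_zero, norm_zero]
      positivity
    · have hn := norm_perturbedCode_le hs hy hη' (not_lt.1 ha)
      have e1 := hK _ (mem_closedBall_zero_iff.2 hn)
      have e2 := hK' _ (mem_closedBall_zero_iff.2 hn)
      have e3 : ‖y a - s a • perturbedCode s y η a‖ ≤ C + 2 * (|R| + C) := by
        refine (norm_sub_le _ _).trans (add_le_add (hy a) ?_)
        rw [norm_smul, Real.norm_eq_abs]
        calc |s a| * ‖perturbedCode s y η a‖ ≤ 1 * ‖perturbedCode s y η a‖ := by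
              gcongr; exact hs a
          _ ≤ 2 * (|R| + C) := by linarith [le_abs_self R]
      refine (norm_add_le _ _).trans (add_le_add ?_ ?_)
      · rw [norm_mul]
        calc ‖s a‖ * ‖W (perturbedCode s y η a)‖ ≤ 1 * |K| := by
              gcongr
              · exact hs a
              · exact e1.trans (le_abs_self K)
          _ = |K| := one_mul _
      · refine (norm_inner_le_norm _ _).trans ?_
        gcongr
        exact e2.trans (le_abs_self K')
  · refine ae_of_all _ fun a η hη => ?_
    have hη' : |η| ≤ 1 / 2 := by simpa using (mem_ball_zero_iff.1 hη).le
    exact hasDerivAt_perspective hW (s a) a (y a)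
      (by linarith [half_le_one_add_mul hη' (hs a)] : (0:ℝ) < 1 + η * s a).ne'

end Perspective

section Reassign

variable {A X : Type*} [MeasurableSpace A] [MeasurableSpace X]

/-- The joint law of labels and states in which a fraction `η` of the states in `T` is reassigned
to random labels in `B`. -/
noncomputable def reassign (γ : Measure (A × X)) (T : Set (A × X)) (B : Set A) (η : ℝ) :
    Measure (A × X) :=
  γ.restrict Tᶜ + ENNReal.ofReal (1 - η * γ.fst.real B) • γ.restrict T
    + ENNReal.ofReal η • (γ.fst.restrict B).prod (γ.restrict T).snd

variable {γ : Measure (A × X)} [IsProbabilityMeasure γ] {T : Set (A × X)} {B : Set A} {η : ℝ}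

theorem snd_reassign (hT : MeasurableSet T) (h0 : 0 ≤ η) (h1 : η ≤ 1) :
    (reassign γ T B η).snd = γ.snd := by
  have hβ : γ.fst.real B ≤ 1 := measureReal_le_one
  have hβ0 : 0 ≤ γ.fst.real B := measureReal_nonneg
  have hprod : ((γ.fst.restrict B).prod (γ.restrict T).snd).snd
      = ENNReal.ofReal (γ.fst.real B) • (γ.restrict T).snd := by
    rw [Measure.snd, Measure.map_snd_prod, Measure.restrict_apply_univ, ofReal_measureReal]
  have hsplit : γ.snd = (γ.restrict Tᶜ).snd + (γ.restrict T).snd := by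
    rw [← Measure.snd_add, add_comm, Measure.restrict_add_restrict_compl hT]
  have hsmul : ∀ (c : ENNReal) (m : Measure (A × X)), (c • m).snd = c • m.snd := fun c m => by
    simp [Measure.snd]
  rw [reassign, Measure.snd_add, Measure.snd_add, hsmul, hsmul, hprod, smul_smul, add_assoc,
    ← add_smul, ← ENNReal.ofReal_mul h0, ← ENNReal.ofReal_add (by nlinarith) (by positivity)]
  rw [sub_add_cancel, ENNReal.ofReal_one, one_smul, hsplit]

theorem isProbabilityMeasure_reassign (hT : MeasurableSet T) (h0 : 0 ≤ η) (h1 : η ≤ 1) :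
    IsProbabilityMeasure (reassign γ T B η) :=
  ⟨by rw [← Measure.snd_univ, snd_reassign hT h0 h1, Measure.snd_univ]; exact measure_univ⟩

theorem integral_reassign {F : Type*} [NormedAddCommGroup F] [NormedSpace ℝ F] {f : A × X → F}
    (hT : MeasurableSet T) (h0 : 0 ≤ η) (h1 : η ≤ 1) (hf : Integrable f γ)
    (hf' : Integrable f ((γ.fst.restrict B).prod (γ.restrict T).snd)) :
    ∫ z, f z ∂(reassign γ T B η) = ∫ z, f z ∂γ - (η * γ.fst.real B) • ∫ z in T, f z ∂γ
      + η • ∫ z, f z ∂((γ.fst.restrict B).prod (γ.restrict T).snd) := by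
  have hβ : γ.fst.real B ≤ 1 := measureReal_le_one
  have hβ0 : 0 ≤ γ.fst.real B := measureReal_nonneg
  have i1 := hf.restrict (s := Tᶜ)
  have i2 := hf.restrict (s := T)
  rw [reassign, integral_add_measure (i1.add_measure (i2.smul_measure ENNReal.ofReal_ne_top))
    (hf'.smul_measure ENNReal.ofReal_ne_top),
    integral_add_measure i1 (i2.smul_measure ENNReal.ofReal_ne_top), integral_smul_measure,
    integral_smul_measure, ENNReal.toReal_ofReal (by nlinarith), ENNReal.toReal_ofReal h0,
    ← integral_add_compl hT hf]
  module

end Reassign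

section Shift

variable {L n : ℕ} {𝒳 : Set (E L)} {F : Type*} [NormedAddCommGroup F] [NormedSpace ℝ F]
  {ν : Measure (E n)} [IsProbabilityMeasure ν] {κ : Kernel (E n) 𝒳} [IsMarkovKernel κ]
  {T : Set (E n × 𝒳)} {B : Set (E n)}

/-- The rate at which the integral of `f` over the posterior of a label changes under
`reassign`. -/
noncomputable def shift (ν : Measure (E n)) (κ : Kernel (E n) 𝒳) (T : Set (E n × 𝒳)) (B : Set (E n))
    (f : 𝒳 → F) (a : E n) : F :=
  B.indicator (fun _ => ∫ z in T, f z.2 ∂(ν ⊗ₘ κ)) a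
    - ν.real B • ∫ x, T.indicator (fun z => f z.2) (a, x) ∂κ a

theorem measurable_shift [MeasurableSpace F] [BorelSpace F] [SecondCountableTopology F]
    (hT : MeasurableSet T) (hB : MeasurableSet B) {f : 𝒳 → F} (hf : Measurable f) :
    Measurable (shift ν κ T B f) := by
  refine (measurable_const.indicator hB).sub (Measurable.const_smul ?_ _)
  have : StronglyMeasurable (T.indicator fun z : E n × 𝒳 => f z.2) :=
    ((hf.comp measurable_snd).indicator hT).stronglyMeasurable
  exact (MeasureTheory.StronglyMeasurable.integral_kernel_prod_right' (κ := κ) this).measurable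

theorem norm_setIntegral_le_of_bound {f : 𝒳 → F} {C : ℝ} (hC0 : 0 ≤ C)
    (hC : ∀ z ∈ T, ‖f z.2‖ ≤ C) : ‖∫ z in T, f z.2 ∂(ν ⊗ₘ κ)‖ ≤ C := by
  refine (norm_setIntegral_le_of_norm_le_const (measure_lt_top _ _) hC).trans ?_
  exact mul_le_of_le_one_right hC0 measureReal_le_one

theorem norm_integral_section_le {f : 𝒳 → F} {C : ℝ} (hC0 : 0 ≤ C)
    (hC : ∀ z ∈ T, ‖f z.2‖ ≤ C) (a : E n) :
    ‖∫ x, T.indicator (fun z => f z.2) (a, x) ∂κ a‖ ≤ C := by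
  have h := norm_integral_le_of_norm_le_const (μ := κ a) (C := C)
    (f := fun x => T.indicator (fun z : E n × 𝒳 => f z.2) (a, x)) (ae_of_all _ fun x => ?_)
  · simpa using h
  · by_cases hx : (a, x) ∈ T
    · rw [indicator_of_mem hx]; exact hC _ hx
    · rw [indicator_of_notMem hx, norm_zero]; exact hC0

theorem norm_shift_le {f : 𝒳 → F} {C : ℝ} (hC0 : 0 ≤ C)
    (hC : ∀ z ∈ T, ‖f z.2‖ ≤ C) (a : E n) : ‖shift ν κ T B f a‖ ≤ 2 * C := by
  have hβ : ν.real B ≤ 1 := measureReal_le_one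
  refine (norm_sub_le _ _).trans ?_
  have h1 : ‖B.indicator (fun _ => ∫ z in T, f z.2 ∂(ν ⊗ₘ κ)) a‖ ≤ C :=
    (norm_indicator_le_norm_self _ a).trans (norm_setIntegral_le_of_bound hC0 hC)
  have h2 := norm_integral_section_le (κ := κ) hC0 hC a
  rw [norm_smul, Real.norm_of_nonneg measureReal_nonneg]
  have := norm_nonneg (∫ x, T.indicator (fun z => f z.2) (a, x) ∂κ a)
  nlinarith [measureReal_nonneg (μ := ν) (s := B)]

/-- The masses of the labels stay positive for `|η| < 1`. -/
theorem abs_shift_one_le (a : E n) :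
    |shift ν κ T B (fun _ => (1 : ℝ)) a| ≤ 1 := by
  have hβ : ν.real B ≤ 1 := measureReal_le_one
  have hβ0 : 0 ≤ ν.real B := measureReal_nonneg
  have h1 := norm_setIntegral_le_of_bound (T := T) (ν := ν) (κ := κ)
    (f := fun _ => (1 : ℝ)) zero_le_one (by simp)
  have h2 := norm_integral_section_le (T := T) (κ := κ)
    (f := fun _ => (1 : ℝ)) zero_le_one (by simp) a
  have h3 : 0 ≤ ∫ z in T, (1 : ℝ) ∂(ν ⊗ₘ κ) := integral_nonneg fun _ => zero_le_one
  have h4 : 0 ≤ ∫ x, T.indicator (fun z => (1 : ℝ)) (a, x) ∂κ a :=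
    integral_nonneg fun x => indicator_nonneg (fun _ _ => zero_le_one) _
  rw [Real.norm_of_nonneg h3] at h1
  rw [Real.norm_of_nonneg h4] at h2
  rw [shift, abs_le, smul_eq_mul]
  by_cases ha : a ∈ B
  · rw [indicator_of_mem ha]
    constructor <;> nlinarith
  · rw [indicator_of_notMem ha]
    constructor <;> nlinarith

theorem shift_eq_zero {f : 𝒳 → F} {a : E n} (haB : a ∉ B) (haT : ∀ x, (a, x) ∉ T) :
    shift ν κ T B f a = 0 := by
  simp [shift, haB, haT]

variable [CompleteSpace F]

theorem setIntegral_compProd_eq {f : E n × 𝒳 → F} (hT : MeasurableSet T)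
    (hf : IntegrableOn f T (ν ⊗ₘ κ)) :
    Integrable (fun a => ∫ x, T.indicator f (a, x) ∂κ a) ν ∧
      ∫ z in T, f z ∂(ν ⊗ₘ κ) = ∫ a, ∫ x, T.indicator f (a, x) ∂κ a ∂ν := by
  have h := hf.integrable_indicator hT
  exact ⟨integrable_integral_compProd h,
    by rw [← integral_indicator hT, Measure.integral_compProd h]⟩

/-- The integral over the reassigned joint law, label by label. -/
theorem integral_reassign_compProd {η : ℝ} (h0 : 0 ≤ η) (h1 : η ≤ 1) (hT : MeasurableSet T)
    (hB : MeasurableSet B) {g : 𝒳 → F} (hg : StronglyMeasurable g)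
    (hgi : Integrable (fun z : E n × 𝒳 => g z.2) (ν ⊗ₘ κ))
    {A : E n → F} (hA : Integrable A ν) {c : E n → ℝ} (hc : Measurable c) {C : ℝ}
    (hC : ∀ a, ‖c a‖ ≤ C) :
    Integrable (fun z : E n × 𝒳 => A z.1 + c z.1 • g z.2) (reassign (ν ⊗ₘ κ) T B η) ∧
    ∫ z, (A z.1 + c z.1 • g z.2) ∂(reassign (ν ⊗ₘ κ) T B η)
      = ∫ a, ((1 + η * shift ν κ T B (fun _ => (1 : ℝ)) a) • A a
          + c a • ((∫ x, g x ∂κ a) + η • shift ν κ T B g a)) ∂ν := by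
  set γ := ν ⊗ₘ κ with hγ
  have hfst : γ.fst = ν := Measure.fst_compProd ν κ
  set τ := (γ.restrict T).snd with hτ
  have hτf : IsFiniteMeasure τ := by rw [hτ]; infer_instance
  have hA1 : Integrable (fun z : E n × 𝒳 => A z.1) γ := by
    rw [← hfst] at hA
    exact hA.comp_measurable measurable_fst
  have hcm : Measurable fun z : E n × 𝒳 => c z.1 := hc.comp measurable_fst
  have hcg : Integrable (fun z : E n × 𝒳 => c z.1 • g z.2) γ :=
    hgi.bdd_smul C hcm.aestronglyMeasurable (ae_of_all _ fun z => hC z.1)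
  let f : E n × 𝒳 → F := fun z => A z.1 + c z.1 • g z.2
  have hf : Integrable f γ := hA1.add hcg
  have hgτ : Integrable g τ :=
    (integrable_map_measure hg.aestronglyMeasurable measurable_snd.aemeasurable).2 hgi.restrict
  have eτ : ∫ x, g x ∂τ = ∫ z in T, g z.2 ∂γ :=
    integral_map measurable_snd.aemeasurable hg.aestronglyMeasurable
  have eτ1 : τ.real univ = ∫ z in T, (1 : ℝ) ∂γ := by
    rw [hτ, measureReal_def, Measure.snd_univ]
    simp [measureReal_def]
  have hf' : Integrable f ((ν.restrict B).prod τ) := by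
    refine Integrable.add (hA.restrict.comp_fst τ) ?_
    exact (hgτ.comp_snd (ν.restrict B)).bdd_smul C hcm.aestronglyMeasurable
      (ae_of_all _ fun z => hC z.1)
  have hfull := integrable_integral_compProd hf
  obtain ⟨hTi, hTe⟩ := setIntegral_compProd_eq hT hf.integrableOn
  have e1 : (fun a => ∫ x, f (a, x) ∂κ a)
      =ᵐ[ν] fun a => A a + c a • ∫ x, g x ∂κ a := by
    filter_upwards [((Measure.integrable_compProd_iff hgi.1).1 hgi).1] with a ha
    change ∫ x, A a + c a • g x ∂κ a = _
    rw [integral_add (integrable_const _) (ha.fun_smul _), integral_smul]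
    simp
  have e2 : (fun a => ∫ x, T.indicator f (a, x) ∂κ a) =ᵐ[ν] fun a =>
      (∫ x, T.indicator (fun _ => (1 : ℝ)) (a, x) ∂κ a) • A a
        + c a • ∫ x, T.indicator (fun z => g z.2) (a, x) ∂κ a := by
    filter_upwards [((Measure.integrable_compProd_iff hgi.1).1 hgi).1] with a ha
    have hTa : MeasurableSet (Prod.mk a ⁻¹' T) := measurable_prodMk_left hT
    have i1 : Integrable (fun x => T.indicator (fun _ => (1 : ℝ)) (a, x)) (κ a) :=
      (integrable_const (1 : ℝ)).indicator hTa
    have i2 : Integrable (fun x => T.indicator (fun z => g z.2) (a, x)) (κ a) :=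
      ha.indicator hTa
    rw [← integral_smul_const, ← integral_smul, ← integral_add (i1.smul_const _) (i2.fun_smul _)]
    refine integral_congr_ae (ae_of_all _ fun x => ?_)
    by_cases hx : (a, x) ∈ T <;> simp [hx, f]
  have e3 : ∫ z, f z ∂((ν.restrict B).prod τ)
      = ∫ a, B.indicator
          (fun a => (∫ z in T, (1 : ℝ) ∂γ) • A a + c a • ∫ z in T, g z.2 ∂γ) a ∂ν := by
    rw [integral_prod _ hf', integral_indicator hB]
    refine integral_congr_ae (ae_of_all _ fun a => ?_)
    change ∫ x, A a + c a • g x ∂τ = _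
    rw [integral_add (integrable_const _) (hgτ.fun_smul _), integral_smul, integral_const, eτ, eτ1]
  have i3 : Integrable (B.indicator fun a => (∫ z in T, (1 : ℝ) ∂γ) • A a
      + c a • ∫ z in T, g z.2 ∂γ) ν := by
    refine Integrable.indicator ((hA.smul _).add ?_) hB
    exact (integrable_const _).bdd_smul C hc.aestronglyMeasurable (ae_of_all _ hC)
  have hr := integral_reassign (B := B) hT h0 h1 hf (by rw [hfst]; exact hf')
  have hrest : Integrable f (reassign γ T B η) := by
    refine ((hf.restrict).add_measure (hf.restrict.smul_measure ENNReal.ofReal_ne_top)).add_measure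
      (Integrable.smul_measure ?_ ENNReal.ofReal_ne_top)
    rw [hfst]
    exact hf'
  refine ⟨hrest, ?_⟩
  change ∫ z, f z ∂_ = _
  rw [hr, hTe, Measure.integral_compProd hf, hfst, integral_congr_ae e1, integral_congr_ae e2]
  have hX := hfull.congr e1
  have hY := (hTi.congr e2).smul (η * ν.real B)
  rw [e3, ← integral_smul, ← integral_smul]
  refine ((congrArg (· + _) (integral_sub hX hY).symm).trans
    (integral_add (hX.sub hY) (i3.smul η)).symm).trans ?_
  refine integral_congr_ae (ae_of_all _ fun a => ?_)
  by_cases ha : a ∈ B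
  · simp only [shift, indicator_of_mem ha, smul_eq_mul, ← hγ, Pi.sub_apply, Pi.smul_apply]
    module
  · simp only [shift, indicator_of_notMem ha, smul_eq_mul, Pi.sub_apply, Pi.smul_apply]
    module

end Shift

/-! ### The first-order condition -/

section FirstOrder

variable {L n : ℕ} {𝒳 : Set (E L)} {W : E n → ℝ} {g : 𝒳 → E n}

variable {ν : Measure (E n)} [IsProbabilityMeasure ν] {κ : Kernel (E n) 𝒳} [IsMarkovKernel κ]
  {T : Set (E n × 𝒳)} {B : Set (E n)} {R : ℝ}

/-- The label `a`, drawn from `ν`, is the mean of `g` under the posterior `κ a`, and no joint law of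
labels and states with this property and the same law of states gives a higher mean of `W`. -/
structure IsBestSignal (W : E n → ℝ) (g : 𝒳 → E n) (ν : Measure (E n)) (κ : Kernel (E n) 𝒳) :
    Prop where
  differentiable : Differentiable ℝ W
  continuous_gradient : Continuous (gradient W)
  measurable : Measurable g
  integrable : Integrable (fun z : E n × 𝒳 => g z.2) (ν ⊗ₘ κ)
  mean : ∀ᵐ a ∂ν, ∫ x, g x ∂κ a = a
  integrable_W : Integrable W ν
  le : ∀ γ : ProbabilityMeasure (E n × 𝒳), (γ : Measure (E n × 𝒳)).snd = (ν ⊗ₘ κ).snd →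
      (∀ φ : E n → ℝ, Continuous φ → HasCompactSupport φ →
        ∫ z, φ z.1 • (z.1 - g z.2) ∂(γ : Measure (E n × 𝒳)) = 0) →
      ∫ z, W z.1 ∂(γ : Measure (E n × 𝒳)) ≤ ∫ a, W a ∂ν

/-- The first-order condition: reassigning the states in `T` to labels in `B` does not raise the
value to first order. -/
theorem integral_shift_nonpos (h : IsBestSignal W g ν κ)
    (hT : MeasurableSet T) (hB : MeasurableSet B) (hR : 0 ≤ R)
    (hTR : ∀ z ∈ T, ‖z.1‖ ≤ R ∧ ‖g z.2‖ ≤ R) (hBR : ∀ a ∈ B, ‖a‖ ≤ R) :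
    Integrable (fun a => shift ν κ T B (fun _ => (1 : ℝ)) a * W a
      + ⟪gradient W a, shift ν κ T B g a - shift ν κ T B (fun _ => (1 : ℝ)) a • a⟫) ν ∧
    ∫ a, (shift ν κ T B (fun _ => (1 : ℝ)) a * W a
      + ⟪gradient W a, shift ν κ T B g a - shift ν κ T B (fun _ => (1 : ℝ)) a • a⟫) ∂ν ≤ 0 := by
  obtain ⟨hW, hb, hgm, hgi, hmean, hWi, hmax⟩ := h
  set s := shift ν κ T B (fun _ => (1 : ℝ)) with hs
  set y := shift ν κ T B g with hy
  have hsm : Measurable s := measurable_shift hT hB measurable_const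
  have hym : Measurable y := measurable_shift hT hB hgm
  have hs1 : ∀ a, |s a| ≤ 1 := abs_shift_one_le
  have hy1 : ∀ a, ‖y a‖ ≤ 2 * R := norm_shift_le hR fun z hz => (hTR z hz).2
  have h0 : ∀ a, R < ‖a‖ → s a = 0 ∧ y a = 0 := fun a ha =>
    have haB : a ∉ B := fun h => ha.not_ge (hBR a h)
    have haT : ∀ x, (a, x) ∉ T := fun x h => ha.not_ge (hTR _ h).1
    ⟨shift_eq_zero haB haT, shift_eq_zero haB haT⟩
  obtain ⟨hint, hder⟩ := hasDerivAt_integral_perspective hW hb hWi hsm hym hs1 hy1 h0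
  refine ⟨hint, ?_⟩
  -- For each small `η`, relabelling the reassigned law by the posterior means gives an admissible
  -- law, so its value does not exceed that of the given signal.
  have key : ∀ η ∈ Ioo (0 : ℝ) (1 / 2),
      ∫ a, (1 + η * s a) * W (perturbedCode s y η a) ∂ν ≤ ∫ a, W a ∂ν := by
    intro η hη
    have hη0 : 0 ≤ η := hη.1.le
    have hη1 : η ≤ 1 := by linarith [hη.2]
    have hηa : |η| ≤ 1 / 2 := by rw [abs_of_nonneg hη0]; exact hη.2.le
    set α := perturbedCode s y η with hα
    have hαm : Measurable α := measurable_perturbedCode hsm hym η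
    have hcode := measurable_code (𝒳 := 𝒳) hαm
    have hpr := isProbabilityMeasure_reassign (γ := ν ⊗ₘ κ) (B := B) hT hη0 hη1
    have hpr' : IsProbabilityMeasure ((reassign (ν ⊗ₘ κ) T B η).map fun z => (α z.1, z.2)) :=
      Measure.isProbabilityMeasure_map hcode.aemeasurable
    have hle := hmax ⟨_, hpr'⟩ ?_ ?_
    · have e1 : ∫ z, W z.1 ∂((reassign (ν ⊗ₘ κ) T B η).map fun z => (α z.1, z.2))
          = ∫ z, W (α z.1) ∂(reassign (ν ⊗ₘ κ) T B η) :=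
        integral_map hcode.aemeasurable
          (hW.continuous.measurable.comp measurable_fst).aestronglyMeasurable
      obtain ⟨K, hK⟩ :=
        (isCompact_closedBall (0 : E n) (2 * (R + 2 * R))).exists_bound_of_continuousOn
        hW.continuous.continuousOn
      have hA : Integrable (fun a => W (α a)) ν := by
        refine Integrable.mono' (hWi.norm.add (integrable_const |K|))
          (hW.continuous.measurable.comp hαm).aestronglyMeasurable (ae_of_all _ fun a => ?_)
        simp only [Pi.add_apply]
        by_cases ha : R < ‖a‖
        · rw [hα, perturbedCode_eq_self (h0 a ha)]
          linarith [abs_nonneg K]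
        · have := hK _ (mem_closedBall_zero_iff.2 (norm_perturbedCode_le hs1 hy1 hηa (not_lt.1 ha)))
          linarith [le_abs_self K, norm_nonneg (W a)]
      have e2 := (integral_reassign_compProd (κ := κ) hη0 hη1 hT hB
        (g := fun _ => (0 : ℝ)) stronglyMeasurable_const (by simp) hA
        (c := fun _ => 0) measurable_const (C := 0) (by simp)).2
      simp only [smul_eq_mul, zero_mul, add_zero] at e2
      change ∫ z, W z.1 ∂((reassign (ν ⊗ₘ κ) T B η).map fun z => (α z.1, z.2)) ≤ _ at hle
      rw [e1, e2] at hle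
      exact hle
    · change ((reassign (ν ⊗ₘ κ) T B η).map fun z => (α z.1, z.2)).snd = _
      rw [Measure.snd, Measure.map_map measurable_snd hcode, ← snd_reassign (B := B) hT hη0 hη1]
      rfl
    · intro φ hφ hc
      change ∫ z, φ z.1 • (z.1 - g z.2) ∂((reassign (ν ⊗ₘ κ) T B η).map fun z => (α z.1, z.2)) = 0
      have hm : Measurable fun z : E n × 𝒳 => φ z.1 • (z.1 - g z.2) :=
        (hφ.measurable.comp measurable_fst).smul (measurable_fst.sub (hgm.comp measurable_snd))
      rw [integral_map hcode.aemeasurable hm.aestronglyMeasurable]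
      obtain ⟨C, hC⟩ := hφ.bounded_above_of_compact_support hc
      obtain ⟨C', hC'⟩ := (hφ.smul continuous_id).bounded_above_of_compact_support hc.smul_right
      have hA : Integrable (fun a => φ (α a) • α a) ν :=
        Integrable.mono' (integrable_const C')
          ((hφ.measurable.comp hαm).smul hαm).aestronglyMeasurable
          (ae_of_all _ fun a => hC' (α a))
      have e := (integral_reassign_compProd (κ := κ) hη0 hη1 hT hB hgm.stronglyMeasurable hgi hA
        (c := fun a => -φ (α a)) (hφ.measurable.comp hαm).neg (C := C)
        (fun a => by rw [norm_neg]; exact hC _)).2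
      have e' : ∀ z : E n × 𝒳, φ (α z.1) • (α z.1 - g z.2)
          = φ (α z.1) • α z.1 + (-φ (α z.1)) • g z.2 := fun z => by module
      simp only [e']
      rw [e]
      refine integral_eq_zero_of_ae ?_
      filter_upwards [hmean] with a ha
      have hpos : 0 < 1 + η * s a := by linarith [half_le_one_add_mul hηa (hs1 a)]
      have hαa : (1 + η * s a) • α a = a + η • y a := by
        rw [hα, perturbedCode, smul_inv_smul₀ hpos.ne']
      rw [ha, ← hs, ← hy, ← hαa]
      simp only [Pi.zero_apply]
      module
  have hz : ∫ a, (1 + 0 * s a) * W (perturbedCode s y 0 a) ∂ν = ∫ a, W a ∂ν := by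
    simp [perturbedCode]
  have hslope := (hasDerivAt_iff_tendsto_slope.1 hder).mono_left
    (nhdsWithin_mono 0 (show Ioi (0 : ℝ) ⊆ {0}ᶜ from fun x hx => ne_of_gt hx))
  refine le_of_tendsto hslope ?_
  filter_upwards [Ioo_mem_nhdsGT (show (0 : ℝ) < 1 / 2 by norm_num)] with η hη
  rw [slope_def_field, hz, sub_zero]
  exact div_nonpos_of_nonpos_of_nonneg (sub_nonpos.2 (key η hη)) hη.1.le

/-- The derivative of the value in a label is the rate of change of the integral of the tangent
function: a tangent function is affine, and `shift` is linear. -/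
theorem shift_tangent (hT : MeasurableSet T) {a : E n} (hg : Integrable g (κ a))
    (hgi : Integrable (fun z : E n × 𝒳 => g z.2) (ν ⊗ₘ κ)) :
    shift ν κ T B (fun _ => (1 : ℝ)) a * W a
      + ⟪gradient W a, shift ν κ T B g a - shift ν κ T B (fun _ => (1 : ℝ)) a • a⟫
      = shift ν κ T B (fun x => tangent W a (g x)) a := by
  have htan : ∀ y : E n, tangent W a y = (W a - ⟪gradient W a, a⟫) * 1 + ⟪gradient W a, y⟫ :=
    fun y => by simp only [tangent, inner_sub_right]; ring
  have hTa : MeasurableSet (Prod.mk a ⁻¹' T) := measurable_prodMk_left hT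
  have i1 : Integrable (fun x => T.indicator (fun _ => (1 : ℝ)) (a, x)) (κ a) :=
    (integrable_const (1 : ℝ)).indicator hTa
  have i2 : Integrable (fun x => T.indicator (fun z => g z.2) (a, x)) (κ a) := hg.indicator hTa
  have e1 : ∫ z in T, tangent W a (g z.2) ∂(ν ⊗ₘ κ)
      = (W a - ⟪gradient W a, a⟫) * ∫ z in T, (1 : ℝ) ∂(ν ⊗ₘ κ)
        + ⟪gradient W a, ∫ z in T, g z.2 ∂(ν ⊗ₘ κ)⟫ := by
    simp only [htan]
    rw [integral_add ((integrable_const _).const_mul _) (hgi.restrict.const_inner _),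
      integral_const_mul, integral_inner hgi.restrict]
  have e2 : ∫ x, T.indicator (fun z => tangent W a (g z.2)) (a, x) ∂κ a
      = (W a - ⟪gradient W a, a⟫) * ∫ x, T.indicator (fun _ => (1 : ℝ)) (a, x) ∂κ a
        + ⟪gradient W a, ∫ x, T.indicator (fun z => g z.2) (a, x) ∂κ a⟫ := by
    rw [← integral_const_mul, ← integral_inner i2, ← integral_add (i1.const_mul _)
      (i2.const_inner _)]
    refine integral_congr_ae (ae_of_all _ fun x => ?_)
    by_cases hx : (a, x) ∈ T
    · simp only [indicator_of_mem hx, htan]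
    · simp [indicator_of_notMem hx]
  simp only [shift, e1, e2, smul_eq_mul]
  by_cases ha : a ∈ B
  · simp only [indicator_of_mem ha, inner_sub_right, inner_smul_right]
    ring
  · simp only [indicator_of_notMem ha, inner_sub_right, inner_smul_right, inner_zero_right]
    ring

/-- States that strictly prefer the tangent function at a label `a'` of the support of `ν` to the
tangent function at their own label form a null set. Otherwise it would pay to reassign some of
them to labels near `a'`. -/
theorem IsBestSignal.measure_eq_zero (h : IsBestSignal W g ν κ) {a' : E n} (ha' : a' ∈ ν.support)
    (hR : ‖a'‖ < R) {δ : ℝ} (hδ : 0 < δ) :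
    (ν ⊗ₘ κ) {z | ‖z.1‖ ≤ R ∧ ‖g z.2‖ ≤ R ∧ tangent W z.1 (g z.2) + 2 * δ ≤ tangent W a' (g z.2)}
      = 0 := by
  have hR0 : 0 ≤ R := (norm_nonneg _).trans hR.le
  have hWc := h.differentiable.continuous
  have hbc := h.continuous_gradient
  let H : E n × E n → ℝ := fun q => tangent W q.1 q.2
  have hH : Continuous H := by
    simp only [H, tangent]
    fun_prop
  have hgm2 : Measurable fun z : E n × 𝒳 => g z.2 := h.measurable.comp measurable_snd
  have hh : Measurable fun z : E n × 𝒳 => tangent W z.1 (g z.2) :=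
    hH.measurable.comp (measurable_fst.prodMk hgm2)
  have hh' : Measurable fun z : E n × 𝒳 => tangent W a' (g z.2) :=
    (continuous_tangent_right a').measurable.comp hgm2
  set T : Set (E n × 𝒳) :=
    {z | ‖z.1‖ ≤ R ∧ ‖g z.2‖ ≤ R ∧ tangent W z.1 (g z.2) + 2 * δ ≤ tangent W a' (g z.2)} with hTdef
  have hT : MeasurableSet T :=
    (measurableSet_le measurable_fst.norm measurable_const).inter
      ((measurableSet_le hgm2.norm measurable_const).inter
        (measurableSet_le (hh.add_const _) hh'))
  -- `e b` bounds the difference of the tangent functions at `b` and at `a'` on the ball of radius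
  -- `R`.
  let e : E n → ℝ := fun b => |W b - ⟪gradient W b, b⟫ - (W a' - ⟪gradient W a', a'⟫)|
    + ‖gradient W b - gradient W a'‖ * R
  have he : Continuous e := by
    simp only [e]
    fun_prop
  set B : Set (E n) := {b | ‖b‖ ≤ R ∧ e b ≤ δ} with hBdef
  have hB : MeasurableSet B :=
    (measurableSet_le measurable_norm measurable_const).inter
      (measurableSet_le he.measurable measurable_const)
  have hBpos : 0 < ν.real B := by
    refine ENNReal.toReal_pos (ne_of_gt ?_) (measure_ne_top _ _)
    refine (Measure.mem_support_iff_forall a').1 ha' B ?_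
    have n1 : ∀ᶠ b in 𝓝 a', ‖b‖ < R := continuous_norm.continuousAt.eventually_lt_const hR
    have n2 : ∀ᶠ b in 𝓝 a', e b < δ :=
      he.continuousAt.eventually_lt_const (by simpa [e] using hδ)
    filter_upwards [n1, n2] with b h1 h2 using ⟨h1.le, h2.le⟩
  have hnear : ∀ b ∈ B, ∀ y : E n, ‖y‖ ≤ R → tangent W a' y - δ ≤ tangent W b y := by
    intro b hb y hy
    have e1 : tangent W a' y - tangent W b y
        = -(W b - ⟪gradient W b, b⟫ - (W a' - ⟪gradient W a', a'⟫))
          - ⟪gradient W b - gradient W a', y⟫ := by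
      simp only [tangent, inner_sub_right, inner_sub_left]
      ring
    have e2 := abs_real_inner_le_norm (gradient W b - gradient W a') y
    have e3 : ‖gradient W b - gradient W a'‖ * ‖y‖ ≤ ‖gradient W b - gradient W a'‖ * R := by
      gcongr
    have e4 := neg_le_of_abs_le e2
    have e5 := neg_abs_le (W b - ⟪gradient W b, b⟫ - (W a' - ⟪gradient W a', a'⟫))
    have e6 : e b ≤ δ := hb.2
    simp only [e] at e6
    linarith
  obtain ⟨K, hK⟩ := ((isCompact_closedBall (0 : E n) R).prod
    (isCompact_closedBall (0 : E n) R)).exists_bound_of_continuousOn hH.continuousOn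
  have hint : IntegrableOn (fun z : E n × 𝒳 => tangent W z.1 (g z.2)) T (ν ⊗ₘ κ) := by
    refine Integrable.mono' (integrable_const K) hh.aestronglyMeasurable
      ((ae_restrict_iff' hT).2 (ae_of_all _ fun z hz => ?_))
    exact hK (z.1, g z.2) ⟨mem_closedBall_zero_iff.2 hz.1, mem_closedBall_zero_iff.2 hz.2.1⟩
  have hint' : IntegrableOn (fun z : E n × 𝒳 => tangent W a' (g z.2)) T (ν ⊗ₘ κ) := by
    refine Integrable.mono' (integrable_const K) hh'.aestronglyMeasurable
      ((ae_restrict_iff' hT).2 (ae_of_all _ fun z hz => ?_))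
    exact hK (a', g z.2) ⟨mem_closedBall_zero_iff.2 hR.le, mem_closedBall_zero_iff.2 hz.2.1⟩
  have hintb : ∀ b, ‖b‖ ≤ R → IntegrableOn (fun z : E n × 𝒳 => tangent W b (g z.2)) T (ν ⊗ₘ κ) := by
    intro b hb
    refine Integrable.mono' (integrable_const K)
      ((continuous_tangent_right b).measurable.comp hgm2).aestronglyMeasurable
      ((ae_restrict_iff' hT).2 (ae_of_all _ fun z hz => ?_))
    exact hK (b, g z.2) ⟨mem_closedBall_zero_iff.2 hb, mem_closedBall_zero_iff.2 hz.2.1⟩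
  obtain ⟨hD, hD0⟩ := integral_shift_nonpos h hT hB hR0 (fun z hz => ⟨hz.1, hz.2.1⟩)
    (fun b hb => hb.1)
  obtain ⟨hTi, hTe⟩ := setIntegral_compProd_eq hT hint
  have hint2 : IntegrableOn (fun z : E n × 𝒳 => tangent W a' (g z.2) - δ) T (ν ⊗ₘ κ) :=
    hint'.sub (integrable_const δ)
  set c := ∫ z in T, (tangent W a' (g z.2) - δ) ∂(ν ⊗ₘ κ) with hc
  have hlow : ∫ a, (B.indicator (fun _ => c) a - ν.real B *
      ∫ x, T.indicator (fun z => tangent W z.1 (g z.2)) (a, x) ∂κ a) ∂ν ≤ 0 := by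
    refine (integral_mono_ae (((integrable_const c).indicator hB).sub (hTi.const_mul _))
      hD ?_).trans hD0
    filter_upwards [((Measure.integrable_compProd_iff h.integrable.1).1 h.integrable).1] with a ha
    rw [shift_tangent hT ha h.integrable, shift, smul_eq_mul]
    have e1 : ∫ x, T.indicator (fun z => tangent W z.1 (g z.2)) (a, x) ∂κ a
        = ∫ x, T.indicator (fun z => tangent W a (g z.2)) (a, x) ∂κ a := rfl
    change B.indicator (fun _ => c) a - ν.real B *
      ∫ x, T.indicator (fun z => tangent W z.1 (g z.2)) (a, x) ∂κ a ≤ _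
    rw [e1]
    refine sub_le_sub_right ?_ _
    by_cases haB : a ∈ B
    · rw [indicator_of_mem haB, indicator_of_mem haB]
      exact setIntegral_mono_on hint2 (hintb a haB.1) hT
        fun z hz => hnear a haB _ hz.2.1
    · rw [indicator_of_notMem haB, indicator_of_notMem haB]
  rw [integral_sub ((integrable_const c).indicator hB) (hTi.const_mul _), integral_const_mul, ← hTe,
    integral_indicator hB, setIntegral_const, smul_eq_mul, ← mul_sub, hc,
    ← integral_sub hint2 hint] at hlow
  have h2 : ∫ z in T, δ ∂(ν ⊗ₘ κ) ≤ 0 := by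
    refine le_trans (setIntegral_mono_on (integrable_const δ)
      (hint2.sub hint) hT fun z hz => ?_)
      (nonpos_of_mul_nonpos_right hlow hBpos)
    have := hz.2.2
    change δ ≤ tangent W a' (g z.2) - δ - tangent W z.1 (g z.2)
    linarith
  rw [setIntegral_const, smul_eq_mul] at h2
  have h3 : (ν ⊗ₘ κ).real T = 0 :=
    le_antisymm (nonpos_of_mul_nonpos_left h2 hδ) measureReal_nonneg
  exact (measureReal_eq_zero_iff (measure_ne_top _ _)).1 h3

/-- Almost every state prefers the tangent function at its own label to the tangent functions at
all labels of the support. -/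
theorem IsBestSignal.ae_tangent_le (h : IsBestSignal W g ν κ) :
    ∀ᵐ z ∂(ν ⊗ₘ κ), ∀ a' ∈ ν.support, tangent W a' (g z.2) ≤ tangent W z.1 (g z.2) := by
  -- It suffices to compare with a countable dense set of labels, on bounded sets, and with gaps
  -- bounded from below.
  obtain ⟨D, hDs, hDc, hD⟩ :=
    (TopologicalSpace.IsSeparable.of_separableSpace ν.support).exists_countable_dense_subset
  have h1 : ∀ a' ∈ D, ∀ᵐ z ∂(ν ⊗ₘ κ), tangent W a' (g z.2) ≤ tangent W z.1 (g z.2) := by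
    intro a' ha'
    have h2 := fun k j : ℕ => measure_eq_zero_iff_ae_notMem.1
      (h.measure_eq_zero (R := ‖a'‖ + 1 + k) (hDs ha')
        (by have := Nat.cast_nonneg (α := ℝ) k; linarith)
        (Nat.one_div_pos_of_nat (α := ℝ) (n := j)))
    filter_upwards [ae_all_iff.2 fun k => ae_all_iff.2 (h2 k)] with z hz
    by_contra! hlt
    obtain ⟨j, hj⟩ := exists_nat_one_div_lt
      (show (0 : ℝ) < (tangent W a' (g z.2) - tangent W z.1 (g z.2)) / 2 by linarith)
    obtain ⟨k, hk⟩ := exists_nat_ge (‖z.1‖ + ‖g z.2‖)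
    have n0 := norm_nonneg a'
    have n1 := norm_nonneg z.1
    have n2 := norm_nonneg (g z.2)
    exact hz k j ⟨by linarith, by linarith, by linarith⟩
  filter_upwards [(ae_ball_iff hDc).2 h1] with z hz a' ha'
  have hcl : IsClosed {a : E n | tangent W a (g z.2) ≤ tangent W z.1 (g z.2)} :=
    isClosed_le (continuous_tangent_left h.differentiable.continuous h.continuous_gradient _)
      continuous_const
  exact hcl.closure_subset_iff.2 (fun a ha => hz a ha) (hD ha')

/-- The tangent functions at the labels lie below `W` at all labels of the support. -/
theorem IsBestSignal.tangent_le (h : IsBestSignal W g ν κ) :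
    ∀ a ∈ ν.support, ∀ a' ∈ ν.support, tangent W a' a ≤ W a := by
  have h1 : ∀ᵐ a ∂ν, ∀ a' ∈ ν.support, tangent W a' a ≤ W a := by
    filter_upwards [Measure.ae_ae_of_ae_compProd h.ae_tangent_le, h.mean,
      ((Measure.integrable_compProd_iff h.integrable.1).1 h.integrable).1] with a h1 h2 h3 a' ha'
    have key : ∀ b : E n, Integrable (fun x => tangent W b (g x)) (κ a) ∧
        ∫ x, tangent W b (g x) ∂κ a = tangent W b a := by
      intro b
      have i1 : Integrable (fun x => g x - b) (κ a) := h3.sub (integrable_const b)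
      refine ⟨(integrable_const _).add (i1.const_inner _), ?_⟩
      simp only [tangent]
      rw [integral_add (integrable_const _) (i1.const_inner _), integral_inner i1,
        integral_sub h3 (integrable_const b), h2]
      simp
    rw [← tangent_self (W := W) a, ← (key a).2, ← (key a').2]
    exact integral_mono_ae (key a').1 (key a).1 (h1.mono fun x hx => hx a' ha')
  have hcl : IsClosed {a : E n | ∀ a' ∈ ν.support, tangent W a' a ≤ W a} := by
    simp only [Set.ofPred_forall]
    exact isClosed_iInter fun a' => isClosed_iInter fun _ =>
      isClosed_le (continuous_tangent_right a') h.differentiable.continuous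
  exact fun a ha => Measure.support_subset_of_isClosed hcl h1 ha

end FirstOrder

/-! ### Extreme joint laws are deterministic -/

section Tilt

variable {M : ℕ} {X : Type*} [MeasurableSpace X] {W : E M → X → ℝ} {G : E M → X → E M}
  {p : ProbabilityMeasure X} {γ : Measure (E M × X)} [IsProbabilityMeasure γ] {h : E M × X → ℝ}

/-- The measure with density `1 + h`. -/
noncomputable def tilt (γ : Measure (E M × X)) (h : E M × X → ℝ) : Measure (E M × X) :=
  γ.withDensity fun z => ENNReal.ofReal (1 + h z)

theorem integral_tilt {F : Type*} [NormedAddCommGroup F] [NormedSpace ℝ F] {f : E M × X → F}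
    (hm : Measurable h) (h1 : ∀ z, |h z| ≤ 1) (hf : Integrable f γ) :
    ∫ z, f z ∂(tilt γ h) = ∫ z, f z ∂γ + ∫ z, h z • f z ∂γ := by
  have hhf : Integrable (fun z => h z • f z) γ :=
    hf.bdd_smul 1 hm.aestronglyMeasurable (ae_of_all _ h1)
  rw [tilt, integral_withDensity_eq_integral_toReal_smul (by fun_prop)
    (ae_of_all _ fun z => ENNReal.ofReal_lt_top), ← integral_add hf hhf]
  refine integral_congr_ae (ae_of_all _ fun z => ?_)
  have := neg_le_of_abs_le (h1 z)
  simp only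
  rw [ENNReal.toReal_ofReal (by linarith), add_smul, one_smul]

theorem snd_tilt (hm : Measurable h) (h1 : ∀ z, |h z| ≤ 1)
    (hs : ∀ s, MeasurableSet s → ∫ z in Prod.snd ⁻¹' s, h z ∂γ = 0) : (tilt γ h).snd = γ.snd := by
  have hi : Integrable h γ :=
    Integrable.mono' (integrable_const 1) hm.aestronglyMeasurable (ae_of_all _ h1)
  have hi1 : Integrable (fun z => 1 + h z) γ := (integrable_const 1).add hi
  ext s hsm
  have hsm' : MeasurableSet (Prod.snd ⁻¹' s : Set (E M × X)) := measurable_snd hsm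
  rw [Measure.snd_apply hsm, Measure.snd_apply hsm, tilt, withDensity_apply _ hsm',
    ← ofReal_integral_eq_lintegral_ofReal hi1.restrict
      (ae_of_all _ fun z => by
        have := neg_le_of_abs_le (h1 z)
        simp only [Pi.zero_apply]
        linarith), integral_add (integrable_const _) hi.restrict, hs s hsm]
  simp

/-- A bounded function that is orthogonal to the functions of the state, to the constraint and to
`W` vanishes almost everywhere with respect to an extreme best joint law. -/
theorem ae_eq_zero_of_extreme (hγ : IsJoint G p γ) (hWi : Integrable (fun z => W z.1 z.2) γ)
    (hGi : ∀ φ : E M → ℝ, Continuous φ → HasCompactSupport φ →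
      Integrable (fun z : E M × X => φ z.1 • G z.1 z.2) γ)
    (hext : ∀ γ₁ γ₂ : ProbabilityMeasure (E M × X), IsJoint G p (γ₁ : Measure (E M × X)) →
      IsJoint G p (γ₂ : Measure (E M × X)) →
      ∫ z, W z.1 z.2 ∂(γ₁ : Measure (E M × X)) = ∫ z, W z.1 z.2 ∂γ →
      ∫ z, W z.1 z.2 ∂(γ₂ : Measure (E M × X)) = ∫ z, W z.1 z.2 ∂γ →
      (γ₁ : Measure (E M × X)) + (γ₂ : Measure (E M × X)) = (2 : ENNReal) • γ →
      (γ₁ : Measure (E M × X)) = γ)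
    (hm : Measurable h) (h1 : ∀ z, |h z| ≤ 1)
    (hs : ∀ s, MeasurableSet s → ∫ z in Prod.snd ⁻¹' s, h z ∂γ = 0)
    (hφ : ∀ φ : E M → ℝ, Continuous φ → HasCompactSupport φ →
      ∫ z, h z • φ z.1 • G z.1 z.2 ∂γ = 0)
    (hw : ∫ z, h z * W z.1 z.2 ∂γ = 0) : ∀ᵐ z ∂γ, h z = 0 := by
  -- Both `1 + h` and `1 - h` are densities of admissible joint laws with the same value, and their
  -- mean is `γ`.
  have key : ∀ k : E M × X → ℝ, Measurable k → (∀ z, |k z| ≤ 1) →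
      (∀ s, MeasurableSet s → ∫ z in Prod.snd ⁻¹' s, k z ∂γ = 0) →
      (∀ φ : E M → ℝ, Continuous φ → HasCompactSupport φ →
        ∫ z, k z • φ z.1 • G z.1 z.2 ∂γ = 0) → ∫ z, k z * W z.1 z.2 ∂γ = 0 →
      IsProbabilityMeasure (tilt γ k) ∧ IsJoint G p (tilt γ k) ∧
        ∫ z, W z.1 z.2 ∂(tilt γ k) = ∫ z, W z.1 z.2 ∂γ := by
    intro k hm h1 hs hφ hw
    have hsnd := snd_tilt hm h1 hs
    refine ⟨⟨by rw [← Measure.snd_univ, hsnd, Measure.snd_univ]; exact measure_univ⟩,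
      ⟨hsnd.trans hγ.1, fun φ hc hcs => ?_⟩, ?_⟩
    · rw [integral_tilt hm h1 (hGi φ hc hcs), hγ.2 φ hc hcs, hφ φ hc hcs, add_zero]
    · rw [integral_tilt hm h1 hWi]
      simp only [smul_eq_mul, hw, add_zero]
  obtain ⟨a1, a2, a3⟩ := key h hm h1 hs hφ hw
  obtain ⟨b1, b2, b3⟩ := key (fun z => -h z) hm.neg (fun z => by rw [abs_neg]; exact h1 z)
    (fun s hsm => by rw [integral_neg, hs s hsm, neg_zero])
    (fun φ hc hcs => by simp only [neg_smul]; rw [integral_neg, hφ φ hc hcs, neg_zero])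
    (by simp only [neg_mul]; rw [integral_neg, hw, neg_zero])
  have h2 : tilt γ h = γ := by
    refine hext ⟨_, a1⟩ ⟨_, b1⟩ a2 b2 a3 b3 ?_
    change tilt γ h + tilt γ (fun z => -h z) = _
    rw [tilt, tilt, ← withDensity_add_left (by fun_prop), ← withDensity_const]
    congr 1
    funext z
    have e1 := neg_le_of_abs_le (h1 z)
    have e2 := le_of_abs_le (h1 z)
    simp only [Pi.add_apply]
    rw [← ENNReal.ofReal_add (by linarith) (by linarith),
      show 1 + h z + (1 + -h z) = 2 by ring]
    norm_num
  have h3 : γ.withDensity (fun z => ENNReal.ofReal (1 + h z)) = γ.withDensity 1 := by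
    rw [withDensity_one]; exact h2
  rw [withDensity_eq_iff (by fun_prop) (by fun_prop)
    (by
        have := a1
        rw [tilt] at this
        rw [← setLIntegral_univ, ← withDensity_apply _ MeasurableSet.univ]
        exact measure_ne_top _ _)] at h3
  filter_upwards [h3] with z hz
  simp only [Pi.one_apply, ENNReal.ofReal_eq_one] at hz
  linarith

end Tilt

section Kick

variable {L n : ℕ} {𝒳 : Set (E L)} {p : ProbabilityMeasure 𝒳} {ρ : Kernel 𝒳 (E n)}
  [IsMarkovKernel ρ] {c d : 𝒳 → E n} {h₀ : 𝒳 → ℝ}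

/-- The signed density that moves mass between the atoms `c x` and `d x` of the conditional law
`ρ x` of the code. -/
noncomputable def kick (ρ : Kernel 𝒳 (E n)) (h₀ : 𝒳 → ℝ) (c d : 𝒳 → E n) (z : E n × 𝒳) : ℝ :=
  h₀ z.2 * (({c z.2} : Set (E n)).indicator (fun _ => 1) z.1 * (ρ z.2).real {d z.2}
    - ({d z.2} : Set (E n)).indicator (fun _ => 1) z.1 * (ρ z.2).real {c z.2})

theorem measurable_atom (hc : Measurable c) : Measurable fun x => (ρ x).real {c x} := by
  have hs : MeasurableSet {z : 𝒳 × E n | z.2 = c z.1} :=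
    measurableSet_eq_fun measurable_snd (hc.comp measurable_fst)
  exact (Kernel.measurable_kernel_prodMk_left (κ := ρ) hs).ennreal_toReal

theorem measurable_kick (hh : Measurable h₀) (hc : Measurable c) (hd : Measurable d) :
    Measurable (kick ρ h₀ c d) := by
  have hi : ∀ {e : 𝒳 → E n}, Measurable e → Measurable fun z : E n × 𝒳 =>
      ({e z.2} : Set (E n)).indicator (fun _ => (1 : ℝ)) z.1 := by
    intro e he
    have hs : MeasurableSet {z : E n × 𝒳 | z.1 = e z.2} :=
      measurableSet_eq_fun measurable_fst (he.comp measurable_snd)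
    exact (measurable_const (a := (1 : ℝ))).indicator hs
  exact (hh.comp measurable_snd).mul (((hi hc).mul ((measurable_atom hd).comp measurable_snd)).sub
    ((hi hd).mul ((measurable_atom hc).comp measurable_snd)))

theorem abs_kick_le (hh : ∀ x, |h₀ x| ≤ 1) (z : E n × 𝒳) : |kick ρ h₀ c d z| ≤ 1 := by
  have hi : ∀ (s t : Set (E n)), 0 ≤ s.indicator (fun _ => (1 : ℝ)) z.1 * (ρ z.2).real t ∧
      s.indicator (fun _ => (1 : ℝ)) z.1 * (ρ z.2).real t ≤ 1 := by
    intro s t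
    have h1 : s.indicator (fun _ => (1 : ℝ)) z.1 ≤ 1 :=
      indicator_le_self' (fun _ _ => zero_le_one) _
    have h0 : 0 ≤ s.indicator (fun _ => (1 : ℝ)) z.1 := indicator_nonneg (fun _ _ => zero_le_one) _
    exact ⟨mul_nonneg h0 measureReal_nonneg, mul_le_one₀ h1 measureReal_nonneg measureReal_le_one⟩
  rw [kick, abs_mul]
  refine mul_le_one₀ (hh _) (abs_nonneg _) (abs_le.2 ⟨?_, ?_⟩)
  · linarith [(hi {c z.2} {d z.2}).1, (hi {d z.2} {c z.2}).2]
  · linarith [(hi {c z.2} {d z.2}).2, (hi {d z.2} {c z.2}).1]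

/-- Integration against `kick` compares the values of `f` at the two atoms. -/
theorem integral_kick_smul {F : Type*} [NormedAddCommGroup F] [NormedSpace ℝ F] [CompleteSpace F]
    {γ : Measure (E n × 𝒳)} (hγ : γ = ((p : Measure 𝒳) ⊗ₘ ρ).map Prod.swap)
    (hh : Measurable h₀) (hh1 : ∀ x, |h₀ x| ≤ 1) (hc : Measurable c) (hd : Measurable d)
    {f : E n × 𝒳 → F} (hf : Integrable f γ) :
    ∫ z, kick ρ h₀ c d z • f z ∂γ
      = ∫ x, (h₀ x * ((ρ x).real {c x} * (ρ x).real {d x})) • (f (c x, x) - f (d x, x))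
          ∂(p : Measure 𝒳) := by
  have hkf : Integrable (fun z => kick ρ h₀ c d z • f z) γ :=
    hf.bdd_smul 1 (measurable_kick hh hc hd).aestronglyMeasurable (ae_of_all _ (abs_kick_le hh1))
  rw [hγ] at hkf ⊢
  rw [integral_map measurable_swap.aemeasurable hkf.1]
  have hkf' : Integrable (fun z : 𝒳 × E n => kick ρ h₀ c d z.swap • f z.swap)
      ((p : Measure 𝒳) ⊗ₘ ρ) := (integrable_map_measure hkf.1 measurable_swap.aemeasurable).1 hkf
  rw [Measure.integral_compProd hkf']
  refine integral_congr_ae (ae_of_all _ fun x => ?_)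
  have hind : ∀ (e : E n), Integrable (({e} : Set (E n)).indicator fun a => f (a, x)) (ρ x) ∧
      ∫ a, ({e} : Set (E n)).indicator (fun a => f (a, x)) a ∂ρ x
        = (ρ x).real {e} • f (e, x) := by
    intro e
    constructor
    · rw [integrable_indicator_iff (measurableSet_singleton e)]
      exact integrableOn_singleton enorm_ne_top (measure_lt_top _ _)
    · rw [integral_indicator (measurableSet_singleton e), integral_singleton]
  have hpt : ∀ a, kick ρ h₀ c d (a, x) • f (a, x)
      = (h₀ x * (ρ x).real {d x}) • ({c x} : Set (E n)).indicator (fun a => f (a, x)) a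
        - (h₀ x * (ρ x).real {c x}) • ({d x} : Set (E n)).indicator (fun a => f (a, x)) a := by
    intro a
    simp only [kick]
    by_cases h1 : a = c x <;> by_cases h2 : a = d x <;>
      simp [indicator, h1, h2, sub_smul, mul_sub, -sub_self]
  change ∫ a, kick ρ h₀ c d (a, x) • f (a, x) ∂ρ x = _
  simp only [hpt]
  rw [integral_sub ((hind _).1.fun_smul _) ((hind _).1.fun_smul _), integral_smul, integral_smul,
    (hind _).2, (hind _).2]
  module

/-- An extreme best joint law does not put two atoms, which are functions of `β`, on a set of states
that can be split relative to the σ-algebra of `β`: mass could be moved between the atoms in two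
opposite ways. -/
theorem false_of_two_atoms {W : E n → ℝ} (hW : Continuous W) {g : 𝒳 → E n}
    (hgi : Integrable g (p : Measure 𝒳)) {γ : Measure (E n × 𝒳)} [IsProbabilityMeasure γ]
    (hγ : γ = ((p : Measure 𝒳) ⊗ₘ ρ).map Prod.swap) (hj : IsJoint (fun a x => a - g x) p γ)
    (hWi : Integrable (fun z : E n × 𝒳 => W z.1) γ)
    (hGi : ∀ φ : E n → ℝ, Continuous φ → HasCompactSupport φ →
      Integrable (fun z : E n × 𝒳 => φ z.1 • (z.1 - g z.2)) γ)
    (hext : ∀ γ₁ γ₂ : ProbabilityMeasure (E n × 𝒳),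
      IsJoint (fun a x => a - g x) p (γ₁ : Measure (E n × 𝒳)) →
      IsJoint (fun a x => a - g x) p (γ₂ : Measure (E n × 𝒳)) →
      ∫ z, W z.1 ∂(γ₁ : Measure (E n × 𝒳)) = ∫ z, W z.1 ∂γ →
      ∫ z, W z.1 ∂(γ₂ : Measure (E n × 𝒳)) = ∫ z, W z.1 ∂γ →
      (γ₁ : Measure (E n × 𝒳)) + (γ₂ : Measure (E n × 𝒳)) = (2 : ENNReal) • γ →
      (γ₁ : Measure (E n × 𝒳)) = γ)
    {β : 𝒳 → E n} (hβ : Measurable β) {C D : E n → E n} (hC : Measurable C) (hD : Measurable D)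
    {K : ℝ} (hCK : ∀ b, ‖C b‖ ≤ K) (hDK : ∀ b, ‖D b‖ ≤ K) {Z : Set 𝒳} (hZ : MeasurableSet Z)
    (hZ0 : (p : Measure 𝒳) Z ≠ 0)
    (hZa : ∀ x ∈ Z, 0 < (ρ x).real {C (β x)} ∧ 0 < (ρ x).real {D (β x)} ∧ C (β x) ≠ D (β x))
    (hsplit : ∀ Z' ⊆ Z, MeasurableSet Z' → (p : Measure 𝒳) Z' ≠ 0 → ∃ Z₁ ⊆ Z', MeasurableSet Z₁ ∧
      (p : Measure 𝒳) {x | 0 < ((p : Measure 𝒳)[Z₁.indicator (fun _ => (1 : ℝ)) |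
          MeasurableSpace.comap β inferInstance]) x ∧
        0 < ((p : Measure 𝒳)[(Z' \ Z₁).indicator (fun _ => (1 : ℝ)) |
          MeasurableSpace.comap β inferInstance]) x} ≠ 0) : False := by
  have hc : Measurable fun x => C (β x) := hC.comp hβ
  have hd : Measurable fun x => D (β x) := hD.comp hβ
  -- The transfer `h₀` has to be conditionally orthogonal to the functions `w` and `w gⱼ`, where
  -- `w` is the product of the masses of the two atoms. The index `none` stands for the function
  -- `1`.
  let w : 𝒳 → ℝ := fun x => (ρ x).real {C (β x)} * (ρ x).real {D (β x)}
  have hwm : Measurable w := (measurable_atom hc).mul (measurable_atom hd)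
  have hw1 : ∀ x, ‖w x‖ ≤ 1 := fun x => by
    rw [Real.norm_of_nonneg (mul_nonneg measureReal_nonneg measureReal_nonneg)]
    exact mul_le_one₀ measureReal_le_one measureReal_nonneg measureReal_le_one
  let u : Option (Fin n) → 𝒳 → ℝ := fun o x => w x * o.elim 1 fun j => g x j
  have hu : ∀ o, Integrable (u o) (p : Measure 𝒳) := by
    intro o
    have h1 : Integrable (fun x => o.elim 1 fun j => g x j) (p : Measure 𝒳) := by
      cases o with
      | none => exact integrable_const 1
      | some j => exact (EuclideanSpace.proj (𝕜 := ℝ) j).integrable_comp hgi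
    exact h1.bdd_mul hwm.aestronglyMeasurable (ae_of_all _ hw1)
  obtain ⟨h₀, h₀m, h₀1, h₀Z, h₀0, h₀u⟩ := exists_condExp_mul_eq_zero hβ.comap_le hsplit
    Finset.univ u (fun o _ => hu o) Z subset_rfl hZ hZ0
  have hhu : ∀ o, Integrable (h₀ * u o) (p : Measure 𝒳) := fun o =>
    (hu o).bdd_mul h₀m.aestronglyMeasurable (ae_of_all _ h₀1)
  have horth : ∀ o, ∀ φ : E n → ℝ, Measurable φ → ∀ B : ℝ, (∀ b, |φ b| ≤ B) →
      Integrable (fun x => φ (β x) * (h₀ * u o) x) (p : Measure 𝒳) ∧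
        ∫ x, φ (β x) * (h₀ * u o) x ∂(p : Measure 𝒳) = 0 := fun o φ hφ B hB =>
    ⟨(hhu o).bdd_mul (hφ.comp hβ).aestronglyMeasurable (ae_of_all _ fun x => hB (β x)),
      integral_mul_comp_eq_zero hβ (hhu o) (h₀u o (Finset.mem_univ o)) hφ hB⟩
  have hbdd : ∀ φ : E n → ℝ, Continuous φ → ∃ B : ℝ, ∀ b, |φ (C b)| ≤ B ∧ |φ (D b)| ≤ B := by
    intro φ hφ
    obtain ⟨B, hB⟩ :=
      (isCompact_closedBall (0 : E n) K).exists_bound_of_continuousOn hφ.continuousOn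
    exact ⟨B, fun b => ⟨hB _ (mem_closedBall_zero_iff.2 (hCK b)),
      hB _ (mem_closedBall_zero_iff.2 (hDK b))⟩⟩
  have hdiff : ∀ o, ∀ φ : E n → ℝ, Continuous φ →
      Integrable (fun x => (φ (C (β x)) - φ (D (β x))) * (h₀ * u o) x) (p : Measure 𝒳) ∧
        ∫ x, (φ (C (β x)) - φ (D (β x))) * (h₀ * u o) x ∂(p : Measure 𝒳) = 0 := by
    intro o φ hφ
    obtain ⟨B, hB⟩ := hbdd φ hφ
    exact horth o (fun b => φ (C b) - φ (D b))
      ((hφ.measurable.comp hC).sub (hφ.measurable.comp hD)) (B + B)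
      fun b => (abs_sub _ _).trans (add_le_add (hB b).1 (hB b).2)
  have hzero := ae_eq_zero_of_extreme (W := fun a _ => W a) (G := fun a x => a - g x)
    (h := kick ρ h₀ (fun x => C (β x)) fun x => D (β x)) hj hWi hGi hext
    (measurable_kick h₀m hc hd) (abs_kick_le h₀1) ?_ ?_ ?_
  · rw [hγ, ae_map_iff measurable_swap.aemeasurable
      (measurableSet_eq_fun (measurable_kick h₀m hc hd) measurable_const)] at hzero
    refine h₀0 (measure_eq_zero_iff_ae_notMem.2 ?_)
    filter_upwards [Measure.ae_ae_of_ae_compProd hzero] with x hx hne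
    by_cases hxZ : x ∈ Z
    · obtain ⟨h1, h2, h3⟩ := hZa x hxZ
      have hat : kick ρ h₀ (fun x => C (β x)) (fun x => D (β x)) (C (β x), x) = 0 := by
        by_contra hcon
        refine h1.ne' ?_
        rw [measureReal_def, measure_mono_null (singleton_subset_iff.2 hcon) hx]
        rfl
      simp only [kick, indicator_of_mem (mem_singleton _),
        indicator_of_notMem (show C (β x) ∉ ({D (β x)} : Set (E n)) from h3), one_mul, zero_mul,
        sub_zero, mul_eq_zero] at hat
      exact hat.elim hne h2.ne'
    · exact hne (h₀Z x hxZ)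
  · intro s hs
    have hs' : MeasurableSet (Prod.snd ⁻¹' s : Set (E n × 𝒳)) := measurable_snd hs
    have hf : Integrable ((Prod.snd ⁻¹' s : Set (E n × 𝒳)).indicator fun _ => (1 : ℝ)) γ :=
      (integrable_const 1).indicator hs'
    have h1 := integral_kick_smul hγ h₀m h₀1 hc hd hf
    rw [← integral_indicator hs']
    refine Eq.trans (integral_congr_ae (ae_of_all _ fun z => ?_)) (h1.trans ?_)
    · by_cases hz : z ∈ (Prod.snd ⁻¹' s : Set (E n × 𝒳))
      · simp only [indicator_of_mem hz, smul_eq_mul, mul_one]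
      · simp only [indicator_of_notMem hz, smul_eq_mul, mul_zero]
    · refine integral_eq_zero_of_ae (ae_of_all _ fun x => ?_)
      have e : (Prod.snd ⁻¹' s : Set (E n × 𝒳)).indicator (fun _ => (1 : ℝ)) (C (β x), x)
          = (Prod.snd ⁻¹' s : Set (E n × 𝒳)).indicator (fun _ => (1 : ℝ)) (D (β x), x) := rfl
      simp only [e, sub_self, smul_zero, Pi.zero_apply]
  · intro φ hφ hφc
    rw [integral_kick_smul hγ h₀m h₀1 hc hd (hGi φ hφ hφc)]
    by_cases hV : Integrable (fun x => (h₀ x * ((ρ x).real {C (β x)} * (ρ x).real {D (β x)})) •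
        (φ (C (β x)) • (C (β x) - g x) - φ (D (β x)) • (D (β x) - g x))) (p : Measure 𝒳)
    · ext j
      have e1 := (EuclideanSpace.proj (𝕜 := ℝ) j : E n →L[ℝ] ℝ).integral_comp_comm hV
      refine e1.symm.trans ?_
      obtain ⟨i1, e2⟩ := hdiff none (fun a => φ a * a j)
        (hφ.mul (EuclideanSpace.proj (𝕜 := ℝ) j : E n →L[ℝ] ℝ).continuous)
      obtain ⟨i2, e3⟩ := hdiff (some j) φ hφ
      have e4 := integral_sub i1 i2
      rw [e2, e3, sub_zero] at e4
      refine Eq.trans (integral_congr_ae (ae_of_all _ fun x => ?_)) e4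
      change h₀ x * ((ρ x).real {C (β x)} * (ρ x).real {D (β x)}) *
        (φ (C (β x)) * (C (β x) j - g x j) - φ (D (β x)) * (D (β x) j - g x j)) = _
      simp only [u, w, Pi.mul_apply, Option.elim_none, Option.elim_some]
      ring
    · exact integral_undef hV
  · obtain ⟨-, e⟩ := hdiff none W hW
    refine (integral_kick_smul hγ h₀m h₀1 hc hd hWi).trans (Eq.trans ?_ e)
    refine integral_congr_ae (ae_of_all _ fun x => ?_)
    simp only [u, w, Pi.mul_apply, Option.elim_none, smul_eq_mul]
    ring

end Kick

section Deterministic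

variable {L n : ℕ} {𝒳 : Set (E L)} {W : E n → ℝ} {g : 𝒳 → E n}

/-- The branches can be replaced by Borel maps on the whole space. Their domains are arbitrary sets,
so this uses that a function measurable for the σ-algebra of the inclusion factors through the
space. -/
theorem FinitelyManyInverseBranches.exists_measurable {F : E n → E n}
    (h : FinitelyManyInverseBranches F) :
    ∃ (k : ℕ) (C : Fin k → E n → E n), (∀ i, Measurable (C i)) ∧ ∀ a, ∃ i, a = C i (F a) := by
  obtain ⟨k, D, B, hB, hF⟩ := h
  -- A continuous map on an arbitrary set `D i` is the restriction of a Borel map.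
  have hext : ∀ i, ∃ C : E n → E n, Measurable C ∧ ∀ b ∈ D i, C b = B i b := by
    intro i
    have h1 : Measurable ((D i).domRestrict (B i)) :=
      (continuousOn_iff_continuous_domRestrict.1 (hB i)).measurable
    obtain ⟨C, hC, hCe⟩ := Measurable.exists_eq_measurable_comp (f := (Subtype.val : D i → E n)) h1
    exact ⟨C, hC, fun b hb => (congrFun hCe ⟨b, hb⟩).symm⟩
  choose C hC hCe using hext
  refine ⟨k, C, hC, fun a => ?_⟩
  obtain ⟨i, hi, ha⟩ := (hF a (F a)).1 rfl
  exact ⟨i, by rw [hCe i _ hi]; exact ha⟩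

/-- A probability measure on finitely many points that does not have two atoms is concentrated at
one point. -/
theorem exists_ae_eq_of_atoms {μ : Measure (E n)} [IsProbabilityMeasure μ] {k : ℕ} {c : Fin k → E n}
    (hc : ∀ᵐ a ∂μ, ∃ i, a = c i)
    (h : ∀ i j, 0 < μ.real {c i} → 0 < μ.real {c j} → c i = c j) : ∃ a₀, ∀ᵐ a ∂μ, a = a₀ := by
  have hpos : ∀ᵐ a ∂μ, ∀ i, a = c i → 0 < μ.real {c i} := by
    refine ae_all_iff.2 fun i => ?_
    by_cases hi : 0 < μ.real {c i}
    · exact ae_of_all _ fun _ _ => hi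
    · have h0 : μ {c i} = 0 :=
        (measureReal_eq_zero_iff (measure_ne_top _ _)).1
          (le_antisymm (not_lt.1 hi) measureReal_nonneg)
      filter_upwards [measure_eq_zero_iff_ae_notMem.1 h0] with a ha hai
      exact absurd hai ha
  obtain ⟨a₁, ⟨i, hi⟩, hp⟩ := (hc.and hpos).exists
  refine ⟨c i, ?_⟩
  filter_upwards [hc, hpos] with a ⟨j, hj⟩ hpa
  rw [hj]
  exact h j i (hpa j hj) (hp i hi)

/-- The form of `volume_eq_zero_of_slide` for sets of states. -/
theorem measure_eq_zero_of_slide {μ : Measure 𝒳} (hg : MeasurableEmbedding g)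
    (hac : μ.map g ≪ volume) (hW : Continuous W) (hb : Continuous (gradient W)) {Ξ : Set (E n)}
    (hΞ : ∀ a ∈ Ξ, ∀ a' ∈ Ξ, tangent W a' a ≤ W a) {Z : Set 𝒳} (hZ : MeasurableSet Z)
    {c : 𝒳 → E n} (hc : Measurable c) (hcΞ : ∀ x ∈ Z, c x ∈ Ξ)
    (hopt : ∀ x ∈ Z, ∀ a' ∈ Ξ, tangent W a' (g x) ≤ tangent W (c x) (g x))
    (hsharp : ∀ x ∈ Z, IsSharpAt W Ξ (c x) (g x)) (hne : ∀ x ∈ Z, c x ≠ g x)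
    (hinj : InjOn (fun x => gradient W (c x)) Z) : μ Z = 0 := by
  have he : ∀ x, Function.extend g c 0 (g x) = c x := fun x => hg.injective.extend_apply c 0 x
  have h0 : volume (g '' Z) = 0 := by
    refine volume_eq_zero_of_slide (c := Function.extend g c 0) hW hb hΞ
      (hg.measurableSet_image.2 hZ) (hg.measurable_extend hc measurable_const) ?_ ?_ ?_ ?_ ?_
    · rintro _ ⟨x, hx, rfl⟩
      rw [he]; exact hcΞ x hx
    · rintro _ ⟨x, hx, rfl⟩
      rw [he]; exact hopt x hx
    · rintro _ ⟨x, hx, rfl⟩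
      rw [he]; exact hsharp x hx
    · rintro _ ⟨x, hx, rfl⟩
      rw [he]; exact hne x hx
    · rintro _ ⟨x, hx, rfl⟩ _ ⟨y, hy, rfl⟩ hxy
      simp only [he] at hxy
      rw [hinj hx hy hxy]
  have h1 := hac h0
  rwa [hg.map_apply, preimage_image_eq _ hg.injective] at h1

/-- Under an extreme best joint law the code is a function of the state. -/
theorem ae_deterministic {p : ProbabilityMeasure 𝒳} {ρ : Kernel 𝒳 (E n)} [IsMarkovKernel ρ]
    (hW : Continuous W) (hb : Continuous (gradient W))
    (hfin : FinitelyManyInverseBranches (gradient W)) (hg : MeasurableEmbedding g)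
    (hac : (p : Measure 𝒳).map g ≪ volume)
    (hgi : Integrable g (p : Measure 𝒳)) {γ : Measure (E n × 𝒳)} [IsProbabilityMeasure γ]
    (hγ : γ = ((p : Measure 𝒳) ⊗ₘ ρ).map Prod.swap) (hj : IsJoint (fun a x => a - g x) p γ)
    (hWi : Integrable (fun z : E n × 𝒳 => W z.1) γ)
    (hGi : ∀ φ : E n → ℝ, Continuous φ → HasCompactSupport φ →
      Integrable (fun z : E n × 𝒳 => φ z.1 • (z.1 - g z.2)) γ)
    (hext : ∀ γ₁ γ₂ : ProbabilityMeasure (E n × 𝒳),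
      IsJoint (fun a x => a - g x) p (γ₁ : Measure (E n × 𝒳)) →
      IsJoint (fun a x => a - g x) p (γ₂ : Measure (E n × 𝒳)) →
      ∫ z, W z.1 ∂(γ₁ : Measure (E n × 𝒳)) = ∫ z, W z.1 ∂γ →
      ∫ z, W z.1 ∂(γ₂ : Measure (E n × 𝒳)) = ∫ z, W z.1 ∂γ →
      (γ₁ : Measure (E n × 𝒳)) + (γ₂ : Measure (E n × 𝒳)) = (2 : ENNReal) • γ →
      (γ₁ : Measure (E n × 𝒳)) = γ)
    {Ξ : Set (E n)} (hΞ : ∀ a ∈ Ξ, ∀ a' ∈ Ξ, tangent W a' a ≤ W a)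
    (hopt : ∀ᵐ x ∂(p : Measure 𝒳), ∀ᵐ a ∂ρ x,
      a ∈ Ξ ∧ ∀ a' ∈ Ξ, tangent W a' (g x) ≤ tangent W a (g x)) :
    ∀ᵐ x ∂(p : Measure 𝒳), ∃ a₀, ∀ᵐ a ∂ρ x, a = a₀ := by
  obtain ⟨k, C, hC, hCF⟩ := hfin.exists_measurable
  set β : 𝒳 → E n := fun x => gradient (envelope W Ξ) (g x) with hβdef
  have hβ : Measurable β := (measurable_gradient _).comp hg.measurable
  have hsharp : ∀ᵐ x ∂(p : Measure 𝒳), ∀ a ∈ Ξ,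
      (∀ a' ∈ Ξ, tangent W a' (g x) ≤ tangent W a (g x)) →
      gradient W a = β x ∧ IsSharpAt W Ξ a (g x) :=
    ae_of_ae_map hg.measurable.aemeasurable (hac.ae_le (ae_isSharpAt W Ξ))
  have hgood := hopt.and hsharp
  have hatom : ∀ {x : 𝒳} {a : E n}, (∀ᵐ a ∂ρ x,
      a ∈ Ξ ∧ ∀ a' ∈ Ξ, tangent W a' (g x) ≤ tangent W a (g x)) → 0 < (ρ x).real {a} →
      a ∈ Ξ ∧ ∀ a' ∈ Ξ, tangent W a' (g x) ≤ tangent W a (g x) := by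
    intro x a hx ha
    by_contra hcon
    refine ha.ne' ?_
    rw [measureReal_def, measure_mono_null (singleton_subset_iff.2 hcon) hx]
    rfl
  have hm : ∀ i, Measurable fun x => C i (β x) := fun i => (hC i).comp hβ
  -- `Zset i j K` is the set of states for which branches `i` and `j` give two different atoms of
  -- norm at most `K`, and the first of them differs from `g x`.
  let Zset : Fin k → Fin k → ℕ → Set 𝒳 := fun i j K =>
    {x | 0 < (ρ x).real {C i (β x)}} ∩ {x | 0 < (ρ x).real {C j (β x)}} ∩
      {x | C i (β x) ≠ C j (β x)} ∩ {x | ‖C i (β x)‖ ≤ K} ∩ {x | ‖C j (β x)‖ ≤ K} ∩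
      {x | C i (β x) ≠ g x}
  have hZset : ∀ i j K, MeasurableSet (Zset i j K) := fun i j K =>
    (((((measurableSet_lt measurable_const (measurable_atom (hm i))).inter
      (measurableSet_lt measurable_const (measurable_atom (hm j)))).inter
      (measurableSet_eq_fun (hm i) (hm j)).compl).inter
      (measurableSet_le (hm i).norm measurable_const)).inter
      (measurableSet_le (hm j).norm measurable_const)).inter
      (measurableSet_eq_fun (hm i) hg.measurable).compl
  have hnull : ∀ i j K, (p : Measure 𝒳) (Zset i j K) = 0 := by
    intro i j K
    by_contra hpos
    obtain ⟨N, hN, hNm, hN0⟩ := exists_measurable_superset_of_null (ae_iff.1 hgood)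
    set Z := Zset i j K \ N with hZdef
    have hZ : MeasurableSet Z := (hZset i j K).diff hNm
    have hZ0 : (p : Measure 𝒳) Z ≠ 0 := by rwa [hZdef, measure_sdiff_null hN0]
    have hgoodZ : ∀ x ∈ Z, (∀ᵐ a ∂ρ x,
        a ∈ Ξ ∧ ∀ a' ∈ Ξ, tangent W a' (g x) ≤ tangent W a (g x)) ∧ ∀ a ∈ Ξ,
        (∀ a' ∈ Ξ, tangent W a' (g x) ≤ tangent W a (g x)) →
        gradient W a = β x ∧ IsSharpAt W Ξ a (g x) := by
      intro x hx
      by_contra hcon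
      exact hx.2 (hN hcon)
    -- The branches are truncated to make them bounded.
    let T : (E n → E n) → E n → E n := fun c => {b | ‖c b‖ ≤ (K : ℝ)}.indicator c
    have hTm : ∀ c, Measurable c → Measurable (T c) := fun c hc =>
      hc.indicator (measurableSet_le hc.norm measurable_const)
    have hTK : ∀ c b, ‖T c b‖ ≤ (K : ℝ) := by
      intro c b
      by_cases hcb : ‖c b‖ ≤ (K : ℝ)
      · simp only [T]
        rwa [indicator_of_mem (by exact hcb)]
      · simp only [T]
        rw [indicator_of_notMem (by exact hcb), norm_zero]
        exact Nat.cast_nonneg K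
    have hTe : ∀ {c : E n → E n} {b}, ‖c b‖ ≤ (K : ℝ) → T c b = c b := fun hcb =>
      indicator_of_mem (by exact hcb) _
    refine false_of_two_atoms hW hgi hγ hj hWi hGi hext hβ (hTm _ (hC i)) (hTm _ (hC j))
      (hTK _) (hTK _) hZ hZ0 (fun x hx => ?_) ?_
    · obtain ⟨⟨⟨⟨⟨h1, h2⟩, h3⟩, h4⟩, h5⟩, -⟩ := hx.1
      rw [hTe h4, hTe h5]
      exact ⟨h1, h2, h3⟩
    · intro Z' hZ' hZ'm hZ'0
      by_contra! hns
      obtain ⟨N', hN'm, hN'0, hinj⟩ := exists_injOn_of_not_split (μ := (p : Measure 𝒳)) hβ hZ'm hns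
      refine hZ'0 ?_
      rw [← measure_sdiff_null hN'0]
      have hc : ∀ x ∈ Z' \ N', C i (β x) ∈ Ξ ∧
          (∀ a' ∈ Ξ, tangent W a' (g x) ≤ tangent W (C i (β x)) (g x)) ∧
          gradient W (C i (β x)) = β x ∧ IsSharpAt W Ξ (C i (β x)) (g x) := by
        intro x hx
        obtain ⟨h1, h2⟩ := hgoodZ x (hZ' hx.1)
        obtain ⟨e1, e2⟩ := hatom h1 (hZ' hx.1).1.1.1.1.1.1
        exact ⟨e1, e2, h2 _ e1 e2⟩
      refine measure_eq_zero_of_slide hg hac hW hb hΞ (hZ'm.diff hN'm) (hm i)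
        (fun x hx => (hc x hx).1)
        (fun x hx => (hc x hx).2.1) (fun x hx => (hc x hx).2.2.2) (fun x hx => (hZ' hx.1).1.2) ?_
      intro x hx y hy hxy
      simp only [(hc x hx).2.2.1, (hc y hy).2.2.1] at hxy
      exact hinj hx hy hxy
  have hnull' : ∀ᵐ x ∂(p : Measure 𝒳), ∀ i j K, x ∉ Zset i j K :=
    ae_all_iff.2 fun i => ae_all_iff.2 fun j => ae_all_iff.2 fun K =>
      measure_eq_zero_iff_ae_notMem.1 (hnull i j K)
  filter_upwards [hgood, hnull'] with x hx hx0
  refine exists_ae_eq_of_atoms (c := fun i => C i (β x)) ?_ ?_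
  · filter_upwards [hx.1] with a ha
    obtain ⟨i, hi⟩ := hCF a
    exact ⟨i, by rw [← (hx.2 a ha.1 ha.2).1]; exact hi⟩
  · intro i j hi hj
    by_contra hij
    obtain ⟨K, hK⟩ := exists_nat_ge (max ‖C i (β x)‖ ‖C j (β x)‖)
    have hKi := (le_max_left _ _).trans hK
    have hKj := (le_max_right _ _).trans hK
    by_cases hgx : C i (β x) = g x
    · exact hx0 j i K ⟨⟨⟨⟨⟨hj, hi⟩, fun h => hij h.symm⟩, hKj⟩, hKi⟩,
        fun h => hij (hgx.trans h.symm)⟩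
    · exact hx0 i j K ⟨⟨⟨⟨⟨hi, hj⟩, hij⟩, hKi⟩, hKj⟩, hgx⟩

end Deterministic

/-! ### The deterministic optimal autoencoder -/

section Final

variable {L n : ℕ} {𝒳 : Set (E L)} {W : E n → ℝ} {g : 𝒳 → E n}

theorem regularConstraint_sub (hg : Measurable g) :
    RegularConstraint (fun (a : E n) (x : 𝒳) => a - g x) 1 where
  measurable := measurable_fst.sub (hg.comp measurable_snd)
  pos := one_pos
  lipschitz x a b := by simp
  monotone := ⟨1, abs_one, fun x a b => by simp⟩

theorem continuous_gradient (hW : ContDiff ℝ 1 W) : Continuous (gradient W) :=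
  (InnerProductSpace.toDual ℝ (E n)).symm.continuous.comp (hW.continuous_fderiv one_ne_zero)

variable {Ξ : Set (E n)} {𝒜 : 𝒳 → E n} {S : Set 𝒳}

theorem monotoneMapOn_extend (hg : Function.Injective g) (hΞ : ∀ x ∈ S, 𝒜 x ∈ Ξ)
    (hopt : ∀ x ∈ S, ∀ a ∈ Ξ, tangent W a (g x) ≤ tangent W (𝒜 x) (g x)) :
    MonotoneMapOn (Function.extend g (fun x => gradient W (𝒜 x)) 0) (g '' S) := by
  rintro _ ⟨x, hx, rfl⟩ _ ⟨y, hy, rfl⟩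
  rw [hg.extend_apply, hg.extend_apply, inner_sub_left, ← tangent_sub, ← tangent_sub]
  linarith [hopt x hx _ (hΞ y hy), hopt y hy _ (hΞ x hx)]

/-- The level set through `g x₀` consists of the points at which no tangent function exceeds the one
at the code of `x₀`. -/
theorem convexLevelSetsOn_extend (hg : Function.Injective g) (hΞ : ∀ x ∈ S, 𝒜 x ∈ Ξ)
    (hopt : ∀ x ∈ S, ∀ a ∈ Ξ, tangent W a (g x) ≤ tangent W (𝒜 x) (g x))
    (hsharp : ∀ x ∈ S, IsSharpAt W Ξ (𝒜 x) (g x)) :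
    ConvexLevelSetsOn (Function.extend g (fun x => gradient W (𝒜 x)) 0) (g '' S) := by
  intro b
  by_cases hb : ∃ x₀ ∈ S, gradient W (𝒜 x₀) = b
  · obtain ⟨x₀, hx₀, rfl⟩ := hb
    refine ⟨{z | ∀ a ∈ Ξ, tangent W a z ≤ tangent W (𝒜 x₀) z}, ?_, ?_⟩
    · intro y hy z hz s t hs ht hst a ha
      rw [tangent_combo _ _ _ hst, tangent_combo _ _ _ hst]
      have h1 := hy a ha
      have h2 := hz a ha
      gcongr
    · ext z
      constructor
      · rintro ⟨⟨x, hx, rfl⟩, hF⟩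
        rw [hg.extend_apply] at hF
        refine ⟨fun a ha => (hopt x hx a ha).trans ?_, ⟨x, hx, rfl⟩⟩
        have e1 := tangent_sub (W := W) (𝒜 x) (g x) (g x₀)
        have e2 := tangent_sub (W := W) (𝒜 x₀) (g x) (g x₀)
        rw [hF, ← e2] at e1
        linarith [hopt x₀ hx₀ _ (hΞ x hx)]
      · rintro ⟨hz, ⟨x, hx, rfl⟩⟩
        refine ⟨⟨x, hx, rfl⟩, ?_⟩
        rw [hg.extend_apply]
        exact ((hsharp x hx).gradient_eq (hΞ x₀ hx₀) (hz _ (hΞ x hx))).symm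
  · refine ⟨∅, convex_empty, ?_⟩
    rw [empty_inter, eq_empty_iff_forall_notMem]
    rintro _ ⟨⟨x, hx, rfl⟩, hF⟩
    rw [hg.extend_apply] at hF
    exact hb ⟨x, hx, hF⟩

/-- Disintegrating a best joint law along the code yields a best signal. -/
theorem IsJoint.isBestSignal [StandardBorelSpace 𝒳] [Nonempty 𝒳] {p : ProbabilityMeasure 𝒳}
    {ψ : 𝒳 → ℝ} {f : ℝ → ℝ} (h : Growth (fun a _ => W a) (fun a x => a - g x) p 1 ψ f)
    (hW : ContDiff ℝ 1 W) (hg : Measurable g) {γ : Measure (E n × 𝒳)} [IsProbabilityMeasure γ]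
    (hγ : IsJoint (fun a x => a - g x) p γ)
    (hmax : ∀ γ' : ProbabilityMeasure (E n × 𝒳),
      IsJoint (fun a x => a - g x) p (γ' : Measure (E n × 𝒳)) →
      ∫ z, W z.1 ∂(γ' : Measure (E n × 𝒳)) ≤ ∫ z, W z.1 ∂γ) :
    IsBestSignal W g γ.fst γ.condKernel := by
  have hG := regularConstraint_sub hg
  obtain ⟨e1, e2, e3⟩ := hγ.exists_signal h hG
  have hd : γ.fst ⊗ₘ γ.condKernel = γ := γ.disintegrate γ.condKernel
  obtain ⟨-, w2, w3⟩ := h.integral_W_jointLaw hG e1 measurable_id e2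
  have hi := h.integrable_zero_snd hG hγ.1
  refine ⟨hW.differentiable one_ne_zero, continuous_gradient hW, hg, ?_, ?_, by simpa using w2, ?_⟩
  · rw [hd]
    simpa using hi.neg
  · filter_upwards [e2] with a ha
    have h1 : Integrable g (γ.condKernel a) := by
      refine ((integrable_const a).sub ha.1).congr (ae_of_all _ fun x => ?_)
      simp
    have h2 := ha.2
    simp only [id_eq] at h2
    rw [integral_sub (integrable_const a) h1] at h2
    simpa using (sub_eq_zero.1 h2).symm
  · intro γ' hs hc
    rw [hd] at hs
    refine (hmax γ' ⟨hs.trans hγ.1, hc⟩).trans_eq ?_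
    rw [e3] at w3
    simpa using w3

theorem exists_isDeterministicOptimal (h𝒳 : MeasurableSet 𝒳) {p : ProbabilityMeasure 𝒳}
    (hg : MeasurableEmbedding g) (hac : (p : Measure 𝒳).map g ≪ volume)
    (hint : IntegrabilityAssumption (fun a _ => W a) p g 1)
    (hfin : FinitelyManyInverseBranches (gradient W)) :
    ∃ 𝒜 : 𝒳 → E n, IsDeterministicOptimal (fun a _ => W a) (fun a x => a - g x) p 𝒜 ∧
      ∃ S : Set 𝒳, (∀ᵐ x ∂(p : Measure 𝒳), x ∈ S) ∧
        MonotoneMapOn (Function.extend g (fun x => gradient W (𝒜 x)) 0) (g '' S) ∧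
        ConvexLevelSetsOn (Function.extend g (fun x => gradient W (𝒜 x)) 0) (g '' S) := by
  have := h𝒳.standardBorel
  have hne : Nonempty 𝒳 := nonempty_of_isProbabilityMeasure (p : Measure 𝒳)
  have hG := regularConstraint_sub hg.measurable
  obtain ⟨ψ, f, h⟩ := IntegrabilityAssumption.exists_growth (W := fun a _ => W a) hG
    (aStar := g) (fun x => sub_self _) (by simpa using hint)
  have hW : ContDiff ℝ 1 W := hint.contDiff hne.some
  have hb := continuous_gradient hW
  obtain ⟨γ₀, hj, hmax, hext⟩ := exists_extreme_joint h hG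
  set γ : Measure (E n × 𝒳) := (γ₀ : Measure (E n × 𝒳)) with hγdef
  obtain ⟨e1, e2, e3⟩ := hj.exists_signal h hG
  have hd : γ.fst ⊗ₘ γ.condKernel = γ := γ.disintegrate γ.condKernel
  have hbest := hj.isBestSignal h hW hg.measurable hmax
  set Ξ := γ.fst.support with hΞdef
  -- The conditional law of the code given the state.
  set ρ := (γ.map Prod.swap).condKernel with hρ
  have hfst : (γ.map Prod.swap).fst = (p : Measure 𝒳) := by rw [Measure.fst_map_swap]; exact hj.1
  have hswap : (p : Measure 𝒳) ⊗ₘ ρ = γ.map Prod.swap := by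
    rw [← hfst]
    exact (γ.map Prod.swap).disintegrate (γ.map Prod.swap).condKernel
  have hγ : γ = ((p : Measure 𝒳) ⊗ₘ ρ).map Prod.swap := by
    rw [hswap, Measure.map_map measurable_swap measurable_swap]
    simp
  have hsupp : ∀ᵐ z ∂γ, z.1 ∈ Ξ :=
    ae_of_ae_map measurable_fst.aemeasurable Measure.support_mem_ae
  have hle : ∀ᵐ z ∂γ, ∀ a' ∈ Ξ, tangent W a' (g z.2) ≤ tangent W z.1 (g z.2) := by
    have := hbest.ae_tangent_le
    rwa [hd] at this
  have hopt : ∀ᵐ x ∂(p : Measure 𝒳), ∀ᵐ a ∂ρ x,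
      a ∈ Ξ ∧ ∀ a' ∈ Ξ, tangent W a' (g x) ≤ tangent W a (g x) := by
    have h1 := hsupp.and hle
    rw [hγ] at h1
    exact Measure.ae_ae_of_ae_compProd (ae_of_ae_map measurable_swap.aemeasurable h1)
  have hgi : Integrable g (p : Measure 𝒳) := by
    simpa using (h.integrable_zero hG h.integrable_gauge).neg
  have hWi : Integrable (fun z : E n × 𝒳 => W z.1) γ := by
    have := (h.integrable_dom hG e1 measurable_id e2).1
    rw [e3] at this
    exact h.integrable_W_of_dom this
  have hdet := ae_deterministic hW.continuous hb hfin hg hac hgi hγ hj hWi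
    (fun φ hφ hc => integrable_smul_constraint hG (h.integrable_zero_snd hG hj.1) hφ hc)
    (fun γ₁ γ₂ h1 h2 h3 h4 h5 => congrArg _ (hext γ₁ γ₂ h1 h2 h3 h4 h5))
    hbest.tangent_le hopt
  -- The conditional law of the code is a point mass almost surely; its mean is a Borel choice of
  -- the point.
  let 𝒜 : 𝒳 → E n := fun x => ∫ a, a ∂ρ x
  have h𝒜 : Measurable 𝒜 :=
    (MeasureTheory.StronglyMeasurable.integral_kernel_prod_right' (κ := ρ)
      (f := fun z : 𝒳 × E n => z.2) measurable_snd.stronglyMeasurable).measurable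
  have hdirac : ∀ᵐ x ∂(p : Measure 𝒳), ∀ᵐ a ∂ρ x, a = 𝒜 x := by
    filter_upwards [hdet] with x ⟨a₀, ha₀⟩
    have : 𝒜 x = a₀ := by
      simp only [𝒜]
      rw [integral_congr_ae ha₀]
      simp
    rw [this]
    exact ha₀
  have hpair : Measurable fun x => (𝒜 x, x) := h𝒜.prodMk measurable_id
  have hlaw : (p : Measure 𝒳).map (fun x => (𝒜 x, x)) = γ := by
    have hae : ∀ᵐ z ∂((p : Measure 𝒳) ⊗ₘ ρ), z.2 = 𝒜 z.1 :=
      (Measure.ae_compProd_iff (measurableSet_eq_fun measurable_snd (h𝒜.comp measurable_fst))).2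
        hdirac
    have hcongr : ((p : Measure 𝒳) ⊗ₘ ρ).map Prod.swap
        = ((p : Measure 𝒳) ⊗ₘ ρ).map ((fun x => (𝒜 x, x)) ∘ Prod.fst) := by
      refine Measure.map_congr ?_
      filter_upwards [hae] with z hz
      simp only [Function.comp_apply, ← hz]
      rfl
    rw [hγ, hcongr, ← Measure.map_map hpair measurable_fst]
    congr 1
    exact (Measure.fst_compProd _ _).symm
  have hν : γ.fst = (p : Measure 𝒳).map 𝒜 := by
    rw [← hlaw, Measure.fst, Measure.map_map measurable_fst hpair]
    rfl
  refine ⟨𝒜, ⟨h𝒜, γ.condKernel, inferInstance, ?_, ?_, posteriorLaw γ.fst γ.condKernel, ?_, ?_⟩,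
    {x | 𝒜 x ∈ Ξ ∧ (∀ a ∈ Ξ, tangent W a (g x) ≤ tangent W (𝒜 x) (g x)) ∧
      IsSharpAt W Ξ (𝒜 x) (g x)}, ?_, ?_, ?_⟩
  · rw [hlaw, ← hν, hd]
  · rw [hν] at e2
    exact ae_of_ae_map h𝒜.aemeasurable e2
  · change γ.fst.map (posterior γ.condKernel) = _
    rw [hν, Measure.map_map measurable_posterior h𝒜]
    rfl
  · refine isOptimal_posteriorLaw h hG e1 measurable_id e2 ?_
    rw [e3]
    exact hmax
  · have hsharp : ∀ᵐ x ∂(p : Measure 𝒳), ∀ a ∈ Ξ,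
        (∀ a' ∈ Ξ, tangent W a' (g x) ≤ tangent W a (g x)) →
        gradient W a = gradient (envelope W Ξ) (g x) ∧ IsSharpAt W Ξ a (g x) :=
      ae_of_ae_map hg.measurable.aemeasurable (hac.ae_le (ae_isSharpAt W Ξ))
    filter_upwards [hopt, hdirac, hsharp] with x h1 h2 h3
    obtain ⟨a, ha, rfl⟩ := (h1.and h2).exists
    exact ⟨ha.1, ha.2, (h3 _ ha.1 ha.2).2⟩
  · exact monotoneMapOn_extend hg.injective (fun x hx => hx.1) fun x hx => hx.2.1
  · exact convexLevelSetsOn_extend hg.injective (fun x hx => hx.1) (fun x hx => hx.2.1)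
      fun x hx => hx.2.2

end Final

end Autoencoder

theorem mainTheorem2 {L : ℕ} {𝒳 : Set (Autoencoder.E L)} (h𝒳 : MeasurableSet 𝒳)
    (p : ProbabilityMeasure 𝒳)
    (hp : (p : Measure 𝒳) ≪ (volume : Measure (Autoencoder.E L)).comap Subtype.val) :
    -- existence of an optimal autoencoder
    (∀ (M : ℕ) (W : Autoencoder.E M → 𝒳 → ℝ) (G : Autoencoder.E M → 𝒳 → Autoencoder.E M)
      (aStar : 𝒳 → Autoencoder.E M) (ε : ℝ),
      Autoencoder.ConstraintAssumption G p aStar ε →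
      Autoencoder.IntegrabilityAssumption W p aStar (ε ^ 4)⁻¹ →
      ∃ τ : ProbabilityMeasure (ProbabilityMeasure 𝒳), Autoencoder.IsOptimal W G p τ) ∧
    -- a deterministic one in the moment case
    (∀ (W : Autoencoder.E L → ℝ) (g : 𝒳 → Autoencoder.E L) (K K' : NNReal),
      LipschitzWith K g → AntilipschitzWith K' g → Convex ℝ (Set.range g) →
      Autoencoder.IntegrabilityAssumption (fun a _ => W a) p g 1 →
      Autoencoder.FinitelyManyInverseBranches (gradient W) →
      ∃ 𝒜 : 𝒳 → Autoencoder.E L,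
        Autoencoder.IsDeterministicOptimal (fun a _ => W a) (fun a x => a - g x) p 𝒜 ∧
        -- `x ↦ D_aW(𝒜(g⁻¹(x)))` on `g(𝒳)`, for almost every state
        ∃ S : Set 𝒳, (∀ᵐ x ∂(p : Measure 𝒳), x ∈ S) ∧
          Autoencoder.MonotoneMapOn (Function.extend g (fun x => gradient W (𝒜 x)) 0) (g '' S) ∧
          Autoencoder.ConvexLevelSetsOn
            (Function.extend g (fun x => gradient W (𝒜 x)) 0) (g '' S)) := by
  have := h𝒳.standardBorel
  have hne : Nonempty 𝒳 := nonempty_of_isProbabilityMeasure (p : Measure 𝒳)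
  refine ⟨fun M W G aStar ε hG hW => ?_, fun W g K K' hg hg' _ hint hfin => ?_⟩
  · obtain ⟨ψ, f, h⟩ := hW.exists_growth hG.regular hG.solves
    exact Autoencoder.exists_isOptimal h hG.regular
  · exact Autoencoder.exists_isDeterministicOptimal h𝒳
      (hg.continuous.measurable.measurableEmbedding hg'.injective)
      (Autoencoder.absolutelyContinuous_map h𝒳 hp hg.continuous.measurable hg') hint hfin
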